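/- **Setting.** Let $T>0$, $I=(0,T)$, $n,m\in\mathbb N$, and let $W_T=H^1(I;\mathbb R^n)$ carry the norm $\|y\|_{W_T}^2=\|\dot y\|_{L^2(I)}^2+\|y\|_{L^2(I)}^2$; elements of $W_T$ are identified with their continuous representatives on $[0,T]$, and $\imath:W_T\to C([0,T];\mathbb R^n)$ is the embedding. Let $f:[0,T]\times\mathbb R^n\to\mathbb R^n$, $g:[0,T]\times\mathbb R^n\to\mathbb R^{n\times m}$, $Q_1,Q_2\in\mathbb R^{n\times n}$, $\beta>0$, $y_d\in L^2(I;\mathbb R^n)$, $y_d^T\in\mathbb R^n$. Let $Y_0\subset\mathbb R^n$ be compact with positive Lebesgue measure, let $\mathcal L$ be the normalized Lebesgue measure on $Y_0$, and let $\omega\in L^\infty(Y_0)$ satisfy $\omega\ge c>0$ a.e. for some constant $c$. For $t\in[0,T]$ put $$J_{t}(y,u)=\tfrac12\int_{t}^T\big(|Q_1(y(s)-y_d(s))|^2+\beta|u(s)|^2\big)\,ds+\tfrac12|Q_2(y(T)-y_d^T)|^2,\qquad J=J_0 .$$ For $T_0\in[0,T)$ let $V^*(T_0,x)$ be the infimum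 of $J_{T_0}(y,u)$ over $y\in H^1(T_0,T;\mathbb R^n)$, $u\in L^2(T_0,T;\mathbb R^m)$ with $\dot y=f(\cdot,y)+g(\cdot,y)u$ a.e. and $y(T_0)=x$; and let $V^*(T,x)=\frac12|Q_2(x-y_d^T)|^2$. Denote by $(P_{x})$ the minimization problem for $T_0=0$. **Assumption 1.** (A.1) $f,g$ are $C^2$ on $[0,T]\times\mathbb R^n$, and their first and second derivatives in $y$ are Lipschitz in $y$ on compact sets, uniformly in $t$. (A.2) For some $M>0$ and $\widehat M=M\|\imath\|$, $V^*$ is $C^2$ on $[0,T]\times\bar B_{2\widehat M}(0)$, with $\partial_yV^*$ and $\partial_{yy}V^*$ Lipschitz in $y$ uniformly in $t$. With $F^*(t,y)=-\frac1\beta g(t,y)^\top\partial_yV^*(t,y)$ and $\mathcal F^*(y)(t)=F^*(t,y(t))$: (A.3) for every $y_0\in Y_0$ there is a unique $y=\mathbf y^*(y_0)\in W_T$ with $\dot y=f(\cdot,y)+g(\cdot,y)\mathcal F^*(y)$, $y(0)=y_0$, $\|y\|_{W_T}\le M$, and $(\mathbf y^*(y_0),\mathcal F^*(\mathbf y^*(y_0)))$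 solves $(P_{y_0})$. **Assumption 2.** There is $\varepsilon_0>0$ such that, for every $\varepsilon\in(0,\varepsilon_0]$, $\mathcal R_\varepsilon$ is a finite-dimensional real Hilbert space and $(\theta,t,y)\mapsto V^\varepsilon_\theta(t,y)$ is $C^4$ on $\mathcal R_\varepsilon\times\mathbb R\times\mathbb R^n$ with $V^\varepsilon_\theta(T,y)=\frac12|Q_2(y-y_d^T)|^2$. There are $\theta_\varepsilon\in\mathcal R_\varepsilon$ and $c>0$ independent of $\varepsilon$ such that, for all $\varepsilon\in(0,\varepsilon_0]$, $t\in[0,T]$ and $|y|\le2\widehat M$, $$|V^\varepsilon_{\theta_\varepsilon}-V^*|(t,y)+|\partial_y(V^\varepsilon_{\theta_\varepsilon}-V^*)|(t,y)+\|\partial_{yy}(V^\varepsilon_{\theta_\varepsilon}-V^*)\|(t,y)\le c\,\varepsilon .$$ Moreover $\gamma_\varepsilon>0$ for $\varepsilon\in(0,\varepsilon_0]$, and $\gamma_\varepsilon\|\theta_\varepsilon\|^2_{\mathcal R_\varepsilon}=O(\varepsilon)$ as $\varepsilon\downarrow0$. **Learning problem.** Put $\mathcal F^\varepsilon_\theta(y)(t)=-\frac1\beta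 g(t,y(t))^\top\partial_yV^\varepsilon_\theta(t,y(t))$ and, for $\gamma_1,\gamma_2\ge0$, $$J_\varepsilon(y,p,\theta)=J(y,\mathcal F^\varepsilon_\theta(y))+\int_0^T\Big(\tfrac{\gamma_1}2|V^\varepsilon_\theta(t,y(t))-J_t(y,\mathcal F^\varepsilon_\theta(y))|^2+\tfrac{\gamma_2}2|\partial_yV^\varepsilon_\theta(t,y(t))-p(t)|^2\Big)dt .$$ Let $\|\mathbf y\|_{W^{1,2}}^2=\int_{Y_0}\big(\|\mathbf y\|_{W_T}^2+\sum_{i=1}^n\|\partial_i\mathbf y\|_{W_T}^2\big)d\mathcal L$ and fix constants $M_W,M_U>0$ with $\|\mathbf y^*\|_{W^{1,2}}\le M_W$ and $\|\mathcal F^*(\mathbf y^*)\|_{L^\infty(Y_0;L^2(I;\mathbb R^m))}\le M_U$. Problem $(\hat{\mathcal P}_\varepsilon)$ is to minimize $$\int_{Y_0}\omega(y_0)J_\varepsilon(\mathbf y(y_0),\mathbf p(y_0),\theta)\,d\mathcal L(y_0)+\tfrac{\gamma_\varepsilon}2\|\theta\|^2_{\mathcal R_\varepsilon}$$ over $\mathbf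 y\in C^1(Y_0;W_T)$, $\mathbf p\in C(Y_0;W_T)$, $\theta\in\mathcal R_\varepsilon$ such that $\|\mathbf y(y_0)\|_{W_T}\le2M$ for all $y_0\in Y_0$, $\|\mathbf y\|_{W^{1,2}}\le2M_W$, $\mathcal F^\varepsilon_\theta(\mathbf y)\in L^\infty(Y_0;L^2(I;\mathbb R^m))$ with norm at most $2M_U$, and, for $\mathcal L$-a.e. $y_0$, the functions $y=\mathbf y(y_0)$, $p=\mathbf p(y_0)$ and $u=\mathcal F^\varepsilon_\theta(y)$ satisfy $$\dot y=f(\cdot,y)+g(\cdot,y)u,\quad y(0)=y_0,$$ $$-\dot p=D_yf(\cdot,y)^\top p+[D_yg(\cdot,y)^\top u]\,p+Q_1^\top Q_1(y-y_d),\quad p(T)=Q_2^\top Q_2(y(T)-y_d^T),$$ where $D_yg(t,y)^\top u$ is the transpose of the Jacobian of $x\mapsto g(t,x)u$ at $y$. **Proposition.** Let Assumptions 1 and 2 hold, let $\gamma_1,\gamma_2>0$, let $(\varepsilon_k)\subset(0,\varepsilon_0]$ be strictly decreasing with $\varepsilon_k\to0$, and for each $k$ let $(\mathbf y_k^*,\mathbf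 p_k^*,\theta_k^*)$ be a minimizing triple of $(\hat{\mathcal P}_{\varepsilon_k})$. Suppose that $(\mathbf y_k^*,\mathbf p_k^*,\mathcal F^{\varepsilon_k}_{\theta_k^*}(\mathbf y_k^*))\to(\bar{\mathbf y},\bar{\mathbf p},\bar{\mathbf u})$ strongly in $L^2(Y_0;W_T)^2\times L^2(Y_0;L^2(I;\mathbb R^m))$. Then $$V^{\varepsilon_k}_{\theta_k^*}(\cdot,\mathbf y_k^*)\to V^*(\cdot,\bar{\mathbf y})\ \text{ in }L^2(Y_0;L^2(I)),\qquad \partial_yV^{\varepsilon_k}_{\theta_k^*}(\cdot,\mathbf y_k^*)\to\bar{\mathbf p}\ \text{ in }L^2(Y_0;L^2(I;\mathbb R^n)).$$ -/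

import Mathlib

open MeasureTheory Set Filter Topology
open scoped ENNReal ContDiff

noncomputable section

/-! ### The Sobolev space of trajectories -/

/-- `ℝⁿ` with the Euclidean norm. -/
abbrev Vec (n : ℕ) : Type := EuclideanSpace ℝ (Fin n)

/-- Lebesgue measure on the open interval `(a, b)`. -/
abbrev timeMeasure (a b : ℝ) : Measure ℝ := volume.restrict (Ioo a b)

/-- `L²((a, b); F)`. -/
abbrev L2 (a b : ℝ) (F : Type*) [NormedAddCommGroup F] : Type _ := Lp F 2 (timeMeasure a b)

/-- Test functions on `(a, b)`. -/
def IsTest (a b : ℝ) (φ : ℝ → ℝ) : Prop :=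
  ContDiff ℝ ∞ φ ∧ HasCompactSupport φ ∧ tsupport φ ⊆ Ioo a b

theorem L2.integrable {a b : ℝ} {n : ℕ} (v : L2 a b (Vec n)) :
    Integrable (v : ℝ → Vec n) (timeMeasure a b) :=
  (Lp.memLp v).integrable one_le_two

theorem IsTest.integrable_smul {a b : ℝ} {φ : ℝ → ℝ} (hφ : IsTest a b φ) {n : ℕ}
    (v : L2 a b (Vec n)) :
    Integrable (fun t => φ t • (v : ℝ → Vec n) t) (timeMeasure a b) :=
  v.integrable.locallyIntegrable.integrable_smul_left_of_hasCompactSupport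
    hφ.1.continuous hφ.2.1

theorem IsTest.deriv {a b : ℝ} {φ : ℝ → ℝ} (hφ : IsTest a b φ) : IsTest a b (deriv φ) :=
  ⟨(contDiff_infty_iff_deriv.mp hφ.1).2, hφ.2.1.deriv,
    (tsupport_deriv_subset).trans hφ.2.2⟩

/-- The Sobolev space `H¹((a, b); ℝⁿ)`: the pairs `(y, ẏ) ∈ L² × L²` such that `ẏ` is the
distributional derivative of `y`.  The norm it inherits is `(‖y‖² + ‖ẏ‖²)^{1/2}`. -/
def sobolev (a b : ℝ) (n : ℕ) : Submodule ℝ (WithLp 2 (L2 a b (Vec n) × L2 a b (Vec n))) where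
  carrier := {z | ∀ φ : ℝ → ℝ, IsTest a b φ →
    ∫ t, deriv φ t • (z.fst : ℝ → Vec n) t ∂(timeMeasure a b)
      = -∫ t, φ t • (z.snd : ℝ → Vec n) t ∂(timeMeasure a b)}
  zero_mem' := by
    intro φ _
    have h : ∀ᵐ t ∂(timeMeasure a b), ((0 : L2 a b (Vec n)) : ℝ → Vec n) t = 0 :=
      Lp.coeFn_zero _ _ _
    have h1 : ∀ᵐ t ∂(timeMeasure a b), deriv φ t • ((0 : L2 a b (Vec n)) : ℝ → Vec n) t = 0 := by
      filter_upwards [h] with t ht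
      rw [ht]
      exact smul_zero _
    have h2 : ∀ᵐ t ∂(timeMeasure a b), φ t • ((0 : L2 a b (Vec n)) : ℝ → Vec n) t = 0 := by
      filter_upwards [h] with t ht
      rw [ht]
      exact smul_zero _
    exact (integral_eq_zero_of_ae h1).trans
      ((neg_eq_zero.mpr (integral_eq_zero_of_ae h2)).symm)
  add_mem' := by
    intro z w hz hw φ hφ
    have h1 : ∫ t, deriv φ t • ((z + w).fst : ℝ → Vec n) t ∂(timeMeasure a b)
        = ∫ t, (deriv φ t • (z.fst : ℝ → Vec n) t + deriv φ t • (w.fst : ℝ → Vec n) t)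
          ∂(timeMeasure a b) := by
      apply integral_congr_ae
      filter_upwards [Lp.coeFn_add z.fst w.fst] with t ht
      rw [WithLp.add_fst, ht, Pi.add_apply, smul_add]
    have h2 : ∫ t, φ t • ((z + w).snd : ℝ → Vec n) t ∂(timeMeasure a b)
        = ∫ t, (φ t • (z.snd : ℝ → Vec n) t + φ t • (w.snd : ℝ → Vec n) t)
          ∂(timeMeasure a b) := by
      apply integral_congr_ae
      filter_upwards [Lp.coeFn_add z.snd w.snd] with t ht
      rw [WithLp.add_snd, ht, Pi.add_apply, smul_add]
    rw [h1, h2, integral_add (hφ.deriv.integrable_smul _) (hφ.deriv.integrable_smul _),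
      integral_add (hφ.integrable_smul _) (hφ.integrable_smul _), hz φ hφ, hw φ hφ, neg_add]
  smul_mem' := by
    intro c z hz φ hφ
    have h1 : ∫ t, deriv φ t • ((c • z).fst : ℝ → Vec n) t ∂(timeMeasure a b)
        = ∫ t, c • (deriv φ t • (z.fst : ℝ → Vec n) t) ∂(timeMeasure a b) := by
      apply integral_congr_ae
      filter_upwards [Lp.coeFn_smul c z.fst] with t ht
      rw [WithLp.smul_fst, ht, Pi.smul_apply, smul_comm]
    have h2 : ∫ t, φ t • ((c • z).snd : ℝ → Vec n) t ∂(timeMeasure a b)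
        = ∫ t, c • (φ t • (z.snd : ℝ → Vec n) t) ∂(timeMeasure a b) := by
      apply integral_congr_ae
      filter_upwards [Lp.coeFn_smul c z.snd] with t ht
      rw [WithLp.smul_snd, ht, Pi.smul_apply, smul_comm]
    rw [h1, h2, integral_smul, integral_smul, hz φ hφ, smul_neg]

/-- The Hilbert space `H¹((a, b); ℝⁿ)`; for `(a, b) = (0, T)` this is `W_T`. -/
abbrev H1 (a b : ℝ) (n : ℕ) : Type := ↥(sobolev a b n)

namespace H1

variable {a b : ℝ} {n : ℕ}

/-- The `L²` function underlying an element of `H¹`. -/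
def fn (y : H1 a b n) : ℝ → Vec n := (y.1.fst : ℝ → Vec n)

/-- The distributional derivative. -/
def der (y : H1 a b n) : ℝ → Vec n := (y.1.snd : ℝ → Vec n)

/-- The continuous representative, written as `t ↦ y(a) + ∫ₐᵗ ẏ`, where the constant `y(a)` is
the mean value over `(a, b)` of the (a.e. constant) function `s ↦ y(s) - ∫ₐˢ ẏ`. -/
def rep (y : H1 a b n) (t : ℝ) : Vec n :=
  (b - a)⁻¹ • (∫ s in a..b, (y.fn s - ∫ r in a..s, y.der r)) + ∫ r in a..t, y.der r

theorem intervalIntegrable_der (hab : a < b) (y : H1 a b n) :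
    IntervalIntegrable y.der volume a b := by
  rw [intervalIntegrable_iff_integrableOn_Ioo_of_le hab.le]
  exact L2.integrable _

theorem intervalIntegrable_fn (hab : a < b) (y : H1 a b n) :
    IntervalIntegrable y.fn volume a b := by
  rw [intervalIntegrable_iff_integrableOn_Ioo_of_le hab.le]
  exact L2.integrable _

theorem continuousOn_primitive (hab : a < b) (y : H1 a b n) :
    ContinuousOn (fun t => ∫ r in a..t, y.der r) (Icc a b) := by
  have h := intervalIntegral.continuousOn_primitive_interval'
    (y.intervalIntegrable_der hab) (left_mem_uIcc)
  rwa [uIcc_of_le hab.le] at h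

theorem continuousOn_rep (hab : a < b) (y : H1 a b n) : ContinuousOn y.rep (Icc a b) :=
  continuousOn_const.add (y.continuousOn_primitive hab)

/-- Integration by parts of a primitive against a test function. -/
theorem integral_deriv_smul_primitive (hab : a < b) {v : ℝ → Vec n}
    (hv : IntervalIntegrable v volume a b) {φ : ℝ → ℝ} (hφ : IsTest a b φ) :
    ∫ t in a..b, deriv φ t • (∫ r in a..t, v r) = -∫ t in a..b, φ t • v t := by
  have hIcc : uIcc a b = Icc a b := uIcc_of_le hab.le
  have hprim : ContinuousOn (fun t => ∫ r in a..t, v r) (uIcc a b) :=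
    intervalIntegral.continuousOn_primitive_interval' hv left_mem_uIcc
  have hφa : φ a = 0 := by
    by_contra h
    exact absurd (hφ.2.2 (subset_tsupport φ h)).1 (lt_irrefl _)
  have hφb : φ b = 0 := by
    by_contra h
    exact absurd (hφ.2.2 (subset_tsupport φ h)).2 (lt_irrefl _)
  have hφc : Continuous φ := hφ.1.continuous
  have hdc : Continuous (deriv φ) := hφ.deriv.1.continuous
  have hi1 : IntervalIntegrable (fun t => deriv φ t • (∫ r in a..t, v r)) volume a b :=
    (hdc.continuousOn.smul hprim).intervalIntegrable
  have hi2 : IntervalIntegrable (fun t => φ t • v t) volume a b :=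
    hv.continuousOn_smul hφc.continuousOn
  refine ext_inner_left ℝ fun e => ?_
  have hve : IntervalIntegrable (fun t => inner ℝ e (v t)) volume a b :=
    ⟨hv.1.const_inner e, hv.2.const_inner e⟩
  have hcomm : ∀ {w : ℝ → Vec n} {s t : ℝ}, IntervalIntegrable w volume s t →
      inner ℝ e (∫ r in s..t, w r) = ∫ r in s..t, inner ℝ e (w r) := fun {w s t} hw =>
    ((innerSL ℝ e).intervalIntegral_comp_comm hw).symm
  rw [inner_neg_right, hcomm hi1, hcomm hi2]
  have hac1 : AbsolutelyContinuousOnInterval φ a b :=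
    (hφ.1.of_le (by norm_num)).contDiffOn.absolutelyContinuousOnInterval
  have hac2 := hve.absolutelyContinuousOnInterval_intervalIntegral (c := a) left_mem_uIcc
  have hibp := hac1.integral_mul_deriv_eq_deriv_mul hac2
  rw [hφa, hφb] at hibp
  have e1 : ∫ x in a..b, φ x * deriv (fun x => ∫ r in a..x, inner ℝ e (v r)) x
      = ∫ x in a..b, inner ℝ e (φ x • v x) := by
    apply intervalIntegral.integral_congr_ae
    filter_upwards [hve.ae_hasDerivAt_integral] with x hx hxm
    rw [(hx (uIoc_subset_uIcc hxm) a left_mem_uIcc).deriv, real_inner_smul_right]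
  have e2 : ∫ x in a..b, deriv φ x * (∫ r in a..x, inner ℝ e (v r))
      = ∫ x in a..b, inner ℝ e (deriv φ x • ∫ r in a..x, v r) := by
    apply intervalIntegral.integral_congr
    intro x hx
    have hsub : IntervalIntegrable v volume a x :=
      hv.mono_set (uIcc_subset_uIcc left_mem_uIcc hx)
    simp only [real_inner_smul_right, hcomm hsub]
  rw [← e1, ← e2, hibp]
  ring

/-- The continuous representative agrees with the function almost everywhere. -/
theorem fn_ae_eq_rep (hab : a < b) (y : H1 a b n) :
    ∀ᵐ t ∂(timeMeasure a b), y.fn t = y.rep t := by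
  set w : ℝ → Vec n := fun s => y.fn s - ∫ r in a..s, y.der r with hw
  have hG : IntervalIntegrable (fun s => ∫ r in a..s, y.der r) volume a b :=
    ((uIcc_of_le hab.le).symm ▸ y.continuousOn_primitive hab :
      ContinuousOn _ (uIcc a b)).intervalIntegrable
  have hwi : IntervalIntegrable w volume a b := (y.intervalIntegrable_fn hab).sub hG
  have htime : ∀ u : ℝ → Vec n, ∫ t, u t ∂(timeMeasure a b) = ∫ t in a..b, u t := fun u => by
    rw [intervalIntegral.integral_of_le hab.le, integral_Ioc_eq_integral_Ioo]
  have hw0 : ∀ φ, IsTest a b φ → ∫ t in a..b, deriv φ t • w t = 0 := by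
    intro φ hφ
    have hdc : Continuous (deriv φ) := hφ.deriv.1.continuous
    have h1 := y.2 φ hφ
    rw [htime, htime] at h1
    have h2 := integral_deriv_smul_primitive hab (y.intervalIntegrable_der hab) hφ
    simp only [hw, smul_sub]
    rw [intervalIntegral.integral_sub
      ((y.intervalIntegrable_fn hab).continuousOn_smul hdc.continuousOn)
      (hG.continuousOn_smul hdc.continuousOn), h2]
    exact sub_eq_zero.mpr h1
  let c : ℝ := (a + b) / 2
  let η0 : ContDiffBump c := ⟨(b - a) / 8, (b - a) / 4, by linarith, by linarith⟩
  let η : ℝ → ℝ := η0.normed volume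
  have hηc : ContDiff ℝ ∞ η := η0.contDiff_normed
  have hηs : tsupport η ⊆ Ioo a b := by
    rw [η0.tsupport_normed_eq, Real.closedBall_eq_Icc]
    intro x hx
    have h1 : c - (b - a) / 4 ≤ x := hx.1
    have h2 : x ≤ c + (b - a) / 4 := hx.2
    simp only [c] at h1 h2
    exact ⟨by linarith, by linarith⟩
  have hηcs : HasCompactSupport η := η0.hasCompactSupport_normed
  have hη1 : ∫ t in a..b, η t = 1 := by
    rw [← η0.integral_normed (μ := volume), intervalIntegral.integral_eq_integral_of_support_subset]
    exact (subset_tsupport η).trans (hηs.trans Ioo_subset_Ioc_self)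
  set C : Vec n := ∫ t in a..b, η t • w t with hC
  have hae : ∀ᵐ t, t ∈ Ioo a b → w t - C = 0 := by
    apply isOpen_Ioo.ae_eq_zero_of_integral_contDiff_smul_eq_zero
    · apply IntegrableOn.locallyIntegrableOn
      have : IntervalIntegrable (fun t => w t - C) volume a b :=
        hwi.sub intervalIntegrable_const
      rwa [intervalIntegrable_iff_integrableOn_Ioo_of_le hab.le] at this
    · intro ψ hψ hψs hψI
      have hψc := hψ.continuous
      set k : ℝ := ∫ t in a..b, ψ t with hk
      let ψ0 : ℝ → ℝ := fun t => ψ t - k * η t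
      have hψ0 : ContDiff ℝ ∞ ψ0 := hψ.sub (contDiff_const.mul hηc)
      have hψ0c : Continuous ψ0 := hψ0.continuous
      have hψ0s : ∀ t, t ∉ tsupport ψ ∪ tsupport η → ψ0 t = 0 := by
        intro t ht
        have h1 := image_eq_zero_of_notMem_tsupport (fun h => ht (Or.inl h))
        have h2 := image_eq_zero_of_notMem_tsupport (fun h => ht (Or.inr h))
        simp [ψ0, h1, h2]
      have hK : IsCompact (tsupport ψ ∪ tsupport η) := hψs.isCompact.union hηcs.isCompact
      have hKI : tsupport ψ ∪ tsupport η ⊆ Ioo a b := union_subset hψI hηs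
      obtain ⟨p, q, hap, hqb, hKpq⟩ : ∃ p q, a < p ∧ q < b ∧
          tsupport ψ ∪ tsupport η ⊆ Icc p q := by
        rcases (tsupport ψ ∪ tsupport η).eq_empty_or_nonempty with h | h
        · exact ⟨b, a, hab, hab, by simp [h]⟩
        · exact ⟨_, _, (hKI (hK.sInf_mem h)).1, (hKI (hK.sSup_mem h)).2,
            fun x hx => ⟨csInf_le hK.bddBelow hx, le_csSup hK.bddAbove hx⟩⟩
      let φ : ℝ → ℝ := fun t => ∫ s in a..t, ψ0 s
      have hφd : ∀ t, HasDerivAt φ (ψ0 t) t := fun t =>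
        intervalIntegral.integral_hasDerivAt_right (hψ0c.intervalIntegrable _ _)
          (hψ0c.stronglyMeasurableAtFilter _ _) hψ0c.continuousAt
      have hderiv : deriv φ = ψ0 := funext fun t => (hφd t).deriv
      have htot : ∫ s in a..b, ψ0 s = 0 := by
        simp only [ψ0]
        have hkη : IntervalIntegrable (fun t => k * η t) volume a b :=
          (continuous_const.mul hηc.continuous).intervalIntegrable _ _
        rw [intervalIntegral.integral_sub (hψc.intervalIntegrable _ _) hkη,
          intervalIntegral.integral_const_mul, hη1]
        simp [hk]
      have hφsupp : Function.support φ ⊆ Icc p q := by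
        intro t ht
        by_contra hn
        apply ht
        have hzero : ∀ {s : ℝ}, s < p ∨ q < s → ψ0 s = 0 := fun {s} hs =>
          hψ0s s (fun h => by
            have := hKpq h
            rcases hs with hs | hs
            · exact absurd this.1 (not_le.mpr hs)
            · exact absurd this.2 (not_le.mpr hs))
        rcases not_and_or.mp hn with h | h
        · have h' : t < p := not_le.mp h
          change ∫ s in a..t, ψ0 s = 0
          rw [intervalIntegral.integral_congr (g := fun _ => (0 : ℝ))]
          · simp
          · intro s hs
            exact hzero (Or.inl (lt_of_le_of_lt hs.2 (max_lt hap h')))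
        · have h' : q < t := not_le.mp h
          change ∫ s in a..t, ψ0 s = 0
          rw [← intervalIntegral.integral_add_adjacent_intervals
            (hψ0c.intervalIntegrable a b) (hψ0c.intervalIntegrable b t), htot, zero_add,
            intervalIntegral.integral_congr (g := fun _ => (0 : ℝ))]
          · simp
          · intro s hs
            exact hzero (Or.inr (lt_of_lt_of_le (lt_min hqb h') hs.1))
      have hφts : tsupport φ ⊆ Icc p q := closure_minimal hφsupp isClosed_Icc
      have hφ : IsTest a b φ := by
        refine ⟨contDiff_infty_iff_deriv.mpr ⟨fun t => (hφd t).differentiableAt, ?_⟩,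
          HasCompactSupport.of_support_subset_isCompact isCompact_Icc hφsupp,
          hφts.trans fun x hx => ⟨lt_of_lt_of_le hap hx.1, lt_of_le_of_lt hx.2 hqb⟩⟩
        rw [hderiv]
        exact hψ0
      have h0 := hw0 φ hφ
      rw [hderiv] at h0
      have i1 : IntervalIntegrable (fun t => ψ t • w t) volume a b :=
        hwi.continuousOn_smul hψc.continuousOn
      have i2 : IntervalIntegrable (fun t => η t • w t) volume a b :=
        hwi.continuousOn_smul hηc.continuous.continuousOn
      have h3 : ∫ t in a..b, ψ t • w t = k • C := by
        have : ∫ t in a..b, ψ0 t • w t = (∫ t in a..b, ψ t • w t) - k • C := by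
          have i3 : IntervalIntegrable (fun t => k • (η t • w t)) volume a b := i2.smul k
          rw [hC, ← intervalIntegral.integral_smul, ← intervalIntegral.integral_sub i1 i3]
          apply intervalIntegral.integral_congr
          intro t _
          simp only [ψ0, sub_smul, mul_smul]
        rw [h0] at this
        exact (sub_eq_zero.mp this.symm)
      have h4 : ∫ t, ψ t • (w t - C) = ∫ t in a..b, ψ t • (w t - C) := by
        rw [intervalIntegral.integral_eq_integral_of_support_subset]
        intro t ht
        have : ψ t ≠ 0 := fun h => ht (by simp [h])
        exact Ioo_subset_Ioc_self (hψI (subset_tsupport ψ this))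
      rw [h4]
      simp only [smul_sub]
      have i4 : IntervalIntegrable (fun t => ψ t • C) volume a b :=
        (hψc.smul continuous_const).intervalIntegrable _ _
      rw [intervalIntegral.integral_sub i1 i4, h3,
        intervalIntegral.integral_smul_const, sub_self]
  have hmean : (b - a)⁻¹ • (∫ s in a..b, w s) = C := by
    have : ∫ s in a..b, w s = ∫ _ in a..b, C := by
      rw [intervalIntegral.integral_of_le hab.le, intervalIntegral.integral_of_le hab.le,
        integral_Ioc_eq_integral_Ioo, integral_Ioc_eq_integral_Ioo]
      apply setIntegral_congr_ae measurableSet_Ioo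
      filter_upwards [hae] with t ht hm
      exact sub_eq_zero.mp (ht hm)
    rw [this, intervalIntegral.integral_const, smul_smul,
      inv_mul_cancel₀ (sub_pos.mpr hab).ne', one_smul]
  rw [ae_restrict_iff' measurableSet_Ioo]
  filter_upwards [hae] with t ht hm
  have h5 : y.fn t - (∫ r in a..t, y.der r) = C := sub_eq_zero.mp (ht hm)
  change y.fn t = (b - a)⁻¹ • (∫ s in a..b, w s) + ∫ r in a..t, y.der r
  rw [hmean, ← h5, sub_add_cancel]

end H1

/-- The operator norm of the embedding of `W_T = H¹((0, T); ℝⁿ)` into `C([0, T]; ℝⁿ)`. -/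
def embeddingNorm (T : ℝ) (n : ℕ) : ℝ :=
  sInf {C : ℝ | 0 ≤ C ∧ ∀ y : H1 0 T n, ∀ t ∈ Icc 0 T, ‖y.rep t‖ ≤ C * ‖y‖}

open Classical in
/-- The class in `L²((a, b); F)` of a square integrable function. -/
def toL2 (a b : ℝ) {F : Type*} [NormedAddCommGroup F] (φ : ℝ → F) : L2 a b F :=
  if h : MemLp φ 2 (timeMeasure a b) then h.toLp φ else 0

/-! ### The control problem -/

/-- The data of the semi-global optimal feedback problem and of the learning functional.
Real `n × m` matrices are written as linear maps `ℝᵐ → ℝⁿ`, so that the transpose is the adjoint. -/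
structure ControlProblem (n m : ℕ) where
  T : ℝ
  T_pos : 0 < T
  f : ℝ → Vec n → Vec n
  g : ℝ → Vec n → (Vec m →L[ℝ] Vec n)
  Q₁ : Vec n →L[ℝ] Vec n
  Q₂ : Vec n →L[ℝ] Vec n
  β : ℝ
  β_pos : 0 < β
  yd : ℝ → Vec n
  yd_mem : MemLp yd 2 (timeMeasure 0 T)
  ydT : Vec n
  Y₀ : Set (Vec n)
  Y₀_compact : IsCompact Y₀
  Y₀_pos : 0 < volume Y₀
  weight : Vec n → ℝ
  weight_mem : MemLp weight ∞ (ProbabilityTheory.cond volume Y₀)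
  weight_pos : ∃ c : ℝ, 0 < c ∧ ∀ᵐ x ∂(ProbabilityTheory.cond volume Y₀), c ≤ weight x
  γ₁ : ℝ
  γ₂ : ℝ
  γ₁_nonneg : 0 ≤ γ₁
  γ₂_nonneg : 0 ≤ γ₂

namespace ControlProblem

variable {n m : ℕ} (P : ControlProblem n m)

/-- The trajectory space `W_T`. -/
abbrev W : Type := H1 0 P.T n

/-- The normalized Lebesgue measure on `Y₀`. -/
abbrev ensemble : Measure (Vec n) := ProbabilityTheory.cond volume P.Y₀

/-- `J_{T₀}(y, u)`; for `T₀ = 0` this is `J(y, u)`. -/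
def cost (T₀ : ℝ) (y : ℝ → Vec n) (u : ℝ → Vec m) : ℝ :=
  (1 / 2) * (∫ t in T₀..P.T, (‖P.Q₁ (y t - P.yd t)‖ ^ 2 + P.β * ‖u t‖ ^ 2))
    + (1 / 2) * ‖P.Q₂ (y P.T - P.ydT)‖ ^ 2

/-- `ẏ = f(y) + g(y) u` a.e. on `(T₀, T)` and `y(T₀) = x`. -/
def IsState (T₀ : ℝ) (x : Vec n) (y : H1 T₀ P.T n) (u : ℝ → Vec m) : Prop :=
  (∀ᵐ t ∂(timeMeasure T₀ P.T), y.der t = P.f t (y.rep t) + P.g t (y.rep t) (u t)) ∧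
    y.rep T₀ = x

/-- Admissible state-control pairs for the open loop problem on `(T₀, T)` started at `x`. -/
def IsFeasible (T₀ : ℝ) (x : Vec n) (y : H1 T₀ P.T n) (u : ℝ → Vec m) : Prop :=
  MemLp u 2 (timeMeasure T₀ P.T) ∧ P.IsState T₀ x y u

/-- The pair `(y, u)` solves the open loop problem on `(0, T)` started at `x`. -/
def IsOptimal (x : Vec n) (y : P.W) (u : ℝ → Vec m) : Prop :=
  P.IsFeasible 0 x y u ∧
    ∀ (z : P.W) (w : ℝ → Vec m), P.IsFeasible 0 x z w → P.cost 0 y.rep u ≤ P.cost 0 z.rep w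

/-- The value function `V*(T₀, x)`.  For `T₀ = T` only the terminal cost is left. -/
def value (T₀ : ℝ) (x : Vec n) : ℝ :=
  if T₀ < P.T then
    sInf {j : ℝ | ∃ (y : H1 T₀ P.T n) (u : ℝ → Vec m),
      P.IsFeasible T₀ x y u ∧ j = P.cost T₀ y.rep u}
  else (1 / 2) * ‖P.Q₂ (x - P.ydT)‖ ^ 2

/-- The closed ball of radius `2 M̂`, `M̂ = M ‖ι‖`, with `ι` the embedding of `W_T` into
`C([0, T]; ℝⁿ)`. -/
def stateBall (M : ℝ) : Set (Vec n) := Metric.closedBall 0 (2 * (M * embeddingNorm P.T n))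

/-- The gradient `∂_y V*(t, x)` of the value function on the closed ball. -/
def valueGrad (M : ℝ) (t : ℝ) (x : Vec n) : Vec n :=
  gradientWithin (P.value t) (P.stateBall M) x

/-- The feedback law `F(t, x) = -(1/β) g(t, x)ᵀ G(t, x)`, to be used with `G = ∂_y V`. -/
def feedback (G : ℝ → Vec n → Vec n) (t : ℝ) (x : Vec n) : Vec m :=
  -((1 / P.β) • (P.g t x).adjoint (G t x))

/-- The control `t ↦ F(t, y(t))` generated along `y` by the feedback law built from `G`. -/
def control (G : ℝ → Vec n → Vec n) (y : P.W) (t : ℝ) : Vec m := P.feedback G t (y.rep t)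

/-- The adjoint equation
`-ṗ = Df(y)ᵀ p + [Dg(y)ᵀ u] p + Q₁ᵀ Q₁ (y - y_d)`, `p(T) = Q₂ᵀ Q₂ (y(T) - y_dᵀ)`.
Here `Dg(y)ᵀ u` is the transpose of the Jacobian of `x ↦ g(t, x) u(t)` at `y(t)`. -/
def IsAdjoint (y : P.W) (u : ℝ → Vec m) (p : P.W) : Prop :=
  (∀ᵐ t ∂(timeMeasure 0 P.T),
    -p.der t = (fderiv ℝ (P.f t) (y.rep t)).adjoint (p.rep t)
      + (fderiv ℝ (fun x => P.g t x (u t)) (y.rep t)).adjoint (p.rep t)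
      + P.Q₁.adjoint (P.Q₁ (y.rep t - P.yd t))) ∧
    p.rep P.T = P.Q₂.adjoint (P.Q₂ (y.rep P.T - P.ydT))

/-! ### Standing assumptions -/

set_option maxSynthPendingDepth 4 in
/-- `f` and `g` are `C²` and their first and second derivatives in the state are Lipschitz
continuous on compact sets, uniformly in time. -/
structure SmoothDynamics : Prop where
  f_smooth : ContDiffOn ℝ 2 (fun z : ℝ × Vec n => P.f z.1 z.2) (Icc 0 P.T ×ˢ univ)
  g_smooth : ContDiffOn ℝ 2 (fun z : ℝ × Vec n => P.g z.1 z.2) (Icc 0 P.T ×ˢ univ)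
  f_lipschitz : ∀ K : Set (Vec n), IsCompact K → ∃ L : NNReal, ∀ t ∈ Icc 0 P.T,
    LipschitzOnWith L (fderiv ℝ (P.f t)) K ∧
    LipschitzOnWith L (fderiv ℝ (fderiv ℝ (P.f t))) K
  g_lipschitz : ∀ K : Set (Vec n), IsCompact K → ∃ L : NNReal, ∀ t ∈ Icc 0 P.T,
    LipschitzOnWith L (fderiv ℝ (P.g t)) K ∧
    LipschitzOnWith L (fderiv ℝ (fderiv ℝ (P.g t))) K

/-- The value function is `C²` on `[0, T] × B̄_{2M̂}(0)`, with gradient and Hessian in the state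
Lipschitz continuous in the state, uniformly in time. -/
structure SmoothValue (M : ℝ) : Prop where
  smooth : ContDiffOn ℝ 2 (fun z : ℝ × Vec n => P.value z.1 z.2) (Icc 0 P.T ×ˢ P.stateBall M)
  lipschitz : ∃ L : NNReal, ∀ t ∈ Icc 0 P.T,
    LipschitzOnWith L (fderivWithin ℝ (P.value t) (P.stateBall M)) (P.stateBall M) ∧
    LipschitzOnWith L
      (fderivWithin ℝ (fderivWithin ℝ (P.value t) (P.stateBall M)) (P.stateBall M))
      (P.stateBall M)

/-- For `x ∈ Y₀` the state `y*(x)` is the unique solution of norm at most `M` of the closed loop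
system with the optimal feedback law, and it is optimal together with its control. -/
def OptimalFeedback (M : ℝ) (ystar : Vec n → P.W) : Prop :=
  ∀ x ∈ P.Y₀,
    (P.IsState 0 x (ystar x) (P.control (P.valueGrad M) (ystar x)) ∧ ‖ystar x‖ ≤ M) ∧
    (∀ z : P.W, P.IsState 0 x z (P.control (P.valueGrad M) z) → ‖z‖ ≤ M → z = ystar x) ∧
    P.IsOptimal x (ystar x) (P.control (P.valueGrad M) (ystar x))

/-- The parametrized functions `V^ε_θ`, `0 < ε ≤ ε₀`, are jointly `C⁴`, have the correct terminal
value, and `V^ε_{θ_ε}` approximates the value function to order `ε` in `C²` in the state. -/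
structure ValueApproximation (M ε₀ : ℝ) {R : ℝ → Type*} [∀ ε, NormedAddCommGroup (R ε)]
    [∀ ε, NormedSpace ℝ (R ε)] (V : ∀ ε, R ε → ℝ → Vec n → ℝ) (θ₀ : ∀ ε, R ε) : Prop where
  smooth : ∀ ε ∈ Ioc 0 ε₀, ContDiff ℝ 4 (fun z : R ε × ℝ × Vec n => V ε z.1 z.2.1 z.2.2)
  terminal : ∀ ε ∈ Ioc 0 ε₀, ∀ (θ : R ε) (x : Vec n),
    V ε θ P.T x = (1 / 2) * ‖P.Q₂ (x - P.ydT)‖ ^ 2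
  approx : ∃ c : ℝ, 0 < c ∧ ∀ ε ∈ Ioc 0 ε₀, ∀ t ∈ Icc 0 P.T, ∀ x ∈ P.stateBall M,
    |V ε (θ₀ ε) t x - P.value t x|
      + ‖fderivWithin ℝ (fun z => V ε (θ₀ ε) t z - P.value t z) (P.stateBall M) x‖
      + ‖fderivWithin ℝ (fderivWithin ℝ (fun z => V ε (θ₀ ε) t z - P.value t z)
          (P.stateBall M)) (P.stateBall M) x‖ ≤ c * ε

/-! ### The learning problem -/

/-- The class in `L²((0, T); F)` of `φ x`, for each initial condition `x`. -/
def ensembleClass {F : Type*} [NormedAddCommGroup F] (φ : Vec n → ℝ → F) (x : Vec n) :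
    L2 0 P.T F := toL2 0 P.T (φ x)

/-- `φ ∈ L^q(Y₀; L²((0, T); F))`. -/
def MemEnsemble {F : Type*} [NormedAddCommGroup F] (q : ℝ≥0∞) (φ : Vec n → ℝ → F) : Prop :=
  (∀ᵐ x ∂P.ensemble, MemLp (φ x) 2 (timeMeasure 0 P.T)) ∧
    MemLp (P.ensembleClass φ) q P.ensemble

/-- Convergence `φ_k → φ` in `L²(Y₀; L²((0, T); F))`. -/
def TendstoEnsemble {F : Type*} [NormedAddCommGroup F] (φk : ℕ → Vec n → ℝ → F)
    (φ : Vec n → ℝ → F) : Prop :=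
  (∀ k, P.MemEnsemble 2 (φk k)) ∧ P.MemEnsemble 2 φ ∧
    Tendsto (fun k => eLpNorm (fun x => P.ensembleClass (φk k) x - P.ensembleClass φ x) 2
      P.ensemble) atTop (𝓝 0)

/-- Convergence `y_k → y` in `L²(Y₀; W_T)`. -/
def TendstoTraj (yk : ℕ → Vec n → P.W) (y : Vec n → P.W) : Prop :=
  (∀ k, MemLp (yk k) 2 P.ensemble) ∧ MemLp y 2 P.ensemble ∧
    Tendsto (fun k => eLpNorm (fun x => yk k x - y x) 2 P.ensemble) atTop (𝓝 0)

/-- The norm of `W^{1,2}(Y₀; W_T)` of a continuously differentiable ensemble. -/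
def w12Norm (y : Vec n → P.W) : ℝ≥0∞ :=
  (∫⁻ x, (‖y x‖ₑ ^ 2
    + ∑ i : Fin n, ‖fderivWithin ℝ y P.Y₀ x (EuclideanSpace.single i 1)‖ₑ ^ 2)
      ∂P.ensemble) ^ (1 / 2 : ℝ)

/-- The augmented running cost `J_ε(y, p, θ)`, for the function `v = V^ε_θ`. -/
def augmentedCost (v : ℝ → Vec n → ℝ) (y p : P.W) : ℝ :=
  P.cost 0 y.rep (P.control (fun t => gradient (v t)) y)
    + ∫ t in (0 : ℝ)..P.T,
      (P.γ₁ / 2 * |v t (y.rep t)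
          - P.cost t y.rep (P.control (fun s => gradient (v s)) y)| ^ 2
        + P.γ₂ / 2 * ‖gradient (v t) (y.rep t) - p.rep t‖ ^ 2)

section Learning

variable {Θ : Type*} [NormedAddCommGroup Θ] (v : Θ → ℝ → Vec n → ℝ)

/-- The objective `∫_{Y₀} weight · J_ε(y, p, θ) dℒ + (γ_ε / 2) ‖θ‖²`. -/
def objective (γ : ℝ) (y p : Vec n → P.W) (θ : Θ) : ℝ :=
  (∫ x, P.weight x * P.augmentedCost (v θ) (y x) (p x) ∂P.ensemble) + γ / 2 * ‖θ‖ ^ 2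

/-- Admissible triples `(y, p, θ)`: `y ∈ C¹(Y₀; W_T)` is bounded by `2M` in `C(Y₀; W_T)` and by
`2 M_W` in `W^{1,2}(Y₀; W_T)`, the feedback control is bounded by `2 M_U` in
`L^∞(Y₀; L²((0, T); ℝᵐ))`, `p ∈ C(Y₀; W_T)`, and the closed loop state equation and the adjoint
equation hold for a.e. initial condition.  Only the values of `y` and `p` on `Y₀` matter. -/
structure IsAdmissible (M MW MU : ℝ) (y p : Vec n → P.W) (θ : Θ) : Prop where
  y_smooth : ContDiffOn ℝ 1 y P.Y₀
  y_bound : ∀ x ∈ P.Y₀, ‖y x‖ ≤ 2 * M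
  y_w12 : P.w12Norm y ≤ ENNReal.ofReal (2 * MW)
  u_mem : P.MemEnsemble ∞ (fun x => P.control (fun t => gradient (v θ t)) (y x))
  u_bound : eLpNorm (P.ensembleClass fun x => P.control (fun t => gradient (v θ t)) (y x)) ∞
    P.ensemble ≤ ENNReal.ofReal (2 * MU)
  p_cont : ContinuousOn p P.Y₀
  state : ∀ᵐ x ∂P.ensemble,
    P.IsState 0 x (y x) (P.control (fun t => gradient (v θ t)) (y x))
  adjoint : ∀ᵐ x ∂P.ensemble,
    P.IsAdjoint (y x) (P.control (fun t => gradient (v θ t)) (y x)) (p x)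

/-- Minimizing triples of the learning problem. -/
def IsMinimizer (M MW MU γ : ℝ) (y p : Vec n → P.W) (θ : Θ) : Prop :=
  P.IsAdmissible v M MW MU y p θ ∧
    ∀ (y' p' : Vec n → P.W) (θ' : Θ), P.IsAdmissible v M MW MU y' p' θ' →
      P.objective v γ y p θ ≤ P.objective v γ y' p' θ'

end Learning

end ControlProblem

end

/-! The proof is an energy argument. For a triple `(y, p, θ)` consider, for each initial value `x`,
the `excess`: the augmented cost minus `V*(0, x)`. For an admissible triple the state and its
feedback control are feasible for almost every `x`, so the cost is at least `V*(0, x)`. The excess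
is therefore a sum of three nonnegative terms (cost gap, `γ₁/2` times the squared L² error of `V` as
a cost to go, `γ₂/2` times the squared L² error of `∂_y V` as an adjoint state) and dominates each
of them (`IsAdmissible.le_excess`). Everything follows once the mean excess of the minimizers is
known to vanish.

For this the minimizers are compared with a competitor with parameter `θ_ε`
(`exists_isNearOptimal`): the closed loop trajectories of the feedback built from `V^ε_{θ_ε}`, with
their adjoint states. Since `V^ε_{θ_ε}` is close to `V*` in C² in the state, the two closed loop
fields are close in C¹, and Grönwall estimates make states, controls, adjoints and derivatives in
`x` close to the optimal ones. The factor 2 in the constraints then makes the competitor admissible.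
Its augmented cost is near `V*(0, x)` because for the exact value function both penalties vanish
along optimal trajectories: `V*(t, y(t))` is the remaining cost (`IsOptimal.value_eq_cost`), and
`∂_y V*(t, y(t))` is the adjoint state (`SmoothDynamics.gradient_value_eq`). The second identity
holds because moving the state at time `t` while keeping the control gives a majorant of `V*(t, ·)`
that touches it at `y(t)` and is, up to a quadratic error, affine with slope `p(t)`; a
differentiable function has the slope of such a majorant. Minimality, `γ_ε ‖θ_ε‖² → 0` and the lower
bound on the weight give `tendsto_integral_excess`.

In the limit, `∂_y V` along `y_k` is the gradient error plus `p_k`, so it converges to `p̄`.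
Likewise `V` along `y_k` is the value error plus the cost to go of `(y_k, u_k)`, which converges to
that of `(ȳ, ū)` because the cost is Lipschitz on bounded sets. It remains to identify this limit
with `V*(·, ȳ)`: along an a.e. convergent subsequence the state equation survives and the cost tends
to `V*(0, x)`, so `(ȳ(x), ū(x))` is optimal for a.e. `x` (`ae_isOptimal_of_tendsto`) and the
principle of optimality applies again. -/

noncomputable section

/-! ### Square integrable functions on an interval and their classes -/

theorem integral_timeMeasure {F : Type*} [NormedAddCommGroup F] [NormedSpace ℝ F] {a b : ℝ}
    (hab : a ≤ b) (u : ℝ → F) : ∫ t, u t ∂(timeMeasure a b) = ∫ t in a..b, u t := by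
  rw [intervalIntegral.integral_of_le hab, integral_Ioc_eq_integral_Ioo]

theorem intervalIntegrable_iff_timeMeasure {F : Type*} [NormedAddCommGroup F] {a b : ℝ}
    (hab : a ≤ b) (u : ℝ → F) :
    IntervalIntegrable u volume a b ↔ Integrable u (timeMeasure a b) :=
  intervalIntegrable_iff_integrableOn_Ioo_of_le hab

theorem ContinuousOn.memLp_timeMeasure {F : Type*} [NormedAddCommGroup F]
    {a b : ℝ} {φ : ℝ → F} (hφ : ContinuousOn φ (Icc a b)) {q : ℝ≥0∞} :
    MemLp φ q (timeMeasure a b) := by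
  obtain ⟨C, hC⟩ := isCompact_Icc.exists_bound_of_continuousOn hφ
  refine MemLp.of_bound ((hφ.mono Ioo_subset_Icc_self).aestronglyMeasurable measurableSet_Ioo) C ?_
  filter_upwards [ae_restrict_mem measurableSet_Ioo] with t ht
  exact hC t (Ioo_subset_Icc_self ht)

theorem toL2_of_memLp {F : Type*} [NormedAddCommGroup F] {a b : ℝ} {φ : ℝ → F}
    (h : MemLp φ 2 (timeMeasure a b)) : toL2 a b φ = h.toLp φ := dif_pos h

theorem coeFn_toL2 {F : Type*} [NormedAddCommGroup F] {a b : ℝ} {φ : ℝ → F}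
    (h : MemLp φ 2 (timeMeasure a b)) : toL2 a b φ =ᵐ[timeMeasure a b] φ := by
  rw [toL2_of_memLp h]
  exact h.coeFn_toLp

theorem toL2_congr {F : Type*} [NormedAddCommGroup F] {a b : ℝ} {φ ψ : ℝ → F}
    (h : φ =ᵐ[timeMeasure a b] ψ) : toL2 a b φ = toL2 a b ψ := by
  by_cases hφ : MemLp φ 2 (timeMeasure a b)
  · rw [toL2_of_memLp hφ, toL2_of_memLp (hφ.ae_eq h)]
    exact (MemLp.toLp_eq_toLp_iff _ _).mpr h
  · have hψ : ¬ MemLp ψ 2 (timeMeasure a b) := fun hψ => hφ (hψ.ae_eq h.symm)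
    simp only [toL2, dif_neg hφ, dif_neg hψ]

theorem toL2_sub {F : Type*} [NormedAddCommGroup F] {a b : ℝ} {φ ψ : ℝ → F}
    (hφ : MemLp φ 2 (timeMeasure a b)) (hψ : MemLp ψ 2 (timeMeasure a b)) :
    toL2 a b (fun t => φ t - ψ t) = toL2 a b φ - toL2 a b ψ := by
  rw [toL2_of_memLp hφ, toL2_of_memLp hψ, ← MemLp.toLp_sub]
  exact toL2_of_memLp (hφ.sub hψ)

theorem norm_L2_le_of_ae_bound {F : Type*} [NormedAddCommGroup F] {a b : ℝ} (hab : a ≤ b)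
    {v : L2 a b F} {C : ℝ} (hC : 0 ≤ C) (h : ∀ᵐ t ∂(timeMeasure a b), ‖v t‖ ≤ C) :
    ‖v‖ ≤ √(b - a) * C := by
  refine (Lp.norm_le_of_ae_bound hC h).trans_eq ?_
  rw [Real.sqrt_eq_rpow]
  congr 1
  simp only [measureUnivNNReal, timeMeasure, Measure.restrict_apply_univ, Real.volume_Ioo]
  change (ENNReal.ofReal (b - a)).toReal ^ _ = _
  rw [ENNReal.toReal_ofReal (sub_nonneg.mpr hab)]
  norm_num

/-- This turns uniform estimates in time into L² estimates. No measurability is asked of `φ`. -/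
theorem norm_toL2_le {F : Type*} [NormedAddCommGroup F] {a b : ℝ} (hab : a ≤ b)
    {φ : ℝ → F} {C : ℝ} (hC : 0 ≤ C) (h : ∀ᵐ t ∂(timeMeasure a b), ‖φ t‖ ≤ C) :
    ‖toL2 a b φ‖ ≤ √(b - a) * C := by
  by_cases hφ : MemLp φ 2 (timeMeasure a b)
  · refine norm_L2_le_of_ae_bound hab hC ?_
    filter_upwards [h, coeFn_toL2 hφ] with t h1 h2
    rwa [h2]
  -- Outside L² the class `toL2` takes the default value zero, so the bound is trivial.
  · simp only [toL2, dif_neg hφ, norm_zero]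
    positivity

theorem integral_norm_sq_L2 {F : Type*} [NormedAddCommGroup F] [InnerProductSpace ℝ F] {a b : ℝ}
    (v : L2 a b F) :
    ∫ t, ‖v t‖ ^ 2 ∂(timeMeasure a b) = ‖v‖ ^ 2 := by
  rw [← real_inner_self_eq_norm_sq, L2.inner_def]
  simp

theorem integral_norm_sq_eq {F : Type*} [NormedAddCommGroup F] [InnerProductSpace ℝ F]
    {a b : ℝ} {φ : ℝ → F} (h : MemLp φ 2 (timeMeasure a b)) :
    ∫ t, ‖φ t‖ ^ 2 ∂(timeMeasure a b) = ‖toL2 a b φ‖ ^ 2 := by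
  rw [← integral_norm_sq_L2]
  refine integral_congr_ae ?_
  filter_upwards [coeFn_toL2 h] with t ht
  rw [ht]

theorem integral_norm_L2_le {F : Type*} [NormedAddCommGroup F] {a b : ℝ} (hab : a ≤ b)
    (v : L2 a b F) : ∫ t, ‖v t‖ ∂(timeMeasure a b) ≤ √(b - a) * ‖v‖ := by
  have h1 := Lp.memLp v
  have h2 := eLpNorm_le_eLpNorm_mul_rpow_measure_univ (μ := timeMeasure a b)
    (p := 1) (q := 2) one_le_two h1.1
  have h3 : ENNReal.ofReal (∫ t, ‖v t‖ ∂(timeMeasure a b)) = eLpNorm v 1 (timeMeasure a b) := by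
    rw [eLpNorm_one_eq_lintegral_enorm,
      ofReal_integral_norm_eq_lintegral_enorm (h1.integrable one_le_two)]
  rw [← h3] at h2
  have h4 : eLpNorm v 2 (timeMeasure a b) = ENNReal.ofReal ‖v‖ := by
    rw [Lp.norm_def, ENNReal.ofReal_toReal h1.eLpNorm_ne_top]
  have h5 : (timeMeasure a b) univ ^ (1 / (1 : ℝ≥0∞).toReal - 1 / (2 : ℝ≥0∞).toReal)
      = ENNReal.ofReal √(b - a) := by
    have : (0 : ℝ) ≤ b - a := sub_nonneg.mpr hab
    rw [Real.sqrt_eq_rpow, ← ENNReal.ofReal_rpow_of_nonneg this (by norm_num)]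
    simp only [timeMeasure, Measure.restrict_apply_univ, Real.volume_Ioo]
    norm_num
  rw [h4, h5, ← ENNReal.ofReal_mul (norm_nonneg _)] at h2
  rw [mul_comm]
  exact (ENNReal.ofReal_le_ofReal_iff (by positivity)).mp h2

/-! ### Calculus in H¹: representatives, restriction, gluing, integration by parts -/

namespace H1

variable {a b : ℝ} {n : ℕ}

theorem memLp_der (y : H1 a b n) : MemLp y.der 2 (timeMeasure a b) := Lp.memLp _

theorem memLp_fn (y : H1 a b n) : MemLp y.fn 2 (timeMeasure a b) := Lp.memLp _

theorem memLp_rep (hab : a < b) (y : H1 a b n) : MemLp y.rep 2 (timeMeasure a b) :=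
  (y.continuousOn_rep hab).memLp_timeMeasure

theorem toL2_rep (hab : a < b) (y : H1 a b n) : toL2 a b y.rep = y.1.fst := by
  rw [← toL2_congr (y.fn_ae_eq_rep hab), toL2_of_memLp y.memLp_fn]
  exact Lp.toLp_coeFn _ _

theorem rep_eq_add_integral (y : H1 a b n) (t : ℝ) :
    y.rep t = y.rep a + ∫ r in a..t, y.der r := by
  simp [rep]

/-- Continuous functions that agree a.e. on an interval agree on its closure. Through this, the
linear operations, defined only on L² classes, pass to the representatives at every point. -/
theorem rep_eq_of_fn_ae_eq (hab : a < b) (y : H1 a b n) {φ : ℝ → Vec n}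
    (hφ : ContinuousOn φ (Icc a b)) (h : y.fn =ᵐ[timeMeasure a b] φ) :
    EqOn y.rep φ (Icc a b) := by
  refine Measure.eqOn_Icc_of_ae_eq volume hab.ne ?_ (y.continuousOn_rep hab) hφ
  rw [← restrict_Ioo_eq_restrict_Icc]
  filter_upwards [h, y.fn_ae_eq_rep hab] with t h1 h2
  rw [← h1, h2]

/-- The primitive of an L² function has that function as weak derivative, by integration by parts;
the added constant is harmless because `φ'` integrates to zero for a test function `φ`.
Restrictions, gluings, time reversals and solutions of differential equations below are all built
from their derivatives by this lemma. -/
theorem exists_of_memLp (hab : a < b) (c : Vec n) {v : ℝ → Vec n}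
    (hv : MemLp v 2 (timeMeasure a b)) :
    ∃ y : H1 a b n, y.rep a = c ∧ y.der =ᵐ[timeMeasure a b] v := by
  have hvi : IntervalIntegrable v volume a b :=
    (intervalIntegrable_iff_timeMeasure hab.le v).mpr (hv.integrable one_le_two)
  have hcont : ContinuousOn (fun t => c + ∫ r in a..t, v r) (Icc a b) := by
    have h := intervalIntegral.continuousOn_primitive_interval' hvi left_mem_uIcc
    rw [uIcc_of_le hab.le] at h
    exact continuousOn_const.add h
  have hm : MemLp (fun t => c + ∫ r in a..t, v r) 2 (timeMeasure a b) := hcont.memLp_timeMeasure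
  let z : WithLp 2 (L2 a b (Vec n) × L2 a b (Vec n)) := WithLp.toLp 2 (hm.toLp _, hv.toLp _)
  have hz : z ∈ sobolev a b n := by
    intro φ hφ
    have e1 : ∫ t, deriv φ t • (z.fst : ℝ → Vec n) t ∂(timeMeasure a b)
        = ∫ t, deriv φ t • (c + ∫ r in a..t, v r) ∂(timeMeasure a b) := by
      apply integral_congr_ae
      filter_upwards [hm.coeFn_toLp] with t ht
      exact congrArg _ ht
    have e2 : ∫ t, φ t • (z.snd : ℝ → Vec n) t ∂(timeMeasure a b)
        = ∫ t, φ t • v t ∂(timeMeasure a b) := by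
      apply integral_congr_ae
      filter_upwards [hv.coeFn_toLp] with t ht
      exact congrArg _ ht
    rw [e1, e2, integral_timeMeasure hab.le, integral_timeMeasure hab.le,
      ← integral_deriv_smul_primitive hab hvi hφ]
    have hdc : Continuous (deriv φ) := hφ.deriv.1.continuous
    have hprim : ContinuousOn (fun t => ∫ r in a..t, v r) (uIcc a b) :=
      intervalIntegral.continuousOn_primitive_interval' hvi left_mem_uIcc
    have i1 : IntervalIntegrable (fun t => deriv φ t • c) volume a b :=
      (hdc.smul continuous_const).intervalIntegrable _ _
    have i2 : IntervalIntegrable (fun t => deriv φ t • ∫ r in a..t, v r) volume a b :=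
      (hdc.continuousOn.smul hprim).intervalIntegrable
    simp only [smul_add]
    rw [intervalIntegral.integral_add i1 i2,
      intervalIntegral.integral_smul_const,
      intervalIntegral.integral_deriv_eq_sub (fun t _ => (hφ.1.differentiable (by simp)).differentiableAt)
        (hdc.intervalIntegrable _ _)]
    have hφa : φ a = 0 := by
      by_contra h
      exact absurd (hφ.2.2 (subset_tsupport φ h)).1 (lt_irrefl _)
    have hφb : φ b = 0 := by
      by_contra h
      exact absurd (hφ.2.2 (subset_tsupport φ h)).2 (lt_irrefl _)
    simp [hφa, hφb]
  refine ⟨⟨z, hz⟩, ?_, hv.coeFn_toLp⟩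
  have := rep_eq_of_fn_ae_eq hab ⟨z, hz⟩ hcont hm.coeFn_toLp (left_mem_Icc.mpr hab.le)
  simpa using this

theorem integral_der_congr {y : H1 a b n} {v : ℝ → Vec n} (h : y.der =ᵐ[timeMeasure a b] v)
    {s t : ℝ} (hs : s ∈ Icc a b) (ht : t ∈ Icc a b) :
    ∫ r in s..t, y.der r = ∫ r in s..t, v r := by
  apply intervalIntegral.integral_congr_ae
  have h' : ∀ᵐ r, r ∈ Ioc a b → y.der r = v r := by
    rw [← ae_restrict_iff' measurableSet_Ioc, ← restrict_Ioo_eq_restrict_Ioc]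
    exact h
  filter_upwards [h'] with r hr hrm
  exact hr ⟨lt_of_le_of_lt (le_min hs.1 ht.1) hrm.1, hrm.2.trans (max_le hs.2 ht.2)⟩

theorem intervalIntegrable_der_of_mem (hab : a < b) (y : H1 a b n) {s t : ℝ} (hs : s ∈ Icc a b)
    (ht : t ∈ Icc a b) : IntervalIntegrable y.der volume s t :=
  (y.intervalIntegrable_der hab).mono_set (by
    rw [uIcc_of_le hab.le]
    exact uIcc_subset_Icc hs ht)

theorem rep_sub_rep (hab : a < b) (y : H1 a b n) {s t : ℝ} (hs : s ∈ Icc a b)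
    (ht : t ∈ Icc a b) : y.rep t - y.rep s = ∫ r in s..t, y.der r := by
  rw [y.rep_eq_add_integral t, y.rep_eq_add_integral s, add_sub_add_left_eq_sub]
  exact intervalIntegral.integral_interval_sub_left
    (y.intervalIntegrable_der_of_mem hab (left_mem_Icc.mpr hab.le) ht)
    (y.intervalIntegrable_der_of_mem hab (left_mem_Icc.mpr hab.le) hs)

theorem der_add (y z : H1 a b n) :
    (y + z).der =ᵐ[timeMeasure a b] fun t => y.der t + z.der t :=
  Lp.coeFn_add y.1.snd z.1.snd

theorem der_sub (y z : H1 a b n) :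
    (y - z).der =ᵐ[timeMeasure a b] fun t => y.der t - z.der t :=
  Lp.coeFn_sub y.1.snd z.1.snd

theorem der_smul (c : ℝ) (y : H1 a b n) :
    (c • y).der =ᵐ[timeMeasure a b] fun t => c • y.der t :=
  Lp.coeFn_smul c y.1.snd

theorem rep_add (hab : a < b) (y z : H1 a b n) :
    ∀ t ∈ Icc a b, (y + z).rep t = y.rep t + z.rep t := by
  refine rep_eq_of_fn_ae_eq hab _ ((y.continuousOn_rep hab).add (z.continuousOn_rep hab)) ?_
  filter_upwards [Lp.coeFn_add y.1.fst z.1.fst, y.fn_ae_eq_rep hab, z.fn_ae_eq_rep hab]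
    with t h1 h2 h3
  rw [← h2, ← h3]
  exact h1

theorem rep_sub (hab : a < b) (y z : H1 a b n) :
    ∀ t ∈ Icc a b, (y - z).rep t = y.rep t - z.rep t := by
  refine rep_eq_of_fn_ae_eq hab _ ((y.continuousOn_rep hab).sub (z.continuousOn_rep hab)) ?_
  filter_upwards [Lp.coeFn_sub y.1.fst z.1.fst, y.fn_ae_eq_rep hab, z.fn_ae_eq_rep hab]
    with t h1 h2 h3
  rw [← h2, ← h3]
  exact h1

theorem rep_smul (hab : a < b) (c : ℝ) (y : H1 a b n) :
    ∀ t ∈ Icc a b, (c • y).rep t = c • y.rep t := by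
  refine rep_eq_of_fn_ae_eq hab _ ((y.continuousOn_rep hab).const_smul c) ?_
  filter_upwards [Lp.coeFn_smul c y.1.fst, y.fn_ae_eq_rep hab] with t h1 h2
  rw [← h2]
  exact h1

theorem norm_sq_eq (y : H1 a b n) : ‖y‖ ^ 2 = ‖y.1.fst‖ ^ 2 + ‖y.1.snd‖ ^ 2 :=
  WithLp.prod_norm_sq_eq_of_L2 y.1

theorem norm_fst_le (y : H1 a b n) : ‖y.1.fst‖ ≤ ‖y‖ :=
  abs_le_of_sq_le_sq' (by rw [y.norm_sq_eq]; nlinarith [sq_nonneg ‖y.1.snd‖]) (norm_nonneg _) |>.2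

theorem norm_snd_le (y : H1 a b n) : ‖y.1.snd‖ ≤ ‖y‖ :=
  abs_le_of_sq_le_sq' (by rw [y.norm_sq_eq]; nlinarith [sq_nonneg ‖y.1.fst‖]) (norm_nonneg _) |>.2

theorem norm_le_fst_add_snd (y : H1 a b n) : ‖y‖ ≤ ‖y.1.fst‖ + ‖y.1.snd‖ :=
  abs_le_of_sq_le_sq' (by
    rw [y.norm_sq_eq]
    nlinarith [mul_nonneg (norm_nonneg y.1.fst) (norm_nonneg y.1.snd)]) (by positivity) |>.2

theorem norm_le_of_bounds (hab : a < b) (y : H1 a b n) {A B : ℝ} (hB : 0 ≤ B)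
    (h1 : ∀ t ∈ Icc a b, ‖y.rep t‖ ≤ A) (h2 : ∀ᵐ t ∂(timeMeasure a b), ‖y.der t‖ ≤ B) :
    ‖y‖ ≤ √(b - a) * (A + B) := by
  have hA : 0 ≤ A := (norm_nonneg _).trans (h1 a (left_mem_Icc.mpr hab.le))
  refine y.norm_le_fst_add_snd.trans ?_
  rw [mul_add]
  refine add_le_add (norm_L2_le_of_ae_bound hab.le hA ?_) (norm_L2_le_of_ae_bound hab.le hB h2)
  filter_upwards [y.fn_ae_eq_rep hab, ae_restrict_mem measurableSet_Ioo] with t h3 ht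
  have := h1 t (Ioo_subset_Icc_self ht)
  rwa [← h3] at this

/-- `H¹` embeds into the continuous functions. -/
theorem exists_norm_rep_le (hab : a < b) (n : ℕ) :
    ∃ C : ℝ, 0 ≤ C ∧ ∀ y : H1 a b n, ∀ t ∈ Icc a b, ‖y.rep t‖ ≤ C * ‖y‖ := by
  have hba : 0 < b - a := sub_pos.mpr hab
  refine ⟨(b - a)⁻¹ * (√(b - a) + (b - a) * √(b - a)) + √(b - a), by positivity, ?_⟩
  intro y t ht
  have hder : ∀ s ∈ Icc a b, ‖∫ r in a..s, y.der r‖ ≤ √(b - a) * ‖y‖ := by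
    intro s hs
    calc ‖∫ r in a..s, y.der r‖ ≤ ∫ r in a..s, ‖y.der r‖ :=
          intervalIntegral.norm_integral_le_integral_norm hs.1
      _ ≤ ∫ r in a..b, ‖y.der r‖ := by
          apply intervalIntegral.integral_mono_interval le_rfl hs.1 hs.2
          · exact Eventually.of_forall fun r => norm_nonneg _
          · exact (y.intervalIntegrable_der hab).norm
      _ ≤ √(b - a) * ‖y.1.snd‖ := by
          rw [← integral_timeMeasure hab.le]
          exact integral_norm_L2_le hab.le y.1.snd
      _ ≤ √(b - a) * ‖y‖ := by gcongr; exact y.norm_snd_le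
  have hG : IntervalIntegrable (fun s => ∫ r in a..s, y.der r) volume a b :=
    ((uIcc_of_le hab.le).symm ▸ y.continuousOn_primitive hab :
      ContinuousOn _ (uIcc a b)).intervalIntegrable
  have hfn : ‖∫ s in a..b, y.fn s‖ ≤ √(b - a) * ‖y‖ :=
    calc ‖∫ s in a..b, y.fn s‖ ≤ ∫ s in a..b, ‖y.fn s‖ :=
          intervalIntegral.norm_integral_le_integral_norm hab.le
      _ ≤ √(b - a) * ‖y.1.fst‖ := by
          rw [← integral_timeMeasure hab.le]
          exact integral_norm_L2_le hab.le y.1.fst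
      _ ≤ √(b - a) * ‖y‖ := by gcongr; exact y.norm_fst_le
  have hprim : ‖∫ s in a..b, ∫ r in a..s, y.der r‖ ≤ √(b - a) * ‖y‖ * (b - a) := by
    have := intervalIntegral.norm_integral_le_of_norm_le_const (a := a) (b := b)
      (f := fun s => ∫ r in a..s, y.der r) (C := √(b - a) * ‖y‖) (fun s hs => by
        rw [uIoc_of_le hab.le] at hs
        exact hder s (Ioc_subset_Icc_self hs))
    rwa [abs_of_pos hba] at this
  calc ‖y.rep t‖ ≤ ‖(b - a)⁻¹ • (∫ s in a..b, (y.fn s - ∫ r in a..s, y.der r))‖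
        + ‖∫ r in a..t, y.der r‖ := norm_add_le _ _
    _ ≤ (b - a)⁻¹ * (√(b - a) * ‖y‖ + √(b - a) * ‖y‖ * (b - a)) + √(b - a) * ‖y‖ := by
        refine add_le_add ?_ (hder t ht)
        rw [norm_smul, intervalIntegral.integral_sub (y.intervalIntegrable_fn hab) hG,
          Real.norm_of_nonneg (by positivity)]
        gcongr
        exact (norm_sub_le _ _).trans (add_le_add hfn hprim)
    _ = _ := by ring

/-- `embeddingNorm` is an infimum of admissible constants. Dividing by `‖y‖` shows that the infimum
is itself admissible; `exists_norm_rep_le` is needed so that it runs over a nonempty set. -/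
theorem norm_rep_le_embeddingNorm {T : ℝ} (hT : 0 < T) (y : H1 0 T n) {t : ℝ}
    (ht : t ∈ Icc 0 T) : ‖y.rep t‖ ≤ embeddingNorm T n * ‖y‖ := by
  obtain ⟨C, hC0, hC⟩ := exists_norm_rep_le hT n
  rcases (norm_nonneg y).eq_or_lt' with h0 | h0
  · simpa [h0] using hC y t ht
  · rw [← div_le_iff₀ h0]
    refine le_csInf ⟨C, hC0, hC⟩ ?_
    rintro D ⟨_, hD⟩
    rw [div_le_iff₀ h0]
    exact hD y t ht

theorem exists_restrict {c : ℝ} (hac : a ≤ c) (hcb : c < b) (y : H1 a b n) :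
    ∃ z : H1 c b n, EqOn z.rep y.rep (Icc c b) ∧ z.der =ᵐ[timeMeasure c b] y.der := by
  have hab : a < b := hac.trans_lt hcb
  have hv : MemLp y.der 2 (timeMeasure c b) :=
    y.memLp_der.mono_measure (Measure.restrict_mono (Ioo_subset_Ioo_left hac) le_rfl)
  obtain ⟨z, hz0, hz⟩ := exists_of_memLp hcb (y.rep c) hv
  refine ⟨z, fun t ht => ?_, hz⟩
  rw [z.rep_eq_add_integral, hz0, integral_der_congr hz (left_mem_Icc.mpr hcb.le) ht,
    ← y.rep_sub_rep hab ⟨hac, hcb.le⟩ ⟨hac.trans ht.1, ht.2⟩]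
  abel

/-- Concatenation of trajectories. -/
theorem exists_glue {c : ℝ} (hac : a ≤ c) (hcb : c < b) (y : H1 a b n) (z : H1 c b n)
    (hyz : z.rep c = y.rep c) :
    ∃ w : H1 a b n, EqOn w.rep y.rep (Icc a c) ∧ EqOn w.rep z.rep (Icc c b) ∧
      w.der =ᵐ[timeMeasure a b] fun t => if t ≤ c then y.der t else z.der t := by
  have hab : a < b := hac.trans_lt hcb
  have hv : MemLp (fun t => if t ≤ c then y.der t else z.der t) 2 (timeMeasure a b) := by
    have h1 : MemLp ((Iic c).indicator y.der) 2 (timeMeasure a b) :=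
      y.memLp_der.indicator measurableSet_Iic
    have h2 : MemLp ((Ioo c b).indicator z.der) 2 (timeMeasure a b) := by
      have h3 : MemLp ((Ioo c b).indicator z.der) 2 volume :=
        (memLp_indicator_iff_restrict measurableSet_Ioo).mpr z.memLp_der
      exact h3.mono_measure Measure.restrict_le_self
    refine (h1.add h2).ae_eq ?_
    filter_upwards [ae_restrict_mem measurableSet_Ioo] with t ht
    by_cases h : t ≤ c
    · simp [h, indicator, not_lt.mpr h]
    · simp [h, indicator, not_le.mp h, ht.2]
  obtain ⟨w, hw0, hw⟩ := exists_of_memLp hab (y.rep a) hv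
  have hwy : EqOn w.rep y.rep (Icc a c) := by
    intro t ht
    rw [w.rep_eq_add_integral, hw0, y.rep_eq_add_integral t,
      integral_der_congr hw (left_mem_Icc.mpr hab.le) ⟨ht.1, ht.2.trans hcb.le⟩]
    congr 1
    apply intervalIntegral.integral_congr
    intro r hr
    rw [uIcc_of_le ht.1] at hr
    simp [hr.2.trans ht.2]
  refine ⟨w, hwy, fun t ht => ?_, hw⟩
  have hc : c ∈ Icc a b := ⟨hac, hcb.le⟩
  have ht' : t ∈ Icc a b := ⟨hac.trans ht.1, ht.2⟩
  have h1 := w.rep_sub_rep hab hc ht'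
  have h2 := z.rep_sub_rep hcb (left_mem_Icc.mpr hcb.le) ht
  have h3 : ∫ r in c..t, w.der r = ∫ r in c..t, z.der r := by
    rw [integral_der_congr hw hc ht']
    apply intervalIntegral.integral_congr_ae
    refine Eventually.of_forall fun r hr => ?_
    rw [uIoc_of_le ht.1] at hr
    simp [not_le.mpr hr.1]
  rw [h3, ← h2, hwy ⟨hac, le_rfl⟩, hyz] at h1
  exact sub_left_inj.mp h1

/-- Integration by parts in `H¹`. -/
theorem integral_inner_der (hab : a < b) (y z : H1 a b n) :
    ∫ t in a..b, (inner ℝ (y.der t) (z.rep t) + inner ℝ (y.rep t) (z.der t))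
      = inner ℝ (y.rep b) (z.rep b) - inner ℝ (y.rep a) (z.rep a) := by
  have hcomp : ∀ (w : H1 a b n) (i : Fin n), IntervalIntegrable (fun t => w.der t i) volume a b :=
    fun w i => by
      have := (EuclideanSpace.proj (𝕜 := ℝ) i).integrable_comp (L2.integrable w.1.snd)
      exact (intervalIntegrable_iff_timeMeasure hab.le _).mpr this
  have hrep : ∀ (w : H1 a b n) (i : Fin n), ∀ t ∈ Icc a b,
      w.rep t i = w.rep a i + ∫ r in a..t, w.der r i := by
    intro w i t ht
    have h1 := w.rep_eq_add_integral t
    have h2 := (EuclideanSpace.proj (𝕜 := ℝ) i).intervalIntegral_comp_comm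
      (w.intervalIntegrable_der_of_mem hab (left_mem_Icc.mpr hab.le) ht)
    conv_lhs => rw [h1]
    rw [PiLp.add_apply]
    congr 1
    exact h2.symm
  -- Work by coordinates: on `[a, b]` each coordinate of the representative is a constant plus a
  -- primitive of an integrable function, hence absolutely continuous, and the scalar product rule
  -- applies.
  have hac : ∀ (w : H1 a b n) (i : Fin n),
      AbsolutelyContinuousOnInterval (fun t => w.rep a i + ∫ r in a..t, w.der r i) a b :=
    fun w i => by
      have h0 : AbsolutelyContinuousOnInterval (fun _ : ℝ => w.rep a i) a b :=
        (contDiff_const (n := 1)).contDiffOn.absolutelyContinuousOnInterval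
      exact h0.fun_add
        ((hcomp w i).absolutelyContinuousOnInterval_intervalIntegral (c := a) left_mem_uIcc)
  have hder : ∀ (w : H1 a b n) (i : Fin n), ∀ᵐ t, t ∈ uIoc a b →
      deriv (fun t => w.rep a i + ∫ r in a..t, w.der r i) t = w.der t i := by
    intro w i
    filter_upwards [(hcomp w i).ae_hasDerivAt_integral] with x hx hxm
    exact ((hx (uIoc_subset_uIcc hxm) a left_mem_uIcc).const_add _).deriv
  have hi : ∀ i : Fin n, ∫ t in a..b, (y.der t i * z.rep t i + y.rep t i * z.der t i)
      = y.rep b i * z.rep b i - y.rep a i * z.rep a i := by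
    intro i
    have h := (hac y i).integral_deriv_mul_eq_sub (hac z i)
    rw [← hrep y i b (right_mem_Icc.mpr hab.le), ← hrep z i b (right_mem_Icc.mpr hab.le),
      ← hrep y i a (left_mem_Icc.mpr hab.le), ← hrep z i a (left_mem_Icc.mpr hab.le)] at h
    rw [← h]
    apply intervalIntegral.integral_congr_ae
    filter_upwards [hder y i, hder z i] with t h1 h2 ht
    have htm : t ∈ Icc a b := by
      rw [uIoc_of_le hab.le] at ht
      exact Ioc_subset_Icc_self ht
    rw [h1 ht, h2 ht, ← hrep y i t htm, ← hrep z i t htm]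
  have hinner : ∀ v w : Vec n, inner ℝ v w = ∑ i, v i * w i := fun v w => by
    simp [PiLp.inner_apply, mul_comm]
  have hci : ∀ (w : H1 a b n) (i : Fin n), ContinuousOn (fun t => w.rep t i) (uIcc a b) := by
    intro w i
    rw [uIcc_of_le hab.le]
    exact (EuclideanSpace.proj (𝕜 := ℝ) i).continuous.comp_continuousOn (w.continuousOn_rep hab)
  simp only [hinner, ← Finset.sum_add_distrib, ← Finset.sum_sub_distrib]
  rw [intervalIntegral.integral_finsetSum]
  · exact Finset.sum_congr rfl fun i _ => hi i
  · intro i _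
    exact ((hcomp y i).mul_continuousOn (hci z i)).add ((hcomp z i).continuousOn_mul (hci y i))

end H1

/-! ### Grönwall estimates and Carathéodory differential equations -/

/-- Grönwall's inequality in integral form. -/
theorem le_mul_exp_of_le_add_integral {φ : ℝ → ℝ} {a b A L : ℝ} (hab : a ≤ b) (hL : 0 ≤ L)
    (hφ : ContinuousOn φ (Icc a b))
    (h : ∀ t ∈ Icc a b, φ t ≤ A + L * ∫ s in a..t, φ s) :
    ∀ t ∈ Icc a b, φ t ≤ A * Real.exp (L * (t - a)) := by
  -- Extending `φ` by its boundary values makes it continuous on the line, so that its primitive is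
  -- differentiable everywhere and the differential form of Grönwall's inequality applies.
  set ψ : ℝ → ℝ := IccExtend hab ((Icc a b).domRestrict φ) with hψ
  have hψc : Continuous ψ := (continuousOn_iff_continuous_domRestrict.mp hφ).Icc_extend'
  have hψφ : ∀ t ∈ Icc a b, ψ t = φ t := fun t ht => IccExtend_of_mem hab _ ht
  have hint : ∀ t ∈ Icc a b, ∫ s in a..t, ψ s = ∫ s in a..t, φ s := by
    intro t ht
    apply intervalIntegral.integral_congr
    intro s hs
    rw [uIcc_of_le ht.1] at hs
    exact hψφ s ⟨hs.1, hs.2.trans ht.2⟩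
  have hd : ∀ t, HasDerivAt (fun t => A + L * ∫ s in a..t, ψ s) (L * ψ t) t := fun t =>
    ((intervalIntegral.integral_hasDerivAt_right (hψc.intervalIntegrable _ _)
      (hψc.stronglyMeasurableAtFilter _ _) hψc.continuousAt).const_mul L).const_add A
  have key := le_gronwallBound_of_liminf_deriv_right_le (a := a) (b := b)
    (f := fun t => A + L * ∫ s in a..t, ψ s) (f' := fun t => L * ψ t) (δ := A) (K := L) (ε := 0)
    (fun t _ => (hd t).continuousAt.continuousWithinAt)
    (fun t _ r hr => (hd t).hasDerivWithinAt.liminf_right_slope_le hr) (by simp)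
    (fun t ht => by
      have ht' := Ico_subset_Icc_self ht
      rw [hint t ht', hψφ t ht', add_zero]
      exact mul_le_mul_of_nonneg_left (h t ht') hL)
  intro t ht
  have h1 := key t ht
  rw [gronwallBound_ε0, hint t ht] at h1
  exact (h t ht).trans h1

/-- The nearest point map onto a closed convex set. -/
theorem exists_lipschitz_retraction {E : Type*} [NormedAddCommGroup E] [InnerProductSpace ℝ E]
    [CompleteSpace E] {K : Set E} (hne : K.Nonempty) (hcl : IsClosed K) (hcv : Convex ℝ K) :
    ∃ π : E → E, (∀ x, π x ∈ K) ∧ (∀ x ∈ K, π x = x) ∧ ∀ x y, ‖π x - π y‖ ≤ ‖x - y‖ := by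
  have h : ∀ x : E, ∃ v ∈ K, ∀ w ∈ K, inner ℝ (x - v) (w - v) ≤ 0 := by
    intro x
    obtain ⟨v, hv, hv'⟩ := exists_norm_eq_iInf_of_complete_convex hne hcl.isComplete hcv x
    exact ⟨v, hv, (norm_eq_iInf_iff_real_inner_le_zero hcv hv).mp hv'⟩
  choose π hπ hπ' using h
  refine ⟨π, hπ, fun x hx => ?_, fun x y => ?_⟩
  · have h1 := hπ' x x hx
    rw [real_inner_self_nonpos, sub_eq_zero] at h1
    exact h1.symm
  · have h1 := hπ' x (π y) (hπ y)
    have h2 := hπ' y (π x) (hπ x)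
    -- The sum of the two obtuse angle inequalities is firm nonexpansiveness; Cauchy–Schwarz then
    -- gives the Lipschitz bound.
    have h3 : ‖π x - π y‖ ^ 2 ≤ inner ℝ (x - y) (π x - π y) := by
      rw [← real_inner_self_eq_norm_sq]
      have e1 : inner ℝ (x - y) (π x - π y) - inner ℝ (π x - π y) (π x - π y)
          = -inner ℝ (x - π x) (π y - π x) - inner ℝ (y - π y) (π x - π y) := by
        simp only [inner_sub_left, inner_sub_right]
        ring
      linarith
    have h4 := real_inner_le_norm (x - y) (π x - π y)
    by_contra! hlt
    have h5 : 0 < ‖π x - π y‖ := (norm_nonneg _).trans_lt hlt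
    nlinarith

namespace H1

variable {a b : ℝ} {n : ℕ}

theorem measurePreserving_reflect (a b : ℝ) :
    MeasurePreserving (fun t => a + b - t) (timeMeasure a b) (timeMeasure a b) := by
  have h := (Measure.measurePreserving_sub_left volume (a + b)).restrict_preimage
    (measurableSet_Ioo (a := a) (b := b))
  have e : (fun t => a + b - t) ⁻¹' Ioo a b = Ioo a b := by
    ext t
    simp only [mem_preimage, mem_Ioo]
    constructor <;> rintro ⟨h1, h2⟩ <;> constructor <;> linarith
  rwa [e] at h

/-- Time reversal. -/
theorem exists_reflect (hab : a < b) (y : H1 a b n) :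
    ∃ z : H1 a b n, (∀ t ∈ Icc a b, z.rep t = y.rep (a + b - t)) ∧
      z.der =ᵐ[timeMeasure a b] fun t => -y.der (a + b - t) := by
  have hv : MemLp (fun t => -y.der (a + b - t)) 2 (timeMeasure a b) :=
    (y.memLp_der.comp_measurePreserving (measurePreserving_reflect a b)).neg
  obtain ⟨z, hz0, hz⟩ := exists_of_memLp hab (y.rep b) hv
  refine ⟨z, fun t ht => ?_, hz⟩
  have ht' : a + b - t ∈ Icc a b := ⟨by linarith [ht.2], by linarith [ht.1]⟩
  have h1 := y.rep_sub_rep hab ht' (right_mem_Icc.mpr hab.le)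
  rw [z.rep_eq_add_integral, hz0, integral_der_congr hz (left_mem_Icc.mpr hab.le) ht,
    intervalIntegral.integral_neg,
    intervalIntegral.integral_comp_sub_left (fun r => y.der r) (a + b), add_sub_cancel_left, ← h1]
  abel

theorem norm_rep_le_of_norm_der_le (hab : a < b) (y : H1 a b n) {L : ℝ} (hL : 0 ≤ L) {β : ℝ → ℝ}
    (hβ : Integrable β (timeMeasure a b)) (hβ0 : ∀ t, 0 ≤ β t)
    (h : ∀ᵐ t ∂(timeMeasure a b), ‖y.der t‖ ≤ L * ‖y.rep t‖ + β t) :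
    ∀ t ∈ Icc a b, ‖y.rep t‖ ≤ (‖y.rep a‖ + ∫ s in a..b, β s) * Real.exp (L * (b - a)) := by
  have hβi := (intervalIntegrable_iff_timeMeasure hab.le β).mpr hβ
  have hc := y.continuousOn_rep hab
  have hA : 0 ≤ ‖y.rep a‖ + ∫ s in a..b, β s :=
    add_nonneg (norm_nonneg _) (intervalIntegral.integral_nonneg hab.le fun s _ => hβ0 s)
  have key := le_mul_exp_of_le_add_integral (A := ‖y.rep a‖ + ∫ s in a..b, β s) hab.le hL hc.norm ?_
  · intro t ht
    refine (key t ht).trans (mul_le_mul_of_nonneg_left ?_ hA)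
    gcongr
    exact ht.2
  intro t ht
  have hsub : uIcc a t ⊆ uIcc a b := by
    rw [uIcc_of_le ht.1, uIcc_of_le hab.le]
    exact Icc_subset_Icc_right ht.2
  have hci : IntervalIntegrable (fun s => ‖y.rep s‖) volume a t := by
    apply ContinuousOn.intervalIntegrable
    rw [uIcc_of_le ht.1]
    exact hc.norm.mono (Icc_subset_Icc_right ht.2)
  have hbt : IntervalIntegrable β volume a t := hβi.mono_set hsub
  have hae : ∀ᵐ s ∂(volume.restrict (Icc a t)), ‖y.der s‖ ≤ L * ‖y.rep s‖ + β s := by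
    rw [timeMeasure, restrict_Ioo_eq_restrict_Icc] at h
    exact ae_mono (Measure.restrict_mono (Icc_subset_Icc_right ht.2) le_rfl) h
  calc ‖y.rep t‖ = ‖y.rep a + ∫ s in a..t, y.der s‖ := by rw [← y.rep_eq_add_integral]
    _ ≤ ‖y.rep a‖ + ‖∫ s in a..t, y.der s‖ := norm_add_le _ _
    _ ≤ ‖y.rep a‖ + ∫ s in a..t, ‖y.der s‖ := by
        gcongr
        exact intervalIntegral.norm_integral_le_integral_norm ht.1
    _ ≤ ‖y.rep a‖ + ∫ s in a..t, (L * ‖y.rep s‖ + β s) := by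
        gcongr
        exact intervalIntegral.integral_mono_ae_restrict ht.1
          ((y.intervalIntegrable_der hab).mono_set hsub).norm ((hci.const_mul L).add hbt) hae
    _ = ‖y.rep a‖ + ((∫ s in a..t, β s) + L * ∫ s in a..t, ‖y.rep s‖) := by
        rw [intervalIntegral.integral_add (hci.const_mul L) hbt,
          intervalIntegral.integral_const_mul, add_comm (L * _)]
    _ ≤ ‖y.rep a‖ + ((∫ s in a..b, β s) + L * ∫ s in a..t, ‖y.rep s‖) := by
        gcongr
        exact intervalIntegral.integral_mono_interval le_rfl ht.1 ht.2
          (Eventually.of_forall hβ0) hβi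
    _ = _ := by ring

/-- Time reversal exchanges the endpoints and preserves the bound on `‖ẏ‖`. -/
theorem norm_rep_le_of_norm_der_le_right (hab : a < b) (y : H1 a b n) {L : ℝ} (hL : 0 ≤ L)
    {β : ℝ → ℝ} (hβ : Integrable β (timeMeasure a b)) (hβ0 : ∀ t, 0 ≤ β t)
    (h : ∀ᵐ t ∂(timeMeasure a b), ‖y.der t‖ ≤ L * ‖y.rep t‖ + β t) :
    ∀ t ∈ Icc a b, ‖y.rep t‖ ≤ (‖y.rep b‖ + ∫ s in a..b, β s) * Real.exp (L * (b - a)) := by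
  obtain ⟨z, hz, hzd⟩ := y.exists_reflect hab
  have hmp := measurePreserving_reflect a b
  have key := z.norm_rep_le_of_norm_der_le hab hL (β := fun t => β (a + b - t))
    (hmp.integrable_comp_of_integrable hβ) (fun t => hβ0 _) (by
      filter_upwards [hzd, hmp.quasiMeasurePreserving.ae h, ae_restrict_mem measurableSet_Ioo]
        with t h1 h2 h3
      rw [h1, norm_neg, hz t (Ioo_subset_Icc_self h3)]
      exact h2)
  intro t ht
  have ht' : a + b - t ∈ Icc a b := ⟨by linarith [ht.2], by linarith [ht.1]⟩
  have h1 := key _ ht'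
  rw [hz _ ht', hz a (left_mem_Icc.mpr hab.le),
    intervalIntegral.integral_comp_sub_left β (a + b)] at h1
  simpa using h1

theorem norm_le_of_rep_bound (hab : a < b) (y : H1 a b n) {L η A : ℝ} (hL : 0 ≤ L) (hη : 0 ≤ η)
    (h : ∀ᵐ t ∂(timeMeasure a b), ‖y.der t‖ ≤ L * ‖y.rep t‖ + η)
    (hA : ∀ t ∈ Icc a b, ‖y.rep t‖ ≤ A) :
    ‖y‖ ≤ √(b - a) * (A + (L * A + η)) := by
  have hA0 : 0 ≤ A := (norm_nonneg _).trans (hA a (left_mem_Icc.mpr hab.le))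
  refine y.norm_le_of_bounds hab (by positivity) hA ?_
  filter_upwards [h, ae_restrict_mem measurableSet_Ioo] with t h1 ht
  exact h1.trans (by gcongr; exact hA t (Ioo_subset_Icc_self ht))

/-- The constant in the Grönwall estimates below. -/
def gronwallConst (τ L : ℝ) : ℝ :=
  (1 + τ) * Real.exp (L * τ) + √τ * ((1 + τ) * Real.exp (L * τ) * (1 + L) + 1)

theorem gronwallConst_nonneg {τ L : ℝ} (hτ : 0 ≤ τ) (hL : 0 ≤ L) : 0 ≤ gronwallConst τ L := by
  unfold gronwallConst
  positivity

/-- Common end of the left and right estimates. `gronwallConst` is the sum of the factor for the sup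
norm and the factor for the H¹ norm, so a single constant serves both. -/
theorem gronwall_aux {y : H1 a b n} (hab : a < b) {L η : ℝ} (hL : 0 ≤ L) (hη : 0 ≤ η)
    (h : ∀ᵐ t ∂(timeMeasure a b), ‖y.der t‖ ≤ L * ‖y.rep t‖ + η)
    (hA : ∀ t ∈ Icc a b, ‖y.rep t‖ ≤ (η + ∫ _ in a..b, η) * Real.exp (L * (b - a))) :
    (∀ t ∈ Icc a b, ‖y.rep t‖ ≤ gronwallConst (b - a) L * η) ∧
      ‖y‖ ≤ gronwallConst (b - a) L * η := by
  have hτ : 0 ≤ b - a := sub_nonneg.mpr hab.le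
  have hn := y.norm_le_of_rep_bound hab hL hη h hA
  rw [intervalIntegral.integral_const, smul_eq_mul] at hA hn
  have e1 : (η + (b - a) * η) * Real.exp (L * (b - a))
      = (1 + (b - a)) * Real.exp (L * (b - a)) * η := by ring
  rw [e1] at hA hn
  constructor
  · intro t ht
    refine (hA t ht).trans (mul_le_mul_of_nonneg_right ?_ hη)
    exact le_add_of_nonneg_right (by positivity)
  · refine hn.trans ?_
    have e2 : √(b - a) * ((1 + (b - a)) * Real.exp (L * (b - a)) * η
        + (L * ((1 + (b - a)) * Real.exp (L * (b - a)) * η) + η))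
        = √(b - a) * ((1 + (b - a)) * Real.exp (L * (b - a)) * (1 + L) + 1) * η := by ring
    rw [e2]
    refine mul_le_mul_of_nonneg_right ?_ hη
    exact le_add_of_nonneg_left (by positivity)

/-- Grönwall's inequality in `H¹`, started on the left. -/
theorem gronwall_left (hab : a < b) {y : H1 a b n} {L η : ℝ} (hL : 0 ≤ L)
    (h0 : ‖y.rep a‖ ≤ η)
    (h : ∀ᵐ t ∂(timeMeasure a b), ‖y.der t‖ ≤ L * ‖y.rep t‖ + η) :
    (∀ t ∈ Icc a b, ‖y.rep t‖ ≤ gronwallConst (b - a) L * η) ∧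
      ‖y‖ ≤ gronwallConst (b - a) L * η := by
  have hη : 0 ≤ η := (norm_nonneg _).trans h0
  refine gronwall_aux hab hL hη h fun t ht =>
    (y.norm_rep_le_of_norm_der_le hab hL (integrable_const η) (fun _ => hη) h t ht).trans ?_
  gcongr

/-- Grönwall's inequality in `H¹`, started on the right. -/
theorem gronwall_right (hab : a < b) {y : H1 a b n} {L η : ℝ} (hL : 0 ≤ L)
    (h0 : ‖y.rep b‖ ≤ η)
    (h : ∀ᵐ t ∂(timeMeasure a b), ‖y.der t‖ ≤ L * ‖y.rep t‖ + η) :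
    (∀ t ∈ Icc a b, ‖y.rep t‖ ≤ gronwallConst (b - a) L * η) ∧
      ‖y‖ ≤ gronwallConst (b - a) L * η := by
  have hη : 0 ≤ η := (norm_nonneg _).trans h0
  refine gronwall_aux hab hL hη h fun t ht =>
    (y.norm_rep_le_of_norm_der_le_right hab hL (integrable_const η) (fun _ => hη) h t ht).trans ?_
  gcongr

/-- Global solutions of Carathéodory differential equations with a Lipschitz right hand side. -/
theorem exists_solution (hab : a < b) {h : ℝ → Vec n → Vec n} {L : ℝ} (hL0 : 0 ≤ L)
    (hL : ∀ t ∈ Icc a b, ∀ x y, ‖h t x - h t y‖ ≤ L * ‖x - y‖)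
    (hm : ∀ y : ℝ → Vec n, Continuous y → MemLp (fun t => h t (y t)) 2 (timeMeasure a b))
    (c : Vec n) :
    ∃ y : H1 a b n, y.rep a = c ∧ ∀ᵐ t ∂(timeMeasure a b), y.der t = h t (y.rep t) := by
  -- Picard iteration in a weighted norm: the unknown is `ψ = exp(-κ (t - a)) y` and `lift` removes
  -- the weight. The integral operator then has Lipschitz constant `L / κ ≤ 1/2` on the whole
  -- interval, whatever its length.
  set κ : ℝ := 2 * (L + 1) with hκ
  have hκ0 : 0 < κ := by positivity
  let lift : C(Icc a b, Vec n) → ℝ → Vec n := fun ψ t =>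
    Real.exp (κ * (t - a)) • IccExtend hab.le ψ t
  have hlift : ∀ ψ, Continuous (lift ψ) := fun ψ =>
    (by fun_prop : Continuous fun t : ℝ => Real.exp (κ * (t - a))).smul ψ.continuous.Icc_extend'
  have hint : ∀ ψ, IntervalIntegrable (fun s => h s (lift ψ s)) volume a b := fun ψ =>
    (intervalIntegrable_iff_timeMeasure hab.le _).mpr ((hm _ (hlift ψ)).integrable one_le_two)
  have hprim : ∀ ψ, ContinuousOn (fun t => ∫ s in a..t, h s (lift ψ s)) (Icc a b) := fun ψ => by
    have h := intervalIntegral.continuousOn_primitive_interval' (hint ψ) left_mem_uIcc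
    rwa [uIcc_of_le hab.le] at h
  let Φ : C(Icc a b, Vec n) → C(Icc a b, Vec n) := fun ψ =>
    ⟨(Icc a b).domRestrict fun t => Real.exp (-(κ * (t - a))) • (c + ∫ s in a..t, h s (lift ψ s)),
      continuousOn_iff_continuous_domRestrict.mp
        ((by fun_prop : Continuous fun t : ℝ => Real.exp (-(κ * (t - a)))).continuousOn.smul
          (continuousOn_const.add (hprim ψ)))⟩
  have hcontr : ContractingWith (1 / 2) Φ := by
    refine ⟨by norm_num, LipschitzWith.of_dist_le_mul fun ψ χ => ?_⟩
    rw [ContinuousMap.dist_le (by positivity)]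
    rintro ⟨t, ht⟩
    have hsub : uIcc a t ⊆ uIcc a b := by
      rw [uIcc_of_le ht.1, uIcc_of_le hab.le]
      exact Icc_subset_Icc_right ht.2
    have hpt : ∀ s ∈ Icc a t, ‖h s (lift ψ s) - h s (lift χ s)‖
        ≤ L * dist ψ χ * Real.exp (κ * (s - a)) := by
      intro s hs
      have hs' : s ∈ Icc a b := ⟨hs.1, hs.2.trans ht.2⟩
      refine (hL s hs' _ _).trans ?_
      rw [← smul_sub, norm_smul, Real.norm_of_nonneg (Real.exp_pos _).le, ← dist_eq_norm,
        IccExtend_of_mem hab.le _ hs', IccExtend_of_mem hab.le _ hs']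
      have := ContinuousMap.dist_apply_le_dist (f := ψ) (g := χ) ⟨s, hs'⟩
      calc L * (Real.exp (κ * (s - a)) * dist (ψ ⟨s, hs'⟩) (χ ⟨s, hs'⟩))
          ≤ L * (Real.exp (κ * (s - a)) * dist ψ χ) := by gcongr
        _ = _ := by ring
    have hexp : ∫ s in a..t, L * dist ψ χ * Real.exp (κ * (s - a))
        = L * dist ψ χ * ((Real.exp (κ * (t - a)) - 1) / κ) := by
      rw [intervalIntegral.integral_const_mul]
      congr 1
      have hd : ∀ s ∈ uIcc a t, HasDerivAt (fun s => Real.exp (κ * (s - a)) / κ)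
          (Real.exp (κ * (s - a))) s := by
        intro s _
        have h1 : HasDerivAt (fun s => κ * (s - a)) κ s := by
          simpa using ((hasDerivAt_id s).sub_const a).const_mul κ
        have h2 := h1.exp.div_const κ
        rwa [mul_div_assoc, div_self hκ0.ne', mul_one] at h2
      rw [intervalIntegral.integral_eq_sub_of_hasDerivAt hd
        ((by fun_prop : Continuous fun s : ℝ => Real.exp (κ * (s - a))).intervalIntegrable _ _)]
      simp
      ring
    have hmain : ‖∫ s in a..t, (h s (lift ψ s) - h s (lift χ s))‖
        ≤ L * dist ψ χ * ((Real.exp (κ * (t - a)) - 1) / κ) := by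
      rw [← hexp]
      refine (intervalIntegral.norm_integral_le_integral_norm ht.1).trans ?_
      refine intervalIntegral.integral_mono_on ht.1
        (((hint ψ).mono_set hsub).sub ((hint χ).mono_set hsub)).norm
        ((by fun_prop : Continuous fun s : ℝ =>
          L * dist ψ χ * Real.exp (κ * (s - a))).intervalIntegrable _ _) hpt
    change dist (Real.exp (-(κ * (t - a))) • (c + ∫ s in a..t, h s (lift ψ s)))
      (Real.exp (-(κ * (t - a))) • (c + ∫ s in a..t, h s (lift χ s))) ≤ _
    rw [dist_eq_norm, ← smul_sub, add_sub_add_left_eq_sub,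
      ← intervalIntegral.integral_sub ((hint ψ).mono_set hsub) ((hint χ).mono_set hsub),
      norm_smul, Real.norm_of_nonneg (Real.exp_pos _).le]
    calc _ ≤ Real.exp (-(κ * (t - a)))
          * (L * dist ψ χ * ((Real.exp (κ * (t - a)) - 1) / κ)) := by gcongr
      _ = L / κ * dist ψ χ
          * (Real.exp (-(κ * (t - a))) * Real.exp (κ * (t - a)) - Real.exp (-(κ * (t - a)))) := by
          field_simp
      _ ≤ L / κ * dist ψ χ * 1 := by
          gcongr
          rw [← Real.exp_add, neg_add_cancel, Real.exp_zero]
          linarith [Real.exp_pos (-(κ * (t - a)))]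
      _ ≤ ((1 / 2 : NNReal) : ℝ) * dist ψ χ := by
          rw [mul_one]
          gcongr
          rw [div_le_iff₀ hκ0, hκ]
          push_cast
          linarith
  set ψ := hcontr.fixedPoint with hψ
  have hfix : Φ ψ = ψ := hcontr.fixedPoint_isFixedPt
  obtain ⟨y, hy0, hy⟩ := exists_of_memLp hab c (hm _ (hlift ψ))
  have hrep : ∀ t ∈ Icc a b, y.rep t = lift ψ t := by
    intro t ht
    rw [y.rep_eq_add_integral, hy0, integral_der_congr hy (left_mem_Icc.mpr hab.le) ht]
    have h1 : ψ ⟨t, ht⟩ = Real.exp (-(κ * (t - a))) • (c + ∫ s in a..t, h s (lift ψ s)) := by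
      conv_lhs => rw [← hfix]
      rfl
    change _ = Real.exp (κ * (t - a)) • IccExtend hab.le ψ t
    rw [IccExtend_of_mem hab.le _ ht, h1, smul_smul, ← Real.exp_add]
    simp
  refine ⟨y, hy0, ?_⟩
  filter_upwards [hy, ae_restrict_mem measurableSet_Ioo] with t h1 ht
  rw [h1, hrep t (Ioo_subset_Icc_self ht)]

theorem exists_solution_right (hab : a < b) {h : ℝ → Vec n → Vec n} {L : ℝ} (hL0 : 0 ≤ L)
    (hL : ∀ t ∈ Icc a b, ∀ x y, ‖h t x - h t y‖ ≤ L * ‖x - y‖)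
    (hm : ∀ y : ℝ → Vec n, Continuous y → MemLp (fun t => h t (y t)) 2 (timeMeasure a b))
    (c : Vec n) :
    ∃ y : H1 a b n, y.rep b = c ∧ ∀ᵐ t ∂(timeMeasure a b), y.der t = h t (y.rep t) := by
  have hmp := measurePreserving_reflect a b
  have hr : ∀ t ∈ Icc a b, a + b - t ∈ Icc a b := fun t ht =>
    ⟨by linarith [ht.2], by linarith [ht.1]⟩
  obtain ⟨z, hz0, hz⟩ := exists_solution hab (h := fun t x => -h (a + b - t) x) hL0
    (fun t ht x y => by
      rw [neg_sub_neg, norm_sub_rev x y]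
      exact hL _ (hr t ht) y x)
    (fun y hy => by
      have h1 := (hm (fun t => y (a + b - t)) (hy.comp (by fun_prop))).comp_measurePreserving hmp
      refine h1.neg.ae_eq (Eventually.of_forall fun t => ?_)
      simp) c
  obtain ⟨y, hy, hyd⟩ := z.exists_reflect hab
  refine ⟨y, by simpa [hz0] using hy b (right_mem_Icc.mpr hab.le), ?_⟩
  filter_upwards [hyd, hmp.quasiMeasurePreserving.ae hz, ae_restrict_mem measurableSet_Ioo]
    with t h1 h2 h3
  rw [h1, h2, hy t (Ioo_subset_Icc_self h3)]
  simp

end H1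

/-! ### Time dependent fields of class C¹ in the state -/

section FieldDef

variable {E F : Type*} [NormedAddCommGroup E] [NormedSpace ℝ E] [NormedAddCommGroup F]
  [NormedSpace ℝ F]

/-- Time dependent maps that are continuous on `[0, T] × K`, together with their derivative in
the state. -/
structure IsC1Field (T : ℝ) (K : Set E) (h : ℝ → E → F) : Prop where
  cont : ContinuousOn (fun z : ℝ × E => h z.1 z.2) (Icc 0 T ×ˢ K)
  diff : ∀ t ∈ Icc 0 T, ∀ x ∈ K, DifferentiableAt ℝ (h t) x
  cont_fderiv : ContinuousOn (fun z : ℝ × E => fderiv ℝ (h z.1) z.2) (Icc 0 T ×ˢ K)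

/-- Time is confined to `[0, T]`, so the joint derivative exists only within the slab. Composition
with `x ↦ (t, x)` involves the state alone, and there `U` is open, which upgrades the result to a
full derivative. -/
theorem ContDiffOn.hasFDerivAt_slice {T : ℝ} {U : Set E} (hU : IsOpen U)
    {h : ℝ → E → F} {k : WithTop ℕ∞} (hk : 1 ≤ k)
    (hh : ContDiffOn ℝ k (fun z : ℝ × E => h z.1 z.2) (Icc 0 T ×ˢ U)) {t : ℝ} (ht : t ∈ Icc 0 T)
    {x : E} (hx : x ∈ U) :
    HasFDerivAt (h t) ((fderivWithin ℝ (fun z : ℝ × E => h z.1 z.2) (Icc 0 T ×ˢ U) (t, x)).comp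
      (ContinuousLinearMap.inr ℝ ℝ E)) x := by
  have h1 : HasFDerivWithinAt (fun z : ℝ × E => h z.1 z.2)
      (fderivWithin ℝ (fun z : ℝ × E => h z.1 z.2) (Icc 0 T ×ˢ U) (t, x)) (Icc 0 T ×ˢ U) (t, x) :=
    (hh.differentiableOn (by positivity) (t, x) ⟨ht, hx⟩).hasFDerivWithinAt
  have h2 : HasFDerivWithinAt (fun x : E => (t, x)) (ContinuousLinearMap.inr ℝ ℝ E) U x :=
    (hasFDerivAt_prodMk_right t x).hasFDerivWithinAt
  have h3 : HasFDerivWithinAt (h t) _ U x := h1.comp x h2 (fun y hy => ⟨ht, hy⟩)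
  exact h3.hasFDerivAt (hU.mem_nhds hx)

theorem ContDiffOn.fderiv_slice {T : ℝ} (hT : 0 < T) {U : Set E} (hU : IsOpen U)
    {h : ℝ → E → F} {k : WithTop ℕ∞}
    (hh : ContDiffOn ℝ (k + 1) (fun z : ℝ × E => h z.1 z.2) (Icc 0 T ×ˢ U)) :
    ContDiffOn ℝ k (fun z : ℝ × E => fderiv ℝ (h z.1) z.2) (Icc 0 T ×ˢ U) := by
  have hu : UniqueDiffOn ℝ (Icc 0 T ×ˢ U) := (uniqueDiffOn_Icc hT).prod hU.uniqueDiffOn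
  have h1 := hh.fderivWithin hu le_rfl
  refine (h1.clm_comp (contDiffOn_const (c := ContinuousLinearMap.inr ℝ ℝ E))).congr fun z hz => ?_
  exact (hh.hasFDerivAt_slice hU le_add_self hz.1 hz.2).fderiv

theorem ContDiffOn.isC1Field {T : ℝ} (hT : 0 < T) {U K : Set E} (hU : IsOpen U) (hK : K ⊆ U)
    {h : ℝ → E → F}
    (hh : ContDiffOn ℝ 1 (fun z : ℝ × E => h z.1 z.2) (Icc 0 T ×ˢ U)) : IsC1Field T K h where
  cont := hh.continuousOn.mono (prod_mono_right hK)
  diff _ ht _ hx := (hh.hasFDerivAt_slice hU le_rfl ht (hK hx)).differentiableAt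
  cont_fderiv :=
    ((hh.of_le (by norm_num) : ContDiffOn ℝ (0 + 1) _ _).fderiv_slice hT hU).continuousOn.mono
      (prod_mono_right hK)

namespace IsC1Field

variable {T : ℝ} {K : Set E} {h : ℝ → E → F}

theorem exists_lipschitz (hh : IsC1Field T K h) (hK : IsCompact K) (hcv : Convex ℝ K) :
    ∃ L : ℝ, 0 ≤ L ∧ (∀ t ∈ Icc 0 T, ∀ x ∈ K, ‖fderiv ℝ (h t) x‖ ≤ L) ∧
      ∀ t ∈ Icc 0 T, ∀ x ∈ K, ∀ y ∈ K, ‖h t x - h t y‖ ≤ L * ‖x - y‖ := by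
  obtain ⟨C, hC⟩ := (isCompact_Icc.prod hK).exists_bound_of_continuousOn hh.cont_fderiv
  have hb : ∀ t ∈ Icc 0 T, ∀ x ∈ K, ‖fderiv ℝ (h t) x‖ ≤ max C 0 := fun t ht x hx =>
    (hC (t, x) ⟨ht, hx⟩).trans (le_max_left _ _)
  refine ⟨max C 0, le_max_right _ _, hb, fun t ht x hx y hy => ?_⟩
  exact hcv.norm_image_sub_le_of_norm_fderiv_le (fun z hz => hh.diff t ht z hz) (hb t ht) hy hx

theorem exists_modulus (hh : IsC1Field T K h) (hK : IsCompact K) (hcv : Convex ℝ K) {η : ℝ}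
    (hη : 0 < η) :
    ∃ δ : ℝ, 0 < δ ∧ ∀ t ∈ Icc 0 T, ∀ x ∈ K, ∀ y ∈ K, ‖y - x‖ < δ →
      ‖fderiv ℝ (h t) y - fderiv ℝ (h t) x‖ ≤ η ∧
      ‖h t y - h t x - fderiv ℝ (h t) x (y - x)‖ ≤ η * ‖y - x‖ := by
  have huc := (isCompact_Icc.prod hK).uniformContinuousOn_of_continuous hh.cont_fderiv
  obtain ⟨δ, hδ, hδ'⟩ := Metric.uniformContinuousOn_iff.mp huc η hη
  have h1 : ∀ t ∈ Icc 0 T, ∀ x ∈ K, ∀ y ∈ K, ‖y - x‖ < δ →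
      ‖fderiv ℝ (h t) y - fderiv ℝ (h t) x‖ ≤ η := by
    intro t ht x hx y hy hxy
    rw [← dist_eq_norm]
    refine (hδ' (t, y) ⟨ht, hy⟩ (t, x) ⟨ht, hx⟩ ?_).le
    rw [Prod.dist_eq, dist_self, dist_eq_norm y x]
    exact max_lt hδ hxy
  refine ⟨δ, hδ, fun t ht x hx y hy hxy => ⟨h1 t ht x hx y hy hxy, ?_⟩⟩
  have hseg : segment ℝ x y ⊆ K := hcv.segment_subset hx hy
  refine (convex_segment x y).norm_image_sub_le_of_norm_fderiv_le'
    (fun z hz => hh.diff t ht z (hseg hz)) (fun z hz => h1 t ht x hx z (hseg hz) ?_)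
    (left_mem_segment ℝ x y) (right_mem_segment ℝ x y)
  refine lt_of_le_of_lt ?_ hxy
  obtain ⟨θ, hθ, rfl⟩ := (segment_eq_image' ℝ x y ▸ hz : z ∈ (fun θ : ℝ => x + θ • (y - x)) '' Icc 0 1)
  rw [add_sub_cancel_left, norm_smul, Real.norm_of_nonneg hθ.1]
  exact mul_le_of_le_one_left (norm_nonneg _) hθ.2

end IsC1Field

end FieldDef

/-! ### Dependence of the flow on the initial value and on the field -/

section Flow

variable {n : ℕ} {T : ℝ}

/-- `Z v` solves the linear equation with coefficient `A` and initial value `v`. -/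
def IsVariation (T : ℝ) (A : ℝ → Vec n →L[ℝ] Vec n) (Z : Vec n →L[ℝ] H1 0 T n) : Prop :=
  ∀ v, (Z v).rep 0 = v ∧ ∀ᵐ t ∂(timeMeasure 0 T), (Z v).der t = A t ((Z v).rep t)

/-- Uniqueness, from Grönwall's inequality with zero data, makes the solution linear in its initial
value; continuity is automatic in finite dimension. -/
theorem exists_isVariation (hT : 0 < T) {A : ℝ → Vec n →L[ℝ] Vec n}
    (hA : ContinuousOn A (Icc 0 T)) : ∃ Z, IsVariation T A Z := by
  obtain ⟨L, hL⟩ := isCompact_Icc.exists_bound_of_continuousOn hA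
  have hL0 : 0 ≤ L := (norm_nonneg _).trans (hL 0 (left_mem_Icc.mpr hT.le))
  have hex : ∀ v, ∃ z : H1 0 T n, z.rep 0 = v ∧
      ∀ᵐ t ∂(timeMeasure 0 T), z.der t = A t (z.rep t) := by
    refine H1.exists_solution hT hL0 (fun t ht x y => ?_) (fun y hy => ?_)
    · rw [← map_sub]
      exact (A t).le_of_opNorm_le (hL t ht) _
    · exact (hA.clm_apply hy.continuousOn).memLp_timeMeasure
  have huniq : ∀ z w : H1 0 T n, z.rep 0 = w.rep 0 →
      (∀ᵐ t ∂(timeMeasure 0 T), z.der t = A t (z.rep t)) →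
      (∀ᵐ t ∂(timeMeasure 0 T), w.der t = A t (w.rep t)) → z = w := by
    intro z w h0 hz hw
    have h1 := (H1.gronwall_left hT (y := z - w) (L := L) (η := 0) hL0 (by
      rw [H1.rep_sub hT z w _ (left_mem_Icc.mpr hT.le), h0, sub_self, norm_zero]) (by
      filter_upwards [hz, hw, H1.der_sub z w, ae_restrict_mem measurableSet_Ioo]
        with t h1 h2 h3 ht
      rw [h3, h1, h2, H1.rep_sub hT z w _ (Ioo_subset_Icc_self ht), ← map_sub, add_zero]
      exact (A t).le_of_opNorm_le (hL t (Ioo_subset_Icc_self ht)) _)).2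
    rw [mul_zero, norm_le_zero_iff, sub_eq_zero] at h1
    exact h1
  choose ζ hζ0 hζ using hex
  let Z : Vec n →ₗ[ℝ] H1 0 T n :=
    { toFun := ζ
      map_add' := fun u v => by
        refine huniq _ _ ?_ (hζ _) ?_
        · rw [hζ0, H1.rep_add hT _ _ _ (left_mem_Icc.mpr hT.le), hζ0, hζ0]
        · filter_upwards [hζ u, hζ v, H1.der_add (ζ u) (ζ v), ae_restrict_mem measurableSet_Ioo]
            with t h1 h2 h3 ht
          rw [h3, h1, h2, H1.rep_add hT _ _ _ (Ioo_subset_Icc_self ht), map_add]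
      map_smul' := fun c v => by
        refine huniq _ _ ?_ (hζ _) ?_
        · rw [hζ0, RingHom.id_apply, H1.rep_smul hT _ _ _ (left_mem_Icc.mpr hT.le), hζ0]
        · rw [RingHom.id_apply]
          filter_upwards [hζ v, H1.der_smul c (ζ v), ae_restrict_mem measurableSet_Ioo]
            with t h1 h3 ht
          rw [h3, h1, H1.rep_smul hT _ _ _ (Ioo_subset_Icc_self ht), map_smul] }
  exact ⟨LinearMap.toContinuousLinearMap Z, fun v => ⟨hζ0 v, hζ v⟩⟩

theorem IsVariation.bound (hT : 0 < T) {A : ℝ → Vec n →L[ℝ] Vec n} {Z : Vec n →L[ℝ] H1 0 T n}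
    (hZ : IsVariation T A Z) {L : ℝ} (hL0 : 0 ≤ L) (hL : ∀ t ∈ Icc 0 T, ‖A t‖ ≤ L) (v : Vec n) :
    ∀ t ∈ Icc 0 T, ‖(Z v).rep t‖ ≤ H1.gronwallConst T L * ‖v‖ := by
  have h := (H1.gronwall_left hT (y := Z v) (L := L) (η := ‖v‖) hL0 (by rw [(hZ v).1]) (by
    filter_upwards [(hZ v).2, ae_restrict_mem measurableSet_Ioo] with t h1 ht
    rw [h1]
    exact ((A t).le_of_opNorm_le (hL t (Ioo_subset_Icc_self ht)) _).trans
      (le_add_of_nonneg_right (norm_nonneg _)))).1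
  simpa using h

/-- The difference of the two solutions solves the equation with coefficient `A` and forcing `(A -
B) Z' v`. Grönwall's constant enters twice: once to bound `Z' v`, once for the difference. -/
theorem IsVariation.norm_sub_le (hT : 0 < T) {A B : ℝ → Vec n →L[ℝ] Vec n}
    {Z Z' : Vec n →L[ℝ] H1 0 T n} (hZ : IsVariation T A Z) (hZ' : IsVariation T B Z') {L η : ℝ}
    (hL0 : 0 ≤ L) (hη : 0 ≤ η) (hA : ∀ t ∈ Icc 0 T, ‖A t‖ ≤ L) (hB : ∀ t ∈ Icc 0 T, ‖B t‖ ≤ L)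
    (hAB : ∀ t ∈ Icc 0 T, ‖A t - B t‖ ≤ η) :
    ‖Z - Z'‖ ≤ H1.gronwallConst T L * (H1.gronwallConst T L * η) := by
  have hc := H1.gronwallConst_nonneg hT.le hL0
  refine ContinuousLinearMap.opNorm_le_bound _ (by positivity) fun v => ?_
  have h := (H1.gronwall_left hT (y := (Z - Z') v) (L := L)
    (η := η * (H1.gronwallConst T L * ‖v‖)) hL0 (by
      rw [sub_apply, H1.rep_sub hT _ _ _ (left_mem_Icc.mpr hT.le), (hZ v).1,
        (hZ' v).1, sub_self, norm_zero]
      positivity) (by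
    filter_upwards [(hZ v).2, (hZ' v).2, H1.der_sub (Z v) (Z' v),
      ae_restrict_mem measurableSet_Ioo] with t h1 h2 h3 ht
    have ht' := Ioo_subset_Icc_self ht
    rw [sub_apply, h3, h1, h2, H1.rep_sub hT _ _ _ ht']
    have e : A t ((Z v).rep t) - B t ((Z' v).rep t)
        = A t ((Z v).rep t - (Z' v).rep t) + (A t - B t) ((Z' v).rep t) := by
      simp
    rw [e]
    refine (norm_add_le _ _).trans (add_le_add ((A t).le_of_opNorm_le (hA t ht') _) ?_)
    exact ((A t - B t).le_of_opNorm_le (hAB t ht') _).trans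
      (mul_le_mul_of_nonneg_left (hZ'.bound hT hL0 hB v t ht') hη))).2
  rw [sub_zero] at h
  refine h.trans_eq ?_
  ring

/-- `y` is a trajectory of the field `h` that stays in `K`. -/
def IsTrajectory (T : ℝ) (K : Set (Vec n)) (h : ℝ → Vec n → Vec n) (y : H1 0 T n) : Prop :=
  (∀ t ∈ Icc 0 T, y.rep t ∈ K) ∧ ∀ᵐ t ∂(timeMeasure 0 T), y.der t = h t (y.rep t)

/-- Only `h` has to be Lipschitz: one compares `h` at the two states, and `h` with `h'` at the same
state `y'(t)`. -/
theorem IsTrajectory.bounds_sub (hT : 0 < T) {K : Set (Vec n)} {h h' : ℝ → Vec n → Vec n}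
    {y y' : H1 0 T n} (hy : IsTrajectory T K h y) (hy' : IsTrajectory T K h' y') {L η : ℝ}
    (hL0 : 0 ≤ L) (hL : ∀ t ∈ Icc 0 T, ∀ x ∈ K, ∀ y ∈ K, ‖h t x - h t y‖ ≤ L * ‖x - y‖)
    (hη : ∀ t ∈ Icc 0 T, ∀ x ∈ K, ‖h t x - h' t x‖ ≤ η) (h0 : ‖y.rep 0 - y'.rep 0‖ ≤ η) :
    (∀ t ∈ Icc 0 T, ‖y.rep t - y'.rep t‖ ≤ H1.gronwallConst T L * η) ∧
      ‖y - y'‖ ≤ H1.gronwallConst T L * η := by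
  have key := H1.gronwall_left hT (y := y - y') (L := L) (η := η) hL0 (by
      rwa [H1.rep_sub hT _ _ _ (left_mem_Icc.mpr hT.le)]) (by
    filter_upwards [hy.2, hy'.2, H1.der_sub y y', ae_restrict_mem measurableSet_Ioo]
      with t h1 h2 h3 ht
    have ht' := Ioo_subset_Icc_self ht
    rw [h3, h1, h2, H1.rep_sub hT _ _ _ ht']
    have e : h t (y.rep t) - h' t (y'.rep t)
        = (h t (y.rep t) - h t (y'.rep t)) + (h t (y'.rep t) - h' t (y'.rep t)) := by abel
    rw [e]
    exact (norm_add_le _ _).trans (add_le_add (hL t ht' _ (hy.1 t ht') _ (hy'.1 t ht'))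
      (hη t ht' _ (hy'.1 t ht'))))
  rw [sub_zero] at key
  refine ⟨fun t ht => ?_, key.2⟩
  have := key.1 t ht
  rwa [H1.rep_sub hT _ _ _ ht] at this

variable {K : Set (Vec n)} {h : ℝ → Vec n → Vec n}

theorem IsC1Field.continuousOn_fderiv_rep (hT : 0 < T) (hh : IsC1Field T K h) {y : H1 0 T n}
    (hy : ∀ t ∈ Icc 0 T, y.rep t ∈ K) :
    ContinuousOn (fun t => fderiv ℝ (h t) (y.rep t)) (Icc 0 T) :=
  hh.cont_fderiv.comp (f := fun t => (t, y.rep t))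
    (continuousOn_id.prodMk (y.continuousOn_rep hT)) fun t ht => ⟨ht, hy t ht⟩

variable {S : Set (Vec n)} {Y : Vec n → H1 0 T n} {Z : Vec n → Vec n →L[ℝ] H1 0 T n}

/-- Differentiability of the flow with respect to the initial value. -/
theorem hasFDerivWithinAt_flow (hT : 0 < T) (hK : IsCompact K) (hcv : Convex ℝ K)
    (hh : IsC1Field T K h) (hY : ∀ x ∈ S, (Y x).rep 0 = x ∧ IsTrajectory T K h (Y x)) {x : Vec n}
    (hx : x ∈ S) {Zx : Vec n →L[ℝ] H1 0 T n}
    (hZ : IsVariation T (fun t => fderiv ℝ (h t) ((Y x).rep t)) Zx) :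
    HasFDerivWithinAt Y Zx S x := by
  obtain ⟨L, hL0, hLd, hL⟩ := hh.exists_lipschitz hK hcv
  set C := H1.gronwallConst T L with hC
  have hC0 : 0 ≤ C := H1.gronwallConst_nonneg hT.le hL0
  have hlip : ∀ x' ∈ S, ∀ t ∈ Icc 0 T, ‖(Y x').rep t - (Y x).rep t‖ ≤ C * ‖x' - x‖ :=
    fun x' hx' => ((hY x' hx').2.bounds_sub hT (hY x hx).2 hL0 hL (η := ‖x' - x‖)
      (fun t _ z _ => by simp) (by rw [(hY x' hx').1, (hY x hx).1])).1
  rw [hasFDerivWithinAt_iff_isLittleO, Asymptotics.isLittleO_iff]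
  intro c hc
  -- One factor `C` comes from the Lipschitz dependence of `Y` on the initial value, the other from
  -- Grönwall's inequality for the remainder; adding 1 keeps the denominators positive.
  set η : ℝ := c / ((C + 1) * (C + 1)) with hη
  have hη0 : 0 < η := by positivity
  obtain ⟨δ, hδ, hmod⟩ := hh.exists_modulus hK hcv hη0
  have hball : Metric.ball x (δ / (C + 1)) ∈ 𝓝[S] x :=
    mem_nhdsWithin_of_mem_nhds (Metric.ball_mem_nhds x (by positivity))
  filter_upwards [hball, self_mem_nhdsWithin] with x' hb hx'
  rw [Metric.mem_ball, dist_eq_norm, lt_div_iff₀ (by positivity)] at hb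
  have key := (H1.gronwall_left hT (y := Y x' - Y x - Zx (x' - x)) (L := L)
    (η := η * (C * ‖x' - x‖)) hL0 (by
      have h0 := left_mem_Icc.mpr hT.le
      rw [H1.rep_sub hT _ _ _ h0, H1.rep_sub hT _ _ _ h0, (hY x' hx').1, (hY x hx).1, (hZ _).1,
        sub_self, norm_zero]
      positivity) (by
    filter_upwards [(hY x' hx').2.2, (hY x hx).2.2, (hZ (x' - x)).2, H1.der_sub (Y x') (Y x),
      H1.der_sub (Y x' - Y x) (Zx (x' - x)), ae_restrict_mem measurableSet_Ioo]
      with t h1 h2 h3 h4 h5 ht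
    have ht' := Ioo_subset_Icc_self ht
    rw [h5, h4, h1, h2, h3, H1.rep_sub hT _ _ _ ht', H1.rep_sub hT _ _ _ ht']
    have hd := hlip x' hx' t ht'
    have hd' : ‖(Y x').rep t - (Y x).rep t‖ < δ := by
      refine hd.trans_lt (lt_of_le_of_lt ?_ hb)
      nlinarith [norm_nonneg (x' - x)]
    have hm := (hmod t ht' _ ((hY x hx).2.1 t ht') _ ((hY x' hx').2.1 t ht') hd').2
    -- The remainder `Y x' - Y x - Zx (x' - x)` solves the linearized equation, driven by the first
    -- order Taylor remainder of `h`.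
    have e : h t ((Y x').rep t) - h t ((Y x).rep t)
          - fderiv ℝ (h t) ((Y x).rep t) ((Zx (x' - x)).rep t)
        = fderiv ℝ (h t) ((Y x).rep t) ((Y x').rep t - (Y x).rep t - (Zx (x' - x)).rep t)
          + (h t ((Y x').rep t) - h t ((Y x).rep t)
            - fderiv ℝ (h t) ((Y x).rep t) ((Y x').rep t - (Y x).rep t)) := by
      simp only [map_sub]
      abel
    rw [e]
    refine (norm_add_le _ _).trans (add_le_add ?_ ?_)
    · exact (fderiv ℝ (h t) ((Y x).rep t)).le_of_opNorm_le (hLd t ht' _ ((hY x hx).2.1 t ht')) _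
    · exact hm.trans (mul_le_mul_of_nonneg_left hd hη0.le))).2
  rw [sub_zero] at key
  refine key.trans ?_
  have e2 : H1.gronwallConst T L * (η * (C * ‖x' - x‖)) = (C * C * η) * ‖x' - x‖ := by
    rw [← hC]
    ring
  rw [e2]
  refine mul_le_mul_of_nonneg_right ?_ (norm_nonneg _)
  have e3 : c = (C + 1) * (C + 1) * η := by
    rw [hη]
    field_simp
  rw [e3]
  refine mul_le_mul_of_nonneg_right ?_ hη0.le
  nlinarith

/-- Neighbouring initial values give uniformly close trajectories, hence uniformly close
coefficients of the variational equation, hence close solution operators. -/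
theorem continuousOn_flow (hT : 0 < T) (hK : IsCompact K) (hcv : Convex ℝ K)
    (hh : IsC1Field T K h) (hY : ∀ x ∈ S, (Y x).rep 0 = x ∧ IsTrajectory T K h (Y x))
    (hZ : ∀ x ∈ S, IsVariation T (fun t => fderiv ℝ (h t) ((Y x).rep t)) (Z x)) :
    ContinuousOn Z S := by
  obtain ⟨L, hL0, hLd, hL⟩ := hh.exists_lipschitz hK hcv
  set C := H1.gronwallConst T L with hC
  have hC0 : 0 ≤ C := H1.gronwallConst_nonneg hT.le hL0
  intro x hx
  refine (Metric.tendsto_nhds (f := 𝓝[S] x) (u := Z) (a := Z x)).mpr ?_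
  intro c hc
  set η : ℝ := c / ((C + 1) * (C + 1)) with hη
  have hη0 : 0 < η := by positivity
  obtain ⟨δ, hδ, hmod⟩ := hh.exists_modulus hK hcv hη0
  have hball : Metric.ball x (δ / (C + 1)) ∈ 𝓝[S] x :=
    mem_nhdsWithin_of_mem_nhds (Metric.ball_mem_nhds x (by positivity))
  filter_upwards [hball, self_mem_nhdsWithin] with x' hb hx'
  rw [Metric.mem_ball, dist_eq_norm, lt_div_iff₀ (by positivity)] at hb
  refine (dist_eq_norm (Z x') (Z x)).trans_lt ?_
  refine ((hZ x' hx').norm_sub_le hT (hZ x hx) hL0 hη0.le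
    (fun t ht => hLd t ht _ ((hY x' hx').2.1 t ht)) (fun t ht => hLd t ht _ ((hY x hx).2.1 t ht))
    (fun t ht => ?_)).trans_lt ?_
  · refine (hmod t ht _ ((hY x hx).2.1 t ht) _ ((hY x' hx').2.1 t ht) ?_).1
    refine (((hY x' hx').2.bounds_sub hT (hY x hx).2 hL0 hL (η := ‖x' - x‖)
      (fun t _ z _ => by simp) (by rw [(hY x' hx').1, (hY x hx).1])).1 t ht).trans_lt
        (lt_of_le_of_lt ?_ hb)
    rw [← hC]
    nlinarith [norm_nonneg (x' - x)]
  · have e3 : c = (C + 1) * (C + 1) * η := by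
      rw [hη]
      field_simp
    rw [e3, ← hC]
    nlinarith

theorem contDiffOn_flow (hT : 0 < T) (hK : IsCompact K) (hcv : Convex ℝ K)
    (hh : IsC1Field T K h) (hY : ∀ x ∈ S, (Y x).rep 0 = x ∧ IsTrajectory T K h (Y x)) :
    ContDiffOn ℝ 1 Y S := by
  have hex : ∀ x, ∃ Zx, x ∈ S → IsVariation T (fun t => fderiv ℝ (h t) ((Y x).rep t)) Zx := by
    intro x
    by_cases hx : x ∈ S
    · obtain ⟨Zx, hZx⟩ := exists_isVariation hT (hh.continuousOn_fderiv_rep hT (hY x hx).2.1)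
      exact ⟨Zx, fun _ => hZx⟩
    · exact ⟨0, fun h => absurd h hx⟩
  choose Z hZ using hex
  have hcz := continuousOn_flow hT hK hcv hh hY hZ
  -- The set `S` is arbitrary, so derivatives within it need not be unique; one continuous choice
  -- `Z` of them is enough.
  rw [show (1 : WithTop ℕ∞) = 0 + 1 by norm_num, contDiffOn_succ_iff_hasFDerivWithinAt (by simp)]
  intro x hx
  refine ⟨S, by rw [insert_eq_of_mem hx]; exact self_mem_nhdsWithin, by simp, Z,
    fun x' hx' => hasFDerivWithinAt_flow hT hK hcv hh hY hx' (hZ x' hx'), ?_⟩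
  rwa [contDiffOn_zero]

/-- The flows of two fields that are close in `C¹` are close in `C¹`. -/
theorem flow_stability (hT : 0 < T) (hK : IsCompact K) (hcv : Convex ℝ K)
    (hh : IsC1Field T K h) {η : ℝ} (hη : 0 < η) :
    ∃ δ : ℝ, 0 < δ ∧ ∀ h' : ℝ → Vec n → Vec n,
      (∀ t ∈ Icc 0 T, ∀ x ∈ K, ‖h t x - h' t x‖ ≤ δ) →
      (∀ t ∈ Icc 0 T, ∀ x ∈ K, ‖fderiv ℝ (h t) x - fderiv ℝ (h' t) x‖ ≤ δ) →
      ∀ y y' : H1 0 T n, IsTrajectory T K h y → IsTrajectory T K h' y' → y.rep 0 = y'.rep 0 →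
      (∀ t ∈ Icc 0 T, ‖y.rep t - y'.rep t‖ ≤ η) ∧ ‖y - y'‖ ≤ η ∧
      ∀ Z Z', IsVariation T (fun t => fderiv ℝ (h t) (y.rep t)) Z →
        IsVariation T (fun t => fderiv ℝ (h' t) (y'.rep t)) Z' → ‖Z - Z'‖ ≤ η := by
  obtain ⟨L, hL0, hLd, hL⟩ := hh.exists_lipschitz hK hcv
  set C := H1.gronwallConst T L with hC
  have hC0 : 0 ≤ C := H1.gronwallConst_nonneg hT.le hL0
  set D := H1.gronwallConst T (L + 1) with hD
  have hD0 : 0 ≤ D := H1.gronwallConst_nonneg hT.le (by positivity)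
  -- The coefficients of the two variational equations differ by at most `2 μ`: one `μ` from the
  -- distance of the trajectories, one from that of the fields. The constant `D` of
  -- `IsVariation.norm_sub_le` enters squared.
  set μ : ℝ := η / (2 * ((D + 1) * (D + 1))) with hμ
  have hμ0 : 0 < μ := by positivity
  obtain ⟨δ, hδ, hmod⟩ := hh.exists_modulus hK hcv hμ0
  -- The four entries: 1 bounds the derivative of `h'` by `L + 1`; `μ` controls the distance of the
  -- derivatives; the third keeps the trajectories within the modulus `δ`; the last makes them
  -- `η`-close.
  set κ : ℝ := min (min 1 μ) (min (δ / (2 * (C + 1))) (η / (C + 1))) with hκ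
  have hκ0 : 0 < κ := by positivity
  have hκ1 : κ ≤ 1 := (min_le_left _ _).trans (min_le_left _ _)
  have hκμ : κ ≤ μ := (min_le_left _ _).trans (min_le_right _ _)
  have hκδ : C * κ < δ := by
    have h1 : κ ≤ δ / (2 * (C + 1)) := (min_le_right _ _).trans (min_le_left _ _)
    rw [le_div_iff₀ (by positivity)] at h1
    nlinarith
  have hκη : C * κ ≤ η := by
    have h1 : κ ≤ η / (C + 1) := (min_le_right _ _).trans (min_le_right _ _)
    rw [le_div_iff₀ (by positivity)] at h1
    nlinarith
  refine ⟨κ, hκ0, fun h' h1 h2 y y' hy hy' h0 => ?_⟩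
  have hb := hy.bounds_sub hT hy' hL0 hL h1 (by rw [h0, sub_self, norm_zero]; exact hκ0.le)
  refine ⟨fun t ht => (hb.1 t ht).trans hκη, hb.2.trans hκη, fun Z Z' hZ hZ' => ?_⟩
  refine (hZ.norm_sub_le hT hZ' (L := L + 1) (η := 2 * μ) (by positivity) (by positivity)
    (fun t ht => (hLd t ht _ (hy.1 t ht)).trans (by linarith)) (fun t ht => ?_)
    (fun t ht => ?_)).trans ?_
  · have h3 := h2 t ht _ (hy'.1 t ht)
    have h4 := hLd t ht _ (hy'.1 t ht)
    have h5 := norm_sub_norm_le (fderiv ℝ (h' t) (y'.rep t)) (fderiv ℝ (h t) (y'.rep t))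
    rw [norm_sub_rev] at h5
    linarith
  · have h3 := h2 t ht _ (hy'.1 t ht)
    have h4 := (hmod t ht _ (hy'.1 t ht) _ (hy.1 t ht) ((hb.1 t ht).trans_lt hκδ)).1
    have e : fderiv ℝ (h t) (y.rep t) - fderiv ℝ (h' t) (y'.rep t)
        = (fderiv ℝ (h t) (y.rep t) - fderiv ℝ (h t) (y'.rep t))
          + (fderiv ℝ (h t) (y'.rep t) - fderiv ℝ (h' t) (y'.rep t)) := by abel
    rw [e]
    refine (norm_add_le _ _).trans ?_
    linarith
  · have e3 : η = (D + 1) * (D + 1) * (2 * μ) := by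
      rw [hμ]
      field_simp
    rw [e3, ← hD]
    nlinarith

end Flow

/-! ### Adjoints and gradients as continuous linear images -/

section Duality

variable {E F : Type*} [NormedAddCommGroup E] [InnerProductSpace ℝ E] [CompleteSpace E]
  [NormedAddCommGroup F] [InnerProductSpace ℝ F] [CompleteSpace F]

/-- The adjoint as a continuous linear map. -/
def adjointCLM (E F : Type*) [NormedAddCommGroup E] [InnerProductSpace ℝ E] [CompleteSpace E]
    [NormedAddCommGroup F] [InnerProductSpace ℝ F] [CompleteSpace F] :
    (E →L[ℝ] F) →L[ℝ] (F →L[ℝ] E) :=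
  LinearMap.mkContinuous
    { toFun := fun A => A.adjoint
      map_add' := fun A B => map_add _ A B
      map_smul' := fun c A => by simp } 1 (fun A => by simp)

@[simp]
theorem adjointCLM_apply (A : E →L[ℝ] F) : adjointCLM E F A = A.adjoint := rfl

/-- The Riesz isomorphism as a continuous linear map. -/
def rieszCLM (E : Type*) [NormedAddCommGroup E] [InnerProductSpace ℝ E] [CompleteSpace E] :
    (E →L[ℝ] ℝ) →L[ℝ] E :=
  LinearMap.mkContinuous
    { toFun := fun A => (InnerProductSpace.toDual ℝ E).symm A
      map_add' := fun A B => map_add _ A B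
      map_smul' := fun c A => by simp } 1 (fun A => by simp)

theorem rieszCLM_fderiv (φ : E → ℝ) (x : E) : rieszCLM E (fderiv ℝ φ x) = gradient φ x := rfl

theorem norm_rieszCLM (A : E →L[ℝ] ℝ) : ‖rieszCLM E A‖ = ‖A‖ :=
  (InnerProductSpace.toDual ℝ E).symm.norm_map A

theorem norm_rieszCLM_le : ‖rieszCLM E‖ ≤ 1 :=
  ContinuousLinearMap.opNorm_le_bound _ zero_le_one fun A => by rw [norm_rieszCLM, one_mul]

theorem ContDiffOn.gradient_slice {T : ℝ} (hT : 0 < T) {U : Set E} (hU : IsOpen U)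
    {v : ℝ → E → ℝ} {k : WithTop ℕ∞}
    (hv : ContDiffOn ℝ (k + 1) (fun z : ℝ × E => v z.1 z.2) (Icc 0 T ×ˢ U)) :
    ContDiffOn ℝ k (fun z : ℝ × E => gradient (v z.1) z.2) (Icc 0 T ×ˢ U) :=
  (rieszCLM E).contDiff.comp_contDiffOn (hv.fderiv_slice hT hU)

end Duality

/-! ### The closed loop field as a function of the gradient -/

namespace ControlProblem

variable {n m : ℕ} (P : ControlProblem n m)

/-- The closed loop vector field. -/
def closedLoop (G : ℝ → Vec n → Vec n) (t : ℝ) (x : Vec n) : Vec n :=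
  P.f t x + P.g t x (P.feedback G t x)

/-- The matrix `-(1/β) g gᵀ`. -/
def gram (t : ℝ) (x : Vec n) : Vec n →L[ℝ] Vec n :=
  -((1 / P.β) • (P.g t x).comp (adjointCLM _ _ (P.g t x)))

variable {P}

/-- The closed loop field is affine in the gradient field, with linear part `-(1/β) g gᵀ`. Closeness
of gradients in C¹ therefore passes to closed loop fields, with constants depending on the dynamics
alone. -/
theorem closedLoop_sub (G G' : ℝ → Vec n → Vec n) (t : ℝ) (x : Vec n) :
    P.closedLoop G t x - P.closedLoop G' t x = P.gram t x (G t x - G' t x) := by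
  simp only [closedLoop, feedback, gram, add_sub_add_left_eq_sub, map_neg, map_smul, map_sub,
    neg_apply, smul_apply, ContinuousLinearMap.comp_apply, adjointCLM_apply]

theorem SmoothDynamics.contDiffOn_feedback (hP : P.SmoothDynamics) {U : Set (Vec n)}
    {k : WithTop ℕ∞} (hk : k ≤ 2) {G : ℝ → Vec n → Vec n}
    (hG : ContDiffOn ℝ k (fun z : ℝ × Vec n => G z.1 z.2) (Icc 0 P.T ×ˢ U)) :
    ContDiffOn ℝ k (fun z : ℝ × Vec n => P.feedback G z.1 z.2) (Icc 0 P.T ×ˢ U) := by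
  have hg : ContDiffOn ℝ k (fun z : ℝ × Vec n => P.g z.1 z.2) (Icc 0 P.T ×ˢ U) :=
    (hP.g_smooth.of_le hk).mono (prod_mono_right (subset_univ _))
  have h1 := (adjointCLM (Vec m) (Vec n)).contDiff.comp_contDiffOn hg
  exact ((h1.clm_apply hG).const_smul (1 / P.β)).neg

theorem SmoothDynamics.contDiffOn_closedLoop (hP : P.SmoothDynamics) {U : Set (Vec n)}
    {k : WithTop ℕ∞} (hk : k ≤ 2) {G : ℝ → Vec n → Vec n}
    (hG : ContDiffOn ℝ k (fun z : ℝ × Vec n => G z.1 z.2) (Icc 0 P.T ×ˢ U)) :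
    ContDiffOn ℝ k (fun z : ℝ × Vec n => P.closedLoop G z.1 z.2) (Icc 0 P.T ×ˢ U) := by
  have hg : ContDiffOn ℝ k (fun z : ℝ × Vec n => P.g z.1 z.2) (Icc 0 P.T ×ˢ U) :=
    (hP.g_smooth.of_le hk).mono (prod_mono_right (subset_univ _))
  have hf : ContDiffOn ℝ k (fun z : ℝ × Vec n => P.f z.1 z.2) (Icc 0 P.T ×ˢ U) :=
    (hP.f_smooth.of_le hk).mono (prod_mono_right (subset_univ _))
  exact hf.add (hg.clm_apply (hP.contDiffOn_feedback hk hG))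

theorem SmoothDynamics.contDiffOn_gram (hP : P.SmoothDynamics) :
    ContDiffOn ℝ 2 (fun z : ℝ × Vec n => P.gram z.1 z.2) (Icc 0 P.T ×ˢ univ) := by
  have h1 := (adjointCLM (Vec m) (Vec n)).contDiff.comp_contDiffOn hP.g_smooth
  exact ((hP.g_smooth.clm_comp h1).const_smul (1 / P.β)).neg

/-- By `closedLoop_sub` and the product rule it suffices to bound `gram`, its state derivative and
`g` on the compact set. The constant precedes `G` and `G'`, so it serves all `ε` at once. -/
theorem SmoothDynamics.closedLoop_close (hP : P.SmoothDynamics) {K U : Set (Vec n)}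
    (hK : IsCompact K) (hU : IsOpen U) (hKU : K ⊆ U) :
    ∃ C : ℝ, 0 ≤ C ∧ ∀ G G' : ℝ → Vec n → Vec n,
      ContDiffOn ℝ 1 (fun z : ℝ × Vec n => G z.1 z.2) (Icc 0 P.T ×ˢ U) →
      ContDiffOn ℝ 1 (fun z : ℝ × Vec n => G' z.1 z.2) (Icc 0 P.T ×ˢ U) → ∀ δ : ℝ, 0 ≤ δ →
      (∀ t ∈ Icc 0 P.T, ∀ x ∈ K, ‖G t x - G' t x‖ ≤ δ) →
      (∀ t ∈ Icc 0 P.T, ∀ x ∈ K, ‖fderiv ℝ (G t) x - fderiv ℝ (G' t) x‖ ≤ δ) →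
      ∀ t ∈ Icc 0 P.T, ∀ x ∈ K,
        ‖P.closedLoop G t x - P.closedLoop G' t x‖ ≤ C * δ ∧
        ‖fderiv ℝ (P.closedLoop G t) x - fderiv ℝ (P.closedLoop G' t) x‖ ≤ C * δ ∧
        ‖P.feedback G t x - P.feedback G' t x‖ ≤ C * δ := by
  have hT := P.T_pos
  have hgram : IsC1Field P.T K P.gram := (hP.contDiffOn_gram.of_le (by norm_num)).isC1Field hT
    isOpen_univ (subset_univ _)
  have hg : IsC1Field P.T K P.g := (hP.g_smooth.of_le (by norm_num)).isC1Field hT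
    isOpen_univ (subset_univ _)
  obtain ⟨a, ha⟩ := (isCompact_Icc.prod hK).exists_bound_of_continuousOn hgram.cont
  obtain ⟨b, hb⟩ := (isCompact_Icc.prod hK).exists_bound_of_continuousOn hgram.cont_fderiv
  obtain ⟨d, hd⟩ := (isCompact_Icc.prod hK).exists_bound_of_continuousOn hg.cont
  have hβ := P.β_pos
  refine ⟨max a 0 + max b 0 + (1 / P.β) * max d 0, by positivity, ?_⟩
  intro G G' hG hG' δ hδ h1 h2 t ht x hx
  have ha' : ‖P.gram t x‖ ≤ max a 0 := (ha (t, x) ⟨ht, hx⟩).trans (le_max_left _ _)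
  have hb' : ‖fderiv ℝ (P.gram t) x‖ ≤ max b 0 := (hb (t, x) ⟨ht, hx⟩).trans (le_max_left _ _)
  have hd' : ‖P.g t x‖ ≤ max d 0 := (hd (t, x) ⟨ht, hx⟩).trans (le_max_left _ _)
  have ea : 0 ≤ max a 0 * δ := by positivity
  have eb : 0 ≤ max b 0 * δ := by positivity
  have ed : 0 ≤ (1 / P.β) * max d 0 * δ := by positivity
  refine ⟨?_, ?_, ?_⟩
  · rw [closedLoop_sub]
    refine ((P.gram t x).le_of_opNorm_le ha' _).trans ?_
    have := mul_le_mul_of_nonneg_left (h1 t ht x hx) (le_max_right a 0)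
    linarith
  · have dG := (hG.hasFDerivAt_slice hU le_rfl ht (hKU hx)).differentiableAt
    have dG' := (hG'.hasFDerivAt_slice hU le_rfl ht (hKU hx)).differentiableAt
    have dh := ((hP.contDiffOn_closedLoop (by norm_num) hG).hasFDerivAt_slice hU le_rfl ht
      (hKU hx)).differentiableAt
    have dh' := ((hP.contDiffOn_closedLoop (by norm_num) hG').hasFDerivAt_slice hU le_rfl ht
      (hKU hx)).differentiableAt
    have e1 : fderiv ℝ (P.closedLoop G t) x - fderiv ℝ (P.closedLoop G' t) x
        = (P.gram t x).comp (fderiv ℝ (G t) x - fderiv ℝ (G' t) x)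
          + (fderiv ℝ (P.gram t) x).flip (G t x - G' t x) := by
      rw [← fderiv_fun_sub dh dh', ← fderiv_fun_sub dG dG']
      simp only [closedLoop_sub]
      exact ((hgram.diff t ht x hx).hasFDerivAt.clm_apply (dG.sub dG').hasFDerivAt).fderiv
    rw [e1]
    refine (norm_add_le _ _).trans ?_
    have n1 : ‖(P.gram t x).comp (fderiv ℝ (G t) x - fderiv ℝ (G' t) x)‖ ≤ max a 0 * δ :=
      (ContinuousLinearMap.opNorm_comp_le _ _).trans
        (mul_le_mul ha' (h2 t ht x hx) (norm_nonneg _) (le_max_right _ _))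
    have n2 : ‖(fderiv ℝ (P.gram t) x).flip (G t x - G' t x)‖ ≤ max b 0 * δ := by
      refine ((fderiv ℝ (P.gram t) x).flip.le_opNorm _).trans ?_
      rw [ContinuousLinearMap.opNorm_flip]
      exact mul_le_mul hb' (h1 t ht x hx) (norm_nonneg _) (le_max_right _ _)
    linarith
  · have e2 : P.feedback G t x - P.feedback G' t x
        = -((1 / P.β) • (P.g t x).adjoint (G t x - G' t x)) := by
      simp only [feedback, map_sub, smul_sub]
      abel
    rw [e2, norm_neg, norm_smul, Real.norm_of_nonneg (by positivity)]
    have n3 : ‖(P.g t x).adjoint (G t x - G' t x)‖ ≤ max d 0 * δ := by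
      refine ((P.g t x).adjoint.le_opNorm _).trans ?_
      rw [LinearIsometryEquiv.norm_map]
      exact mul_le_mul hd' (h1 t ht x hx) (norm_nonneg _) (le_max_right _ _)
    have := mul_le_mul_of_nonneg_left n3 (by positivity : 0 ≤ 1 / P.β)
    nlinarith

theorem valueGrad_of_mem_interior {M t : ℝ} {x : Vec n} (hx : x ∈ interior (P.stateBall M)) :
    P.valueGrad M t x = gradient (P.value t) x := by
  rw [valueGrad, gradientWithin, gradient,
    fderivWithin_of_mem_nhds (mem_interior_iff_mem_nhds.mp hx)]

theorem SmoothValue.contDiffOn_valueGrad {M : ℝ} (hP : P.SmoothValue M) :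
    ContDiffOn ℝ 1 (fun z : ℝ × Vec n => P.valueGrad M z.1 z.2)
      (Icc 0 P.T ×ˢ interior (P.stateBall M)) := by
  have h1 : ContDiffOn ℝ (1 + 1) (fun z : ℝ × Vec n => P.value z.1 z.2)
      (Icc 0 P.T ×ˢ interior (P.stateBall M)) :=
    (hP.smooth.mono (prod_mono_right interior_subset)).of_le (by norm_num)
  exact (h1.gradient_slice P.T_pos isOpen_interior).congr fun z hz =>
    valueGrad_of_mem_interior hz.2

theorem SmoothValue.hasFDerivAt_value {M : ℝ} (hP : P.SmoothValue M) {t : ℝ} (ht : t ∈ Icc 0 P.T)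
    {x : Vec n} (hx : x ∈ interior (P.stateBall M)) :
    HasFDerivAt (P.value t) (fderiv ℝ (P.value t) x) x :=
  ((hP.smooth.mono (prod_mono_right interior_subset)).hasFDerivAt_slice isOpen_interior
    (by norm_num) ht hx).differentiableAt.hasFDerivAt

section Approximation

variable {Θ : Type*} [NormedAddCommGroup Θ] [NormedSpace ℝ Θ] {v : Θ → ℝ → Vec n → ℝ}

theorem contDiff_slice (hv : ContDiff ℝ 4 (fun z : Θ × ℝ × Vec n => v z.1 z.2.1 z.2.2)) (θ : Θ) :
    ContDiff ℝ 4 (fun z : ℝ × Vec n => v θ z.1 z.2) :=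
  hv.comp (contDiff_const.prodMk contDiff_id)

theorem contDiffOn_gradient (hv : ContDiff ℝ 4 (fun z : Θ × ℝ × Vec n => v z.1 z.2.1 z.2.2))
    (θ : Θ) {U : Set (Vec n)} (hU : IsOpen U) :
    ContDiffOn ℝ 2 (fun z : ℝ × Vec n => gradient (v θ z.1) z.2) (Icc 0 P.T ×ˢ U) :=
  ((contDiff_slice hv θ).contDiffOn.of_le (by norm_num) :
    ContDiffOn ℝ (2 + 1) _ _).gradient_slice P.T_pos hU

end Approximation

/-- Translates the assumption on derivatives within the closed ball into estimates for gradients and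
their derivatives. In the interior both kinds of derivative agree, and the Riesz map is an isometry,
so the constant `c` is unchanged. -/
theorem ValueApproximation.bounds {M ε₀ : ℝ} (hP : P.SmoothValue M) {R : ℝ → Type*}
    [∀ ε, NormedAddCommGroup (R ε)] [∀ ε, NormedSpace ℝ (R ε)] {V : ∀ ε, R ε → ℝ → Vec n → ℝ}
    {θ₀ : ∀ ε, R ε} (h : P.ValueApproximation M ε₀ V θ₀) :
    ∃ c : ℝ, 0 < c ∧ ∀ ε ∈ Ioc 0 ε₀, ∀ t ∈ Icc 0 P.T, ∀ x ∈ interior (P.stateBall M),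
      |V ε (θ₀ ε) t x - P.value t x| ≤ c * ε ∧
      ‖gradient (V ε (θ₀ ε) t) x - P.valueGrad M t x‖ ≤ c * ε ∧
      ‖fderiv ℝ (gradient (V ε (θ₀ ε) t)) x - fderiv ℝ (P.valueGrad M t) x‖ ≤ c * ε := by
  obtain ⟨c, hc, happ⟩ := h.approx
  refine ⟨c, hc, fun ε hε t ht x hx => ?_⟩
  have h0 := happ ε hε t ht x (interior_subset hx)
  set B := P.stateBall M with hB
  set Δ : Vec n → ℝ := fun z => V ε (θ₀ ε) t z - P.value t z with hΔ
  have hVd : ∀ z, DifferentiableAt ℝ (V ε (θ₀ ε) t) z := fun z =>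
    ((contDiff_slice (h.smooth ε hε) (θ₀ ε)).contDiffOn.hasFDerivAt_slice isOpen_univ
      (by norm_num) ht (mem_univ z)).differentiableAt
  have e1 : ∀ z ∈ interior B, fderivWithin ℝ Δ B z
      = fderiv ℝ (V ε (θ₀ ε) t) z - fderiv ℝ (P.value t) z := fun z hz => by
    rw [fderivWithin_of_mem_nhds (mem_interior_iff_mem_nhds.mp hz)]
    exact fderiv_fun_sub (hVd z) (hP.hasFDerivAt_value ht hz).differentiableAt
  have g1 : ∀ z ∈ interior B, rieszCLM _ (fderivWithin ℝ Δ B z)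
      = gradient (V ε (θ₀ ε) t) z - P.valueGrad M t z := fun z hz => by
    rw [e1 z hz, map_sub, rieszCLM_fderiv, rieszCLM_fderiv, valueGrad_of_mem_interior hz]
  have hU : interior B ∈ 𝓝 x := isOpen_interior.mem_nhds hx
  have dV : DifferentiableAt ℝ (gradient (V ε (θ₀ ε) t)) x :=
    ((contDiffOn_gradient (P := P) (h.smooth ε hε) (θ₀ ε) isOpen_univ).hasFDerivAt_slice
      (h := fun t => gradient (V ε (θ₀ ε) t)) isOpen_univ (by norm_num : (1 : WithTop ℕ∞) ≤ 2) ht (mem_univ x)).differentiableAt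
  have dG : DifferentiableAt ℝ (P.valueGrad M t) x :=
    (hP.contDiffOn_valueGrad.hasFDerivAt_slice isOpen_interior le_rfl ht hx).differentiableAt
  have dΔ : DifferentiableAt ℝ (fderivWithin ℝ Δ B) x := by
    have h1 : DifferentiableAt ℝ (fderiv ℝ (V ε (θ₀ ε) t)) x :=
      ((((contDiff_slice (h.smooth ε hε) (θ₀ ε)).contDiffOn.of_le (by norm_num) :
        ContDiffOn ℝ (1 + 1) _ _).fderiv_slice P.T_pos isOpen_univ).hasFDerivAt_slice
        (h := fun t => fderiv ℝ (V ε (θ₀ ε) t)) isOpen_univ le_rfl ht (mem_univ x)).differentiableAt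
    have h2 : DifferentiableAt ℝ (fderiv ℝ (P.value t)) x :=
      ((((hP.smooth.mono (prod_mono_right interior_subset)).of_le (by norm_num) :
        ContDiffOn ℝ (1 + 1) _ _).fderiv_slice P.T_pos isOpen_interior).hasFDerivAt_slice
        (h := fun t => fderiv ℝ (P.value t)) isOpen_interior le_rfl ht hx).differentiableAt
    refine (h1.sub h2).congr_of_eventuallyEq ?_
    filter_upwards [hU] with z hz
    exact e1 z hz
  have n1 := abs_nonneg (Δ x)
  have n2 := norm_nonneg (fderivWithin ℝ Δ B x)
  have n3 := norm_nonneg (fderivWithin ℝ (fderivWithin ℝ Δ B) B x)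
  refine ⟨?_, ?_, ?_⟩
  · change |Δ x| ≤ _
    linarith
  · rw [← g1 x hx, norm_rieszCLM]
    linarith
  · have e2 : fderiv ℝ (gradient (V ε (θ₀ ε) t)) x - fderiv ℝ (P.valueGrad M t) x
        = (rieszCLM _).comp (fderivWithin ℝ (fderivWithin ℝ Δ B) B x) := by
      rw [fderivWithin_of_mem_nhds (mem_interior_iff_mem_nhds.mp hx), ← fderiv_fun_sub dV dG]
      rw [← ((rieszCLM (Vec n)).hasFDerivAt.comp x dΔ.hasFDerivAt).fderiv]
      apply Filter.EventuallyEq.fderiv_eq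
      filter_upwards [hU] with z hz
      exact (g1 z hz).symm
    rw [e2]
    refine (ContinuousLinearMap.opNorm_comp_le _ _).trans ?_
    have := mul_le_mul_of_nonneg_right (norm_rieszCLM_le (E := Vec n)) n3
    linarith

end ControlProblem

/-! ### The adjoint equation: solvability and stability -/

namespace ControlProblem

variable {n m : ℕ} (P : ControlProblem n m)

/-- The state derivative of `x ↦ f(t, x) + g(t, x) w`. -/
def jac (t : ℝ) (x : Vec n) (w : Vec m) : Vec n →L[ℝ] Vec n :=
  fderiv ℝ (P.f t) x + (fderiv ℝ (P.g t) x).flip w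

variable {P}

theorem SmoothDynamics.isC1Field_f (hP : P.SmoothDynamics) (K : Set (Vec n)) :
    IsC1Field P.T K P.f :=
  (hP.f_smooth.of_le (by norm_num)).isC1Field P.T_pos isOpen_univ (subset_univ _)

theorem SmoothDynamics.isC1Field_g (hP : P.SmoothDynamics) (K : Set (Vec n)) :
    IsC1Field P.T K P.g :=
  (hP.g_smooth.of_le (by norm_num)).isC1Field P.T_pos isOpen_univ (subset_univ _)

theorem SmoothDynamics.hasFDerivAt_jac (hP : P.SmoothDynamics) {t : ℝ} (ht : t ∈ Icc 0 P.T)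
    (x : Vec n) (w : Vec m) :
    HasFDerivAt (fun z => P.f t z + P.g t z w) (P.jac t x w) x := by
  have hf := ((hP.isC1Field_f univ).diff t ht x (mem_univ x)).hasFDerivAt
  have hg := ((hP.isC1Field_g univ).diff t ht x (mem_univ x)).hasFDerivAt
  have h := hf.add (hg.clm_apply (hasFDerivAt_const w x))
  simp only [ContinuousLinearMap.comp_zero, zero_add] at h
  exact h

/-- The two derivative terms combine into the adjoint of one Jacobian, of `x ↦ f(t, x) + g(t, x) u`,
and the equation is solved for `ṗ`, as the linear theory requires. -/
theorem SmoothDynamics.isAdjoint_iff (hP : P.SmoothDynamics) {y p : P.W} {u : ℝ → Vec m} :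
    P.IsAdjoint y u p ↔
      (∀ᵐ t ∂(timeMeasure 0 P.T), p.der t = -((P.jac t (y.rep t) (u t)).adjoint (p.rep t))
        - P.Q₁.adjoint (P.Q₁ (y.rep t - P.yd t))) ∧
      p.rep P.T = P.Q₂.adjoint (P.Q₂ (y.rep P.T - P.ydT)) := by
  refine and_congr_left fun _ => ?_
  have key : ∀ t ∈ Icc 0 P.T, (fderiv ℝ (P.f t) (y.rep t)).adjoint (p.rep t)
      + (fderiv ℝ (fun x => P.g t x (u t)) (y.rep t)).adjoint (p.rep t)
      = (P.jac t (y.rep t) (u t)).adjoint (p.rep t) := by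
    intro t ht
    have hg := ((hP.isC1Field_g univ).diff t ht (y.rep t) (mem_univ _)).hasFDerivAt
    have h1 : fderiv ℝ (fun x => P.g t x (u t)) (y.rep t)
        = (fderiv ℝ (P.g t) (y.rep t)).flip (u t) := by
      have := (hg.clm_apply (hasFDerivAt_const (u t) (y.rep t))).fderiv
      simpa using this
    rw [h1, jac, map_add]
    rfl
  constructor
  · intro h
    filter_upwards [h, ae_restrict_mem measurableSet_Ioo] with t h1 ht
    rw [key t (Ioo_subset_Icc_self ht)] at h1
    rw [← neg_neg (p.der t), h1]
    abel
  · intro h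
    filter_upwards [h, ae_restrict_mem measurableSet_Ioo] with t h1 ht
    rw [key t (Ioo_subset_Icc_self ht), h1]
    abel

/-- For controls bounded by `R`, the derivatives of `f` and `g` are bounded by compactness and
Lipschitz by assumption. A Lipschitz derivative makes the Taylor remainder quadratic, which is what
the first variation of the cost needs. -/
theorem SmoothDynamics.exists_jac_bounds (hP : P.SmoothDynamics) {K : Set (Vec n)}
    (hK : IsCompact K) (hcv : Convex ℝ K) {R : ℝ} (hR : 0 ≤ R) :
    ∃ L : ℝ, 0 ≤ L ∧ ∀ t ∈ Icc 0 P.T, ∀ x ∈ K, ∀ x' ∈ K, ∀ w w' : Vec m, ‖w‖ ≤ R → ‖w'‖ ≤ R →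
      ‖P.jac t x w‖ ≤ L ∧ ‖P.jac t x w - P.jac t x' w'‖ ≤ L * (‖x - x'‖ + ‖w - w'‖) ∧
      ‖(P.f t x + P.g t x w) - (P.f t x' + P.g t x' w)‖ ≤ L * ‖x - x'‖ ∧
      ‖(P.f t x' + P.g t x' w) - (P.f t x + P.g t x w) - P.jac t x w (x' - x)‖
        ≤ L * ‖x' - x‖ ^ 2 := by
  obtain ⟨a, ha0, ha, -⟩ := (hP.isC1Field_f K).exists_lipschitz hK hcv
  obtain ⟨b, hb0, hb, -⟩ := (hP.isC1Field_g K).exists_lipschitz hK hcv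
  obtain ⟨lf, hlf⟩ := hP.f_lipschitz K hK
  obtain ⟨lg, hlg⟩ := hP.g_lipschitz K hK
  have hlf0 : (0 : ℝ) ≤ lf := lf.2
  have hlg0 : (0 : ℝ) ≤ lg := lg.2
  set L : ℝ := a + b * R + lf + lg * R + b with hL
  have hbR : 0 ≤ b * R := by positivity
  have hgR : 0 ≤ lg * R := by positivity
  have hb1 : ∀ t ∈ Icc 0 P.T, ∀ x ∈ K, ∀ w : Vec m, ‖w‖ ≤ R → ‖P.jac t x w‖ ≤ L := by
    intro t ht x hx w hw
    refine (norm_add_le _ _).trans ?_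
    have h1 : ‖(fderiv ℝ (P.g t) x).flip w‖ ≤ b * R := by
      refine ((fderiv ℝ (P.g t) x).flip.le_opNorm _).trans ?_
      rw [ContinuousLinearMap.opNorm_flip]
      exact mul_le_mul (hb t ht x hx) hw (norm_nonneg _) hb0
    linarith [ha t ht x hx]
  have hb2 : ∀ t ∈ Icc 0 P.T, ∀ x ∈ K, ∀ x' ∈ K, ∀ w w' : Vec m, ‖w‖ ≤ R → ‖w'‖ ≤ R →
      ‖P.jac t x w - P.jac t x' w'‖ ≤ L * (‖x - x'‖ + ‖w - w'‖) := by
    intro t ht x hx x' hx' w w' hw hw'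
    have e : P.jac t x w - P.jac t x' w' = (fderiv ℝ (P.f t) x - fderiv ℝ (P.f t) x')
        + (fderiv ℝ (P.g t) x - fderiv ℝ (P.g t) x').flip w
        + (fderiv ℝ (P.g t) x').flip (w - w') := by
      ext1 v
      simp only [jac, add_apply, sub_apply, ContinuousLinearMap.flip_apply, map_sub]
      abel
    have n1 : ‖fderiv ℝ (P.f t) x - fderiv ℝ (P.f t) x'‖ ≤ lf * ‖x - x'‖ :=
      (hlf t ht).1.norm_sub_le hx hx'
    have n2 : ‖(fderiv ℝ (P.g t) x - fderiv ℝ (P.g t) x').flip w‖ ≤ lg * ‖x - x'‖ * R := by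
      refine ((fderiv ℝ (P.g t) x - fderiv ℝ (P.g t) x').flip.le_opNorm _).trans ?_
      rw [ContinuousLinearMap.opNorm_flip]
      exact mul_le_mul ((hlg t ht).1.norm_sub_le hx hx') hw (norm_nonneg _) (by positivity)
    have n3 : ‖(fderiv ℝ (P.g t) x').flip (w - w')‖ ≤ b * ‖w - w'‖ := by
      refine ((fderiv ℝ (P.g t) x').flip.le_opNorm _).trans ?_
      rw [ContinuousLinearMap.opNorm_flip]
      exact mul_le_mul_of_nonneg_right (hb t ht x' hx') (norm_nonneg _)
    rw [e]
    refine (norm_add₃_le).trans ?_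
    have p1 : lf * ‖x - x'‖ + lg * ‖x - x'‖ * R ≤ L * ‖x - x'‖ := by
      have : lf + lg * R ≤ L := by linarith
      nlinarith [norm_nonneg (x - x')]
    have p2 : b * ‖w - w'‖ ≤ L * ‖w - w'‖ :=
      mul_le_mul_of_nonneg_right (by linarith) (norm_nonneg _)
    linarith
  have hL0 : 0 ≤ L := by positivity
  refine ⟨L, hL0, fun t ht x hx x' hx' w w' hw hw' =>
    ⟨hb1 t ht x hx w hw, hb2 t ht x hx x' hx' w w' hw hw', ?_, ?_⟩⟩
  · exact hcv.norm_image_sub_le_of_norm_hasFDerivWithin_le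
      (fun z _ => (hP.hasFDerivAt_jac ht z w).hasFDerivWithinAt)
      (fun z hz => hb1 t ht z hz w hw) hx' hx
  · have hseg : segment ℝ x x' ⊆ K := hcv.segment_subset hx hx'
    have := (convex_segment x x').norm_image_sub_le_of_norm_hasFDerivWithin_le'
      (C := L * ‖x' - x‖) (φ := P.jac t x w)
      (fun z _ => (hP.hasFDerivAt_jac ht z w).hasFDerivWithinAt) (fun z hz => ?_)
      (left_mem_segment ℝ x x') (right_mem_segment ℝ x x')
    · rw [pow_two, ← mul_assoc]
      exact this
    · refine (hb2 t ht z (hseg hz) x hx w w hw hw).trans ?_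
      rw [sub_self, norm_zero, add_zero]
      refine mul_le_mul_of_nonneg_left ?_ hL0
      obtain ⟨θ, hθ, rfl⟩ :=
        (segment_eq_image' ℝ x x' ▸ hz : z ∈ (fun θ : ℝ => x + θ • (x' - x)) '' Icc 0 1)
      rw [add_sub_cancel_left, norm_smul, Real.norm_of_nonneg hθ.1]
      exact mul_le_of_le_one_left (norm_nonneg _) hθ.2

theorem SmoothDynamics.continuousOn_jac (hP : P.SmoothDynamics) {y : P.W} {u : ℝ → Vec m}
    (hu : ContinuousOn u (Icc 0 P.T)) :
    ContinuousOn (fun t => P.jac t (y.rep t) (u t)) (Icc 0 P.T) := by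
  have h1 := (hP.isC1Field_f univ).cont_fderiv.comp (f := fun t => (t, y.rep t))
    (continuousOn_id.prodMk (y.continuousOn_rep P.T_pos)) fun t ht => ⟨ht, mem_univ _⟩
  have h2 := (hP.isC1Field_g univ).cont_fderiv.comp (f := fun t => (t, y.rep t))
    (continuousOn_id.prodMk (y.continuousOn_rep P.T_pos)) fun t ht => ⟨ht, mem_univ _⟩
  have h3 := (ContinuousLinearMap.flipₗᵢ ℝ (Vec n) (Vec m) (Vec n)).continuous.comp_continuousOn h2
  exact h1.add (h3.clm_apply hu)

/-- A linear terminal value problem: a continuous control makes the coefficient bounded, while `y_d`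
enters only as an L² forcing. -/
theorem SmoothDynamics.exists_isAdjoint (hP : P.SmoothDynamics) (y : P.W) {u : ℝ → Vec m}
    (hu : ContinuousOn u (Icc 0 P.T)) : ∃ p, P.IsAdjoint y u p := by
  have hT := P.T_pos
  have hA := (adjointCLM (Vec n) (Vec n)).continuous.comp_continuousOn (hP.continuousOn_jac (y := y) hu)
  obtain ⟨L, hL⟩ := isCompact_Icc.exists_bound_of_continuousOn hA
  have hL0 : 0 ≤ L := (norm_nonneg _).trans (hL 0 (left_mem_Icc.mpr hT.le))
  obtain ⟨p, hp0, hp⟩ := H1.exists_solution_right hT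
    (h := fun t q => -((P.jac t (y.rep t) (u t)).adjoint q)
      - P.Q₁.adjoint (P.Q₁ (y.rep t - P.yd t))) hL0
    (fun t ht q q' => by
      rw [sub_sub_sub_cancel_right, neg_sub_neg, ← map_sub, norm_sub_rev q q']
      exact (P.jac t (y.rep t) (u t)).adjoint.le_of_opNorm_le (hL t ht) _)
    (fun q hq => by
      refine (ContinuousOn.memLp_timeMeasure (hA.clm_apply hq.continuousOn)).neg.sub ?_
      exact (P.Q₁.adjoint.comp P.Q₁).comp_memLp'
        ((y.memLp_rep hT).sub P.yd_mem))
    (P.Q₂.adjoint (P.Q₂ (y.rep P.T - P.ydT)))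
  exact ⟨p, hP.isAdjoint_iff.mpr ⟨hp, hp0⟩⟩

/-- Stability of the adjoint equation. -/
theorem SmoothDynamics.adjoint_stability (hP : P.SmoothDynamics) {K : Set (Vec n)}
    (hK : IsCompact K) (hcv : Convex ℝ K) {R R' : ℝ} (hR : 0 ≤ R) (hR' : 0 ≤ R') :
    ∃ C : ℝ, 0 ≤ C ∧ ∀ (y y' p p' : P.W) (u u' : ℝ → Vec m) (η : ℝ), 0 ≤ η →
      (∀ t ∈ Icc 0 P.T, y.rep t ∈ K ∧ y'.rep t ∈ K ∧ ‖u t‖ ≤ R ∧ ‖u' t‖ ≤ R ∧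
        ‖y.rep t - y'.rep t‖ ≤ η ∧ ‖u t - u' t‖ ≤ η) →
      (∀ t ∈ Ioo 0 P.T, ‖p'.rep t‖ ≤ R') →
      P.IsAdjoint y u p → P.IsAdjoint y' u' p' →
      (∀ t ∈ Icc 0 P.T, ‖p.rep t - p'.rep t‖ ≤ C * η) ∧ ‖p - p'‖ ≤ C * η := by
  have hT := P.T_pos
  obtain ⟨L, hL0, hL⟩ := hP.exists_jac_bounds hK hcv hR
  set q₁ := ‖P.Q₁.adjoint.comp P.Q₁‖ with hq₁
  set q₂ := ‖P.Q₂.adjoint.comp P.Q₂‖ with hq₂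
  set D := H1.gronwallConst P.T L with hD
  have hD0 : 0 ≤ D := H1.gronwallConst_nonneg hT.le hL0
  refine ⟨D * (L * 2 * R' + q₁ + q₂), by positivity, ?_⟩
  intro y y' p p' u u' η hη hb hbp hp hp'
  rw [hP.isAdjoint_iff] at hp hp'
  have hTm := right_mem_Icc.mpr hT.le
  have key := H1.gronwall_right hT (y := p - p') (L := L) (η := (L * 2 * R' + q₁ + q₂) * η) hL0 (by
      rw [H1.rep_sub hT _ _ _ hTm, hp.2, hp'.2, ← map_sub, ← map_sub, sub_sub_sub_cancel_right]
      refine ((P.Q₂.adjoint.comp P.Q₂).le_opNorm (y.rep P.T - y'.rep P.T)).trans ?_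
      have h1 := mul_le_mul_of_nonneg_left (hb P.T hTm).2.2.2.2.1 (norm_nonneg
        (P.Q₂.adjoint.comp P.Q₂))
      have h2 : 0 ≤ (L * 2 * R' + q₁) * η := by positivity
      rw [← hq₂] at h1 ⊢
      linarith) (by
    filter_upwards [hp.1, hp'.1, H1.der_sub p p', ae_restrict_mem measurableSet_Ioo]
      with t h1 h2 h3 ht
    have ht' := Ioo_subset_Icc_self ht
    obtain ⟨b1, b2, b3, b4, b6, b7⟩ := hb t ht'
    rw [h3, h1, h2, H1.rep_sub hT _ _ _ ht']
    set A := P.jac t (y.rep t) (u t) with hA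
    set A' := P.jac t (y'.rep t) (u' t) with hA'
    have hLt := hL t ht' _ b1 _ b2 (u t) (u' t) b3 b4
    -- The difference `p - p'` solves the adjoint equation of `(y, u)` with forcing from the change
    -- of Jacobian, applied to `p'`, and from the change of state; `y_d` cancels.
    have e : (-(A.adjoint (p.rep t)) - P.Q₁.adjoint (P.Q₁ (y.rep t - P.yd t)))
          - (-(A'.adjoint (p'.rep t)) - P.Q₁.adjoint (P.Q₁ (y'.rep t - P.yd t)))
        = -(A.adjoint (p.rep t - p'.rep t) + (A - A').adjoint (p'.rep t)
          + (P.Q₁.adjoint.comp P.Q₁) (y.rep t - y'.rep t)) := by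
      simp only [map_sub, sub_apply, ContinuousLinearMap.comp_apply]
      abel
    rw [e, norm_neg]
    refine (norm_add₃_le).trans ?_
    have n1 : ‖A.adjoint (p.rep t - p'.rep t)‖ ≤ L * ‖p.rep t - p'.rep t‖ :=
      A.adjoint.le_of_opNorm_le (by rw [LinearIsometryEquiv.norm_map]; exact hLt.1) _
    have n2 : ‖(A - A').adjoint (p'.rep t)‖ ≤ L * (2 * η) * R' := by
      refine ((A - A').adjoint.le_opNorm _).trans ?_
      rw [LinearIsometryEquiv.norm_map]
      refine mul_le_mul (hLt.2.1.trans ?_) (hbp t ht) (norm_nonneg _) (by positivity)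
      exact mul_le_mul_of_nonneg_left (by linarith) hL0
    have n3 : ‖(P.Q₁.adjoint.comp P.Q₁) (y.rep t - y'.rep t)‖ ≤ q₁ * η :=
      ((P.Q₁.adjoint.comp P.Q₁).le_opNorm _).trans
        (mul_le_mul_of_nonneg_left b6 (norm_nonneg _))
    have n4 : 0 ≤ q₂ * η := by positivity
    linarith)
  rw [sub_zero, ← mul_assoc] at key
  refine ⟨fun t ht => ?_, key.2⟩
  have := key.1 t ht
  rwa [H1.rep_sub hT _ _ _ ht] at this

end ControlProblem

/-! ### Estimates for quadratic functionals -/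

section L2Bounds

variable {E F : Type*} [NormedAddCommGroup E] [InnerProductSpace ℝ E]
  [NormedAddCommGroup F] [InnerProductSpace ℝ F]

theorem MeasureTheory.MemLp.timeMeasure_mono {E : Type*} [NormedAddCommGroup E] {q : ℝ≥0∞} {T t : ℝ} (ht : 0 ≤ t) {φ : ℝ → E}
    (h : MemLp φ q (timeMeasure 0 T)) : MemLp φ q (timeMeasure t T) :=
  h.mono_measure (Measure.restrict_mono (Ioo_subset_Ioo_left ht) le_rfl)

theorem norm_toL2_mono {E : Type*} [NormedAddCommGroup E] {T t : ℝ} (ht : 0 ≤ t) {φ : ℝ → E} (h : MemLp φ 2 (timeMeasure 0 T)) :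
    ‖toL2 t T φ‖ ≤ ‖toL2 0 T φ‖ := by
  rw [toL2_of_memLp h, toL2_of_memLp (h.timeMeasure_mono ht), Lp.norm_toLp, Lp.norm_toLp]
  exact ENNReal.toReal_mono h.eLpNorm_ne_top
    (eLpNorm_mono_measure _ (Measure.restrict_mono (Ioo_subset_Ioo_left ht) le_rfl))

theorem norm_toL2_clm_le {a b : ℝ} (A : E →L[ℝ] F) {φ : ℝ → E}
    (h : MemLp φ 2 (timeMeasure a b)) :
    ‖toL2 a b (fun t => A (φ t))‖ ≤ ‖A‖ * ‖toL2 a b φ‖ := by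
  have h1 : MemLp (fun t => A (φ t)) 2 (timeMeasure a b) := A.comp_memLp' h
  have e : toL2 a b (fun t => A (φ t)) = A.compLp (toL2 a b φ) := by
    refine Lp.ext ?_
    filter_upwards [coeFn_toL2 h1, A.coeFn_compLp (toL2 a b φ), coeFn_toL2 h] with t h1 h2 h3
    rw [h1, h2, h3]
  rw [e]
  exact A.norm_compLp_le _

theorem integrable_norm_sq {E : Type*} [NormedAddCommGroup E] {a b : ℝ} {φ : ℝ → E} (h : MemLp φ 2 (timeMeasure a b)) :
    Integrable (fun t => ‖φ t‖ ^ 2) (timeMeasure a b) :=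
  h.integrable_norm_pow (by norm_num)

theorem integrable_inner_of_memLp {a b : ℝ} {φ ψ : ℝ → E} (hφ : MemLp φ 2 (timeMeasure a b))
    (hψ : MemLp ψ 2 (timeMeasure a b)) :
    Integrable (fun t => (inner ℝ (φ t) (ψ t) : ℝ)) (timeMeasure a b) := by
  refine (L2.integrable_inner (𝕜 := ℝ) (hφ.toLp φ) (hψ.toLp ψ)).congr ?_
  filter_upwards [hφ.coeFn_toLp, hψ.coeFn_toLp] with t h1 h2
  rw [h1, h2]

/-- A difference of squares of L² norms. Norms over `(t, T)` are at most those over `(0, T)`, so the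
bound is uniform in `t`. -/
theorem abs_integral_norm_sq_sub_le {T t : ℝ} (ht : t ∈ Icc 0 T) {φ ψ : ℝ → E}
    (hφ : MemLp φ 2 (timeMeasure 0 T)) (hψ : MemLp ψ 2 (timeMeasure 0 T)) :
    |(∫ s in t..T, ‖φ s‖ ^ 2) - ∫ s in t..T, ‖ψ s‖ ^ 2|
      ≤ ‖toL2 0 T φ - toL2 0 T ψ‖ * (‖toL2 0 T φ‖ + ‖toL2 0 T ψ‖) := by
  have hφ' := hφ.timeMeasure_mono ht.1
  have hψ' := hψ.timeMeasure_mono ht.1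
  rw [← integral_timeMeasure ht.2, ← integral_timeMeasure ht.2, integral_norm_sq_eq hφ',
    integral_norm_sq_eq hψ', sq_sub_sq, abs_mul, mul_comm]
  refine mul_le_mul ?_ ?_ (abs_nonneg _) (norm_nonneg _)
  · refine (abs_norm_sub_norm_le _ _).trans ?_
    rw [← toL2_sub hφ' hψ', ← toL2_sub hφ hψ]
    exact norm_toL2_mono ht.1 (hφ.sub hψ)
  · rw [abs_of_nonneg (by positivity)]
    exact add_le_add (norm_toL2_mono ht.1 hφ) (norm_toL2_mono ht.1 hψ)

end L2Bounds

theorem norm_add_sq_sub_norm_sq {E : Type*} [NormedAddCommGroup E] [InnerProductSpace ℝ E]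
    (a b : E) : ‖a + b‖ ^ 2 - ‖a‖ ^ 2 = 2 * inner ℝ a b + ‖b‖ ^ 2 := by
  rw [norm_add_sq_real]
  ring

theorem abs_norm_sq_sub_le {E : Type*} [NormedAddCommGroup E] (a b : E) :
    |‖a‖ ^ 2 - ‖b‖ ^ 2| ≤ ‖a - b‖ * (‖a‖ + ‖b‖) := by
  rw [sq_sub_sq, abs_mul, mul_comm, abs_of_nonneg (by positivity : 0 ≤ ‖a‖ + ‖b‖)]
  exact mul_le_mul_of_nonneg_right (abs_norm_sub_norm_le a b) (by positivity)

/-- A differentiable function that is majorized to second order by an affine function has the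
derivative of this affine function. -/
theorem HasFDerivAt.eq_of_quadratic_majorant {E : Type*} [NormedAddCommGroup E]
    [InnerProductSpace ℝ E] {φ : E → ℝ} {φ' ℓ : E →L[ℝ] ℝ} {x : E} (hφ : HasFDerivAt φ φ' x) {C : ℝ}
    (h : ∀ᶠ v in 𝓝 (0 : E), φ (x + v) - φ x ≤ ℓ v + C * ‖v‖ ^ 2) : φ' = ℓ := by
  have h1 : HasFDerivAt (fun v => φ (x + v)) φ' 0 := by
    have h0 : HasFDerivAt φ φ' (x + 0) := by rwa [add_zero]
    have := h0.comp (0 : E) ((hasFDerivAt_id (0 : E)).const_add x)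
    rwa [ContinuousLinearMap.comp_id] at this
  have h2 : HasFDerivAt (fun v : E => C * ‖v‖ ^ 2) (0 : E →L[ℝ] ℝ) 0 := by
    have := (hasStrictFDerivAt_norm_sq (0 : E)).hasFDerivAt.const_mul C
    simpa using this
  have h3 : HasFDerivAt (fun v => ℓ v + C * ‖v‖ ^ 2 - φ (x + v)) (ℓ + 0 - φ') 0 :=
    (ℓ.hasFDerivAt.add h2).sub h1
  -- Majorant minus increment has a local minimum at 0, and its derivative there is `ℓ - φ'`.
  have hmin : IsLocalMin (fun v => ℓ v + C * ‖v‖ ^ 2 - φ (x + v)) 0 := by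
    filter_upwards [h] with v hv
    simp only [map_zero, norm_zero, add_zero]
    linarith
  have := hmin.hasFDerivAt_eq_zero h3
  rw [add_zero, sub_eq_zero] at this
  exact this.symm

/-! ### Cost, value function and principle of optimality -/

namespace ControlProblem

variable {n m : ℕ} {P : ControlProblem n m}

theorem integrable_runningCost {t : ℝ} (ht : 0 ≤ t) {y : ℝ → Vec n} {u : ℝ → Vec m}
    (hy : MemLp y 2 (timeMeasure t P.T)) (hu : MemLp u 2 (timeMeasure t P.T)) :
    Integrable (fun s => ‖P.Q₁ (y s - P.yd s)‖ ^ 2 + P.β * ‖u s‖ ^ 2) (timeMeasure t P.T) :=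
  (integrable_norm_sq (P.Q₁.comp_memLp' (hy.sub (P.yd_mem.timeMeasure_mono ht)))).add
    ((integrable_norm_sq hu).const_mul _)

theorem cost_nonneg {t : ℝ} (ht : t ≤ P.T) (y : ℝ → Vec n) (u : ℝ → Vec m) : 0 ≤ P.cost t y u := by
  have := P.β_pos
  refine add_nonneg (mul_nonneg (by norm_num) ?_) (by positivity)
  exact intervalIntegral.integral_nonneg ht fun s _ => by positivity

theorem cost_congr {t : ℝ} (ht : t ≤ P.T) {y y' : ℝ → Vec n} {u u' : ℝ → Vec m}
    (hy : EqOn y y' (Icc t P.T)) (hu : u =ᵐ[timeMeasure t P.T] u') :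
    P.cost t y u = P.cost t y' u' := by
  unfold cost
  rw [hy (right_mem_Icc.mpr ht), ← integral_timeMeasure ht, ← integral_timeMeasure ht]
  congr 2
  refine integral_congr_ae ?_
  filter_upwards [hu, ae_restrict_mem measurableSet_Ioo] with s h1 hs
  rw [h1, hy (Ioo_subset_Icc_self hs)]

theorem cost_eq_add {t : ℝ} (ht : t ∈ Icc 0 P.T) {y : ℝ → Vec n} {u : ℝ → Vec m}
    (hy : MemLp y 2 (timeMeasure 0 P.T)) (hu : MemLp u 2 (timeMeasure 0 P.T)) :
    P.cost 0 y u = (1 / 2) * (∫ s in (0 : ℝ)..t, (‖P.Q₁ (y s - P.yd s)‖ ^ 2 + P.β * ‖u s‖ ^ 2))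
      + P.cost t y u := by
  have hi := (intervalIntegrable_iff_timeMeasure P.T_pos.le _).mpr
    (integrable_runningCost (P := P) le_rfl hy hu)
  have h1 := intervalIntegral.integral_add_adjacent_intervals
    (hi.mono_set (c := 0) (d := t) (by
      rw [uIcc_of_le ht.1, uIcc_of_le P.T_pos.le]; exact Icc_subset_Icc_right ht.2))
    (hi.mono_set (c := t) (d := P.T) (by
      rw [uIcc_of_le ht.2, uIcc_of_le P.T_pos.le]; exact Icc_subset_Icc_left ht.1))
  unfold cost
  rw [← h1]
  ring

theorem value_le_cost {t : ℝ} (ht : t < P.T) {x : Vec n} {y : H1 t P.T n} {u : ℝ → Vec m}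
    (h : P.IsFeasible t x y u) : P.value t x ≤ P.cost t y.rep u := by
  rw [value, if_pos ht]
  refine csInf_le ⟨0, ?_⟩ ⟨y, u, h, rfl⟩
  rintro j ⟨z, w, -, rfl⟩
  exact cost_nonneg ht.le _ _

theorem value_terminal (x : Vec n) : P.value P.T x = (1 / 2) * ‖P.Q₂ (x - P.ydT)‖ ^ 2 :=
  if_neg (lt_irrefl _)

theorem IsFeasible.restrict {x : Vec n} {y : P.W} {u : ℝ → Vec m} (h : P.IsFeasible 0 x y u) {t : ℝ}
    (ht : t ∈ Ico 0 P.T) {z : H1 t P.T n} (hz : EqOn z.rep y.rep (Icc t P.T))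
    (hzd : z.der =ᵐ[timeMeasure t P.T] y.der) : P.IsFeasible t (y.rep t) z u := by
  refine ⟨h.1.timeMeasure_mono ht.1, ?_, hz (left_mem_Icc.mpr ht.2.le)⟩
  have h1 := ae_mono (Measure.restrict_mono (Ioo_subset_Ioo_left ht.1) le_rfl) h.2.1
  filter_upwards [h1, hzd, ae_restrict_mem measurableSet_Ioo] with s h2 h3 hs
  rw [h3, h2, hz (Ioo_subset_Icc_self hs)]

/-- The principle of optimality. -/
theorem IsOptimal.value_eq_cost {x : Vec n} {y : P.W} {u : ℝ → Vec m} (h : P.IsOptimal x y u)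
    {t : ℝ} (ht : t ∈ Icc 0 P.T) : P.value t (y.rep t) = P.cost t y.rep u := by
  rcases ht.2.eq_or_lt with rfl | htT
  · rw [value_terminal, cost]
    simp
  rw [value, if_pos htT]
  refine IsLeast.csInf_eq ⟨?_, ?_⟩
  · obtain ⟨z, hz, hzd⟩ := H1.exists_restrict ht.1 htT y
    refine ⟨z, u, h.1.restrict ⟨ht.1, htT⟩ hz hzd, ?_⟩
    exact cost_congr ht.2 hz.symm (Eventually.of_forall fun _ => rfl)
  · rintro j ⟨z, w, hzw, rfl⟩
    obtain ⟨c, hcy, hcz, hcd⟩ := H1.exists_glue ht.1 htT y z hzw.2.2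
    -- Follow `(y, u)` up to time `t` and the competitor `(z, w)` afterwards. Optimality on `(0, T)`
    -- applies to this pair, and the equal costs on `(0, t)` cancel.
    set U : ℝ → Vec m := fun s => if s ≤ t then u s else w s with hU
    have hUm : MemLp U 2 (timeMeasure 0 P.T) := by
      have h1 : MemLp ((Iic t).indicator u) 2 (timeMeasure 0 P.T) :=
        h.1.1.indicator measurableSet_Iic
      have h2 : MemLp ((Ioo t P.T).indicator w) 2 (timeMeasure 0 P.T) := by
        have h3 : MemLp ((Ioo t P.T).indicator w) 2 volume :=
          (memLp_indicator_iff_restrict measurableSet_Ioo).mpr hzw.1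
        exact h3.mono_measure Measure.restrict_le_self
      refine (h1.add h2).ae_eq ?_
      filter_upwards [ae_restrict_mem measurableSet_Ioo] with s hs
      by_cases hst : s ≤ t
      · simp [hU, hst, indicator, not_lt.mpr hst]
      · simp [hU, hst, indicator, not_le.mp hst, hs.2]
    have hfeas : P.IsFeasible 0 x c U := by
      refine ⟨hUm, ?_, ?_⟩
      · have h1 : ∀ᵐ s ∂(timeMeasure 0 P.T), s ∈ Ioo t P.T →
            z.der s = P.f s (z.rep s) + P.g s (z.rep s) (w s) := by
          have h2 := (ae_restrict_iff' measurableSet_Ioo).mp hzw.2.1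
          exact ae_restrict_of_ae h2
        filter_upwards [hcd, h1, h.1.2.1, ae_restrict_mem measurableSet_Ioo] with s h2 h3 h4 hs
        rw [h2]
        by_cases hst : s ≤ t
        · simp only [hU, hst, if_true]
          rw [h4, hcy ⟨hs.1.le, hst⟩]
        · simp only [hU, hst, if_false]
          rw [h3 ⟨not_le.mp hst, hs.2⟩, hcz ⟨(not_le.mp hst).le, hs.2.le⟩]
      · rw [hcy ⟨le_rfl, ht.1⟩]
        exact h.1.2.2
    have hopt := h.2 c U hfeas
    rw [cost_eq_add ht (y.memLp_rep P.T_pos) h.1.1, cost_eq_add ht (c.memLp_rep P.T_pos) hUm] at hopt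
    have e1 : ∫ s in (0 : ℝ)..t, (‖P.Q₁ (c.rep s - P.yd s)‖ ^ 2 + P.β * ‖U s‖ ^ 2)
        = ∫ s in (0 : ℝ)..t, (‖P.Q₁ (y.rep s - P.yd s)‖ ^ 2 + P.β * ‖u s‖ ^ 2) := by
      apply intervalIntegral.integral_congr
      intro s hs
      rw [uIcc_of_le ht.1] at hs
      simp only [hU, hs.2, if_true]
      rw [hcy hs]
    have e2 : P.cost t c.rep U = P.cost t z.rep w := by
      refine cost_congr ht.2 hcz ?_
      filter_upwards [ae_restrict_mem measurableSet_Ioo] with s hs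
      simp [hU, not_le.mpr hs.1]
    rw [e1, e2] at hopt
    linarith

set_option maxHeartbeats 600000 in
/-- The cost is locally Lipschitz continuous. -/
theorem exists_cost_lipschitz (P : ControlProblem n m) {R : ℝ} (hR : 0 ≤ R) :
    ∃ C : ℝ, 0 ≤ C ∧ ∀ t ∈ Icc 0 P.T, ∀ (y y' : P.W) (u u' : ℝ → Vec m),
      MemLp u 2 (timeMeasure 0 P.T) → MemLp u' 2 (timeMeasure 0 P.T) → ‖y‖ ≤ R → ‖y'‖ ≤ R →
      ‖toL2 0 P.T u‖ ≤ R → ‖toL2 0 P.T u'‖ ≤ R →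
      |P.cost t y.rep u - P.cost t y'.rep u'|
        ≤ C * (‖y - y'‖ + ‖toL2 0 P.T u - toL2 0 P.T u'‖) := by
  have hT := P.T_pos
  have hβ := P.β_pos
  obtain ⟨ι, hι0, hι⟩ := H1.exists_norm_rep_le hT n
  set q₁ := ‖P.Q₁‖
  set q₂ := ‖P.Q₂‖
  set d := ‖toL2 0 P.T P.yd‖
  set dT := ‖P.ydT‖
  -- Lipschitz constants of the tracking term, the control term and the terminal term: each is a
  -- difference of squares, estimated as a difference times a sum.
  set C₁ : ℝ := q₁ * (q₁ * (R + d) + q₁ * (R + d)) with hC₁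
  set C₂ : ℝ := P.β * (R + R) with hC₂
  set C₃ : ℝ := q₂ * ι * (q₂ * (ι * R + dT) + q₂ * (ι * R + dT)) with hC₃
  have hC₁0 : 0 ≤ C₁ := by positivity
  have hC₂0 : 0 ≤ C₂ := by positivity
  have hC₃0 : 0 ≤ C₃ := by positivity
  refine ⟨C₁ + C₂ + C₃, by positivity, ?_⟩
  intro t ht y y' u u' hu hu' hy hy' hun hun'
  have hyd : ∀ z : P.W, MemLp (fun s => z.rep s - P.yd s) 2 (timeMeasure 0 P.T) := fun z =>
    (z.memLp_rep hT).sub P.yd_mem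
  have hq : ∀ z : P.W, MemLp (fun s => P.Q₁ (z.rep s - P.yd s)) 2 (timeMeasure 0 P.T) := fun z =>
    P.Q₁.comp_memLp' (hyd z)
  have hrepn : ∀ z : P.W, ‖toL2 0 P.T z.rep‖ ≤ ‖z‖ := fun z => by
    rw [H1.toL2_rep hT]
    exact z.norm_fst_le
  have hqn : ∀ z : P.W, ‖z‖ ≤ R → ‖toL2 0 P.T (fun s => P.Q₁ (z.rep s - P.yd s))‖ ≤ q₁ * (R + d) := by
    intro z hz
    refine (norm_toL2_clm_le P.Q₁ (hyd z)).trans ?_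
    refine mul_le_mul_of_nonneg_left ?_ (norm_nonneg _)
    rw [toL2_sub (z.memLp_rep hT) P.yd_mem]
    exact (norm_sub_le _ _).trans (add_le_add ((hrepn z).trans hz) le_rfl)
  have e1 : |(∫ s in t..P.T, ‖P.Q₁ (y.rep s - P.yd s)‖ ^ 2)
      - ∫ s in t..P.T, ‖P.Q₁ (y'.rep s - P.yd s)‖ ^ 2| ≤ C₁ * ‖y - y'‖ := by
    refine (abs_integral_norm_sq_sub_le ht (hq y) (hq y')).trans ?_
    have h1 : ‖toL2 0 P.T (fun s => P.Q₁ (y.rep s - P.yd s))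
        - toL2 0 P.T (fun s => P.Q₁ (y'.rep s - P.yd s))‖ ≤ q₁ * ‖y - y'‖ := by
      rw [← toL2_sub (hq y) (hq y')]
      simp only [← map_sub, sub_sub_sub_cancel_right]
      refine (norm_toL2_clm_le P.Q₁ ((y.memLp_rep hT).sub (y'.memLp_rep hT))).trans ?_
      refine mul_le_mul_of_nonneg_left ?_ (norm_nonneg _)
      have h2 := toL2_sub (y.memLp_rep hT) (y'.memLp_rep hT)
      rw [H1.toL2_rep hT, H1.toL2_rep hT] at h2
      exact (congrArg norm h2).trans_le (y - y').norm_fst_le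
    have := mul_le_mul h1 (add_le_add (hqn y hy) (hqn y' hy')) (by positivity) (by positivity)
    refine this.trans_eq ?_
    rw [hC₁]
    ring
  have e2 : |(∫ s in t..P.T, ‖u s‖ ^ 2) - ∫ s in t..P.T, ‖u' s‖ ^ 2|
      ≤ ‖toL2 0 P.T u - toL2 0 P.T u'‖ * (R + R) :=
    (abs_integral_norm_sq_sub_le ht hu hu').trans
      (mul_le_mul_of_nonneg_left (add_le_add hun hun') (norm_nonneg _))
  have hTm := right_mem_Icc.mpr hT.le
  have e3 : |‖P.Q₂ (y.rep P.T - P.ydT)‖ ^ 2 - ‖P.Q₂ (y'.rep P.T - P.ydT)‖ ^ 2|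
      ≤ C₃ * ‖y - y'‖ := by
    have hb : ∀ z : P.W, ‖z‖ ≤ R → ‖P.Q₂ (z.rep P.T - P.ydT)‖ ≤ q₂ * (ι * R + dT) := by
      intro z hz
      refine (P.Q₂.le_opNorm _).trans (mul_le_mul_of_nonneg_left ?_ (norm_nonneg _))
      refine (norm_sub_le _ _).trans (add_le_add ((hι z _ hTm).trans ?_) le_rfl)
      exact mul_le_mul_of_nonneg_left hz hι0
    refine (abs_norm_sq_sub_le _ _).trans ?_
    rw [← map_sub, sub_sub_sub_cancel_right, ← H1.rep_sub hT _ _ _ hTm]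
    have h1 : ‖P.Q₂ ((y - y').rep P.T)‖ ≤ q₂ * (ι * ‖y - y'‖) :=
      (P.Q₂.le_opNorm _).trans (mul_le_mul_of_nonneg_left (hι _ _ hTm) (norm_nonneg _))
    have := mul_le_mul h1 (add_le_add (hb y hy) (hb y' hy')) (by positivity) (by positivity)
    refine this.trans_eq ?_
    rw [hC₃]
    ring
  have hsplit : ∀ (z : P.W) (w : ℝ → Vec m), MemLp w 2 (timeMeasure 0 P.T) →
      P.cost t z.rep w = (1 / 2) * ((∫ s in t..P.T, ‖P.Q₁ (z.rep s - P.yd s)‖ ^ 2)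
        + P.β * ∫ s in t..P.T, ‖w s‖ ^ 2) + (1 / 2) * ‖P.Q₂ (z.rep P.T - P.ydT)‖ ^ 2 := by
    intro z w hw
    rw [cost, intervalIntegral.integral_add, intervalIntegral.integral_const_mul]
    · exact (intervalIntegrable_iff_timeMeasure ht.2 _).mpr
        (integrable_norm_sq ((hq z).timeMeasure_mono ht.1))
    · exact ((intervalIntegrable_iff_timeMeasure ht.2 _).mpr
        (integrable_norm_sq (hw.timeMeasure_mono ht.1))).const_mul _
  rw [hsplit y u hu, hsplit y' u' hu']
  have e2' := mul_le_mul_of_nonneg_left e2 hβ.le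
  rw [← abs_of_pos hβ, ← abs_mul, abs_of_pos hβ] at e2'
  set I₁ := ∫ s in t..P.T, ‖P.Q₁ (y.rep s - P.yd s)‖ ^ 2
  set I₂ := ∫ s in t..P.T, ‖P.Q₁ (y'.rep s - P.yd s)‖ ^ 2
  set N₁ := ‖P.Q₂ (y.rep P.T - P.ydT)‖ ^ 2
  set N₂ := ‖P.Q₂ (y'.rep P.T - P.ydT)‖ ^ 2
  set D := ‖toL2 0 P.T u - toL2 0 P.T u'‖ with hD
  have hD0 : 0 ≤ D := norm_nonneg _
  have hY0 : 0 ≤ ‖y - y'‖ := norm_nonneg _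
  have f1 : 0 ≤ C₁ * D := by positivity
  have f2 : 0 ≤ C₂ * ‖y - y'‖ := by positivity
  have f3 : 0 ≤ C₃ * D := by positivity
  have f4 : 0 ≤ C₁ * ‖y - y'‖ := by positivity
  have f5 : 0 ≤ C₂ * D := by positivity
  have f6 : 0 ≤ C₃ * ‖y - y'‖ := by positivity
  have f7 : P.β * (D * (R + R)) = C₂ * D := by rw [hC₂]; ring
  rw [f7] at e2'
  rw [abs_le] at e1 e2' e3 ⊢
  constructor <;> linarith [e1.1, e1.2, e2'.1, e2'.2, e3.1, e3.2]

end ControlProblem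

/-! ### The adjoint state as gradient of the value function -/

namespace ControlProblem

variable {n m : ℕ} {P : ControlProblem n m}

/-- The first variation of the cost along an admissible perturbation, expressed through the
adjoint state. -/
theorem SmoothDynamics.cost_sub_le (hP : P.SmoothDynamics) {K : Set (Vec n)} {L R B δ : ℝ}
    (hL0 : 0 ≤ L) (hB0 : 0 ≤ B)
    (hL : ∀ t ∈ Icc 0 P.T, ∀ x ∈ K, ∀ x' ∈ K, ∀ w : Vec m, ‖w‖ ≤ R →
      ‖(P.f t x' + P.g t x' w) - (P.f t x + P.g t x w) - P.jac t x w (x' - x)‖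
        ≤ L * ‖x' - x‖ ^ 2)
    {y p : P.W} {u : ℝ → Vec m} (hu : ∀ t ∈ Icc 0 P.T, ‖u t‖ ≤ R)
    (hum : MemLp u 2 (timeMeasure 0 P.T))
    (hyK : ∀ t ∈ Icc 0 P.T, y.rep t ∈ K)
    (hy : ∀ᵐ t ∂(timeMeasure 0 P.T), y.der t = P.f t (y.rep t) + P.g t (y.rep t) (u t))
    (hp : P.IsAdjoint y u p) (hpB : ∀ t ∈ Icc 0 P.T, ‖p.rep t‖ ≤ B) {t : ℝ} (ht : t ∈ Ico 0 P.T)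
    {z : H1 t P.T n} (hzK : ∀ s ∈ Icc t P.T, z.rep s ∈ K)
    (hz : ∀ᵐ s ∂(timeMeasure t P.T), z.der s = P.f s (z.rep s) + P.g s (z.rep s) (u s))
    (hδ : ∀ s ∈ Icc t P.T, ‖z.rep s - y.rep s‖ ≤ δ) :
    P.cost t z.rep u - P.cost t y.rep u ≤ inner ℝ (p.rep t) (z.rep t - y.rep t)
      + ((‖P.Q₁‖ ^ 2 + B * L) * P.T + ‖P.Q₂‖ ^ 2) * δ ^ 2 := by
  have hT := P.T_pos
  have htT := ht.2
  rw [hP.isAdjoint_iff] at hp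
  obtain ⟨y', hy', hyd'⟩ := H1.exists_restrict ht.1 htT y
  obtain ⟨p', hp', hpd'⟩ := H1.exists_restrict ht.1 htT p
  have hsub : Icc t P.T ⊆ Icc 0 P.T := Icc_subset_Icc_left ht.1
  have htm : t ∈ Icc t P.T := left_mem_Icc.mpr htT.le
  have hTm : P.T ∈ Icc t P.T := right_mem_Icc.mpr htT.le
  set d := z - y' with hd
  have hdrep : ∀ s ∈ Icc t P.T, d.rep s = z.rep s - y.rep s := fun s hs => by
    rw [hd, H1.rep_sub htT _ _ _ hs, hy' hs]
  have hrestr : ∀ {q : ℝ → Prop}, (∀ᵐ s ∂(timeMeasure 0 P.T), q s) →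
      ∀ᵐ s ∂(timeMeasure t P.T), q s := fun h =>
    ae_mono (Measure.restrict_mono (Ioo_subset_Ioo_left ht.1) le_rfl) h
  -- `J` is the a.e. derivative of `s ↦ ⟨p(s), z(s) - y(s)⟩`; its integral produces the boundary
  -- terms of the duality identity.
  set J : ℝ → ℝ := fun s => inner ℝ (p'.der s) (d.rep s) + inner ℝ (p'.rep s) (d.der s) with hJ
  set Γ : ℝ → ℝ := fun s => ‖P.Q₁ (z.rep s - P.yd s)‖ ^ 2 - ‖P.Q₁ (y.rep s - P.yd s)‖ ^ 2 with hΓ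
  have hJint : Integrable J (timeMeasure t P.T) :=
    (integrable_inner_of_memLp p'.memLp_der (d.memLp_rep htT)).add
      (integrable_inner_of_memLp (p'.memLp_rep htT) d.memLp_der)
  have hyd := P.yd_mem.timeMeasure_mono ht.1
  have hzq : MemLp (fun s => P.Q₁ (z.rep s - P.yd s)) 2 (timeMeasure t P.T) :=
    P.Q₁.comp_memLp' ((z.memLp_rep htT).sub hyd)
  have hyq : MemLp (fun s => P.Q₁ (y.rep s - P.yd s)) 2 (timeMeasure t P.T) :=
    P.Q₁.comp_memLp' (((y.memLp_rep hT).timeMeasure_mono ht.1).sub hyd)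
  have hΓint : Integrable Γ (timeMeasure t P.T) :=
    (integrable_norm_sq hzq).sub (integrable_norm_sq hyq)
  have hpt : ∀ᵐ s ∂(timeMeasure t P.T),
      (1 / 2) * Γ s + J s ≤ (‖P.Q₁‖ ^ 2 + B * L) * δ ^ 2 := by
    filter_upwards [hpd', hrestr hp.1, hrestr hy, hz, H1.der_sub z y', hyd',
      ae_restrict_mem measurableSet_Ioo] with s h1 h2 h3 h4 h5 h6 hs
    have hs' := Ioo_subset_Icc_self hs
    have hs0 := hsub hs'
    have e0 : z.rep s - P.yd s = (y.rep s - P.yd s) + d.rep s := by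
      rw [hdrep s hs']
      abel
    set r : Vec n := (P.f s (z.rep s) + P.g s (z.rep s) (u s))
      - (P.f s (y.rep s) + P.g s (y.rep s) (u s)) - P.jac s (y.rep s) (u s) (d.rep s) with hr
    have hrn : ‖r‖ ≤ L * δ ^ 2 := by
      have := hL s hs0 _ (hyK s hs0) _ (hzK s hs') (u s) (hu s hs0)
      rw [← hdrep s hs'] at this
      refine this.trans (mul_le_mul_of_nonneg_left ?_ hL0)
      rw [hdrep s hs']
      exact pow_le_pow_left₀ (norm_nonneg _) (hδ s hs') 2
    have hdd : d.der s = P.jac s (y.rep s) (u s) (d.rep s) + r := by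
      rw [hr, hd, h5, h4, h6, h3]
      abel
    -- The Jacobian terms of the state and adjoint equations cancel, leaving minus half the linear
    -- part of the tracking difference `Γ`, and the Taylor remainder `r` tested with `p`.
    have hJs : J s = -inner ℝ (P.Q₁ (y.rep s - P.yd s)) (P.Q₁ (d.rep s)) + inner ℝ (p.rep s) r := by
      simp only [hJ]
      rw [h1, h2, hdd, hp' hs', inner_sub_left, inner_neg_left, inner_add_right,
        ContinuousLinearMap.adjoint_inner_left, ContinuousLinearMap.adjoint_inner_left]
      ring
    have hΓs : Γ s = 2 * inner ℝ (P.Q₁ (y.rep s - P.yd s)) (P.Q₁ (d.rep s))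
        + ‖P.Q₁ (d.rep s)‖ ^ 2 := by
      simp only [hΓ]
      rw [e0, map_add, norm_add_sq_sub_norm_sq]
    have hQd : ‖P.Q₁ (d.rep s)‖ ^ 2 ≤ ‖P.Q₁‖ ^ 2 * δ ^ 2 := by
      rw [← mul_pow]
      refine pow_le_pow_left₀ (norm_nonneg _) ((P.Q₁.le_opNorm _).trans ?_) 2
      rw [hdrep s hs']
      exact mul_le_mul_of_nonneg_left (hδ s hs') (norm_nonneg _)
    have hpr : inner ℝ (p.rep s) r ≤ B * (L * δ ^ 2) :=
      (real_inner_le_norm _ _).trans (mul_le_mul (hpB s hs0) hrn (norm_nonneg _) hB0)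
    have : 0 ≤ ‖P.Q₁ (d.rep s)‖ ^ 2 := by positivity
    rw [hJs, hΓs]
    linarith
  have hint := integral_mono_ae ((hΓint.const_mul (1 / 2)).add hJint) (integrable_const _) hpt
  rw [integral_add' (hΓint.const_mul (1 / 2)) hJint, integral_const_mul] at hint
  have hconst : ∫ _, (‖P.Q₁‖ ^ 2 + B * L) * δ ^ 2 ∂(timeMeasure t P.T)
      ≤ (‖P.Q₁‖ ^ 2 + B * L) * P.T * δ ^ 2 := by
    rw [integral_timeMeasure htT.le, intervalIntegral.integral_const, smul_eq_mul]
    have h1 : 0 ≤ (‖P.Q₁‖ ^ 2 + B * L) * δ ^ 2 := by positivity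
    nlinarith [ht.1]
  have hJval : ∫ s, J s ∂(timeMeasure t P.T)
      = inner ℝ (p.rep P.T) (d.rep P.T) - inner ℝ (p.rep t) (z.rep t - y.rep t) := by
    rw [integral_timeMeasure htT.le, H1.integral_inner_der htT p' d, hp' hTm, hp' htm,
      hdrep t htm]
  have hcost : P.cost t z.rep u - P.cost t y.rep u
      = (1 / 2) * (∫ s, Γ s ∂(timeMeasure t P.T))
        + (inner ℝ (p.rep P.T) (d.rep P.T) + (1 / 2) * ‖P.Q₂ (d.rep P.T)‖ ^ 2) := by
    have hum' := hum.timeMeasure_mono ht.1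
    have i1 := integrable_runningCost (P := P) ht.1 (z.memLp_rep htT) hum'
    have i2 := integrable_runningCost (P := P) ht.1 ((y.memLp_rep hT).timeMeasure_mono ht.1) hum'
    have e1 : ∫ s, Γ s ∂(timeMeasure t P.T)
        = (∫ s in t..P.T, (‖P.Q₁ (z.rep s - P.yd s)‖ ^ 2 + P.β * ‖u s‖ ^ 2))
          - ∫ s in t..P.T, (‖P.Q₁ (y.rep s - P.yd s)‖ ^ 2 + P.β * ‖u s‖ ^ 2) := by
      rw [← integral_timeMeasure htT.le, ← integral_timeMeasure htT.le, ← integral_sub i1 i2]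
      refine integral_congr_ae (Eventually.of_forall fun s => ?_)
      simp only [hΓ]
      ring
    have e2 : ‖P.Q₂ (z.rep P.T - P.ydT)‖ ^ 2 - ‖P.Q₂ (y.rep P.T - P.ydT)‖ ^ 2
        = 2 * inner ℝ (p.rep P.T) (d.rep P.T) + ‖P.Q₂ (d.rep P.T)‖ ^ 2 := by
      have e0 : z.rep P.T - P.ydT = (y.rep P.T - P.ydT) + d.rep P.T := by
        rw [hdrep P.T hTm]
        abel
      rw [e0, map_add, norm_add_sq_sub_norm_sq, hp.2, ContinuousLinearMap.adjoint_inner_left]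
    rw [e1]
    unfold cost
    linarith
  have hQd : ‖P.Q₂ (d.rep P.T)‖ ^ 2 ≤ ‖P.Q₂‖ ^ 2 * δ ^ 2 := by
    rw [← mul_pow]
    refine pow_le_pow_left₀ (norm_nonneg _) ((P.Q₂.le_opNorm _).trans ?_) 2
    rw [hdrep _ hTm]
    exact mul_le_mul_of_nonneg_left (hδ _ hTm) (norm_nonneg _)
  have hQ0 : 0 ≤ ‖P.Q₂ (d.rep P.T)‖ ^ 2 := by positivity
  rw [hcost]
  linarith

/-- Along an optimal trajectory the adjoint state is the gradient of the value function. -/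
theorem SmoothDynamics.gradient_value_eq (hP : P.SmoothDynamics) {K : Set (Vec n)}
    (hK : IsCompact K) (hcv : Convex ℝ K) {x : Vec n} {y p : P.W} {u : ℝ → Vec m}
    (hopt : P.IsOptimal x y u) (hu : ContinuousOn u (Icc 0 P.T)) (hp : P.IsAdjoint y u p) {r : ℝ}
    (hr : 0 < r) (hyK : ∀ t ∈ Icc 0 P.T, Metric.closedBall (y.rep t) r ⊆ K) {t : ℝ}
    (ht : t ∈ Ico 0 P.T) (hd : DifferentiableAt ℝ (P.value t) (y.rep t)) :
    gradient (P.value t) (y.rep t) = p.rep t := by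
  have hT := P.T_pos
  have htT := ht.2
  obtain ⟨R, hR⟩ := isCompact_Icc.exists_bound_of_continuousOn hu
  have h0m : (0 : ℝ) ∈ Icc 0 P.T := left_mem_Icc.mpr hT.le
  have hR0 : 0 ≤ R := (norm_nonneg _).trans (hR 0 h0m)
  obtain ⟨B, hB⟩ := isCompact_Icc.exists_bound_of_continuousOn (p.continuousOn_rep hT)
  have hB0 : 0 ≤ B := (norm_nonneg _).trans (hB 0 h0m)
  obtain ⟨L, hL0, hL⟩ := hP.exists_jac_bounds hK hcv hR0
  have hyK' : ∀ s ∈ Icc 0 P.T, y.rep s ∈ K := fun s hs =>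
    hyK s hs (Metric.mem_closedBall_self hr.le)
  obtain ⟨π, hπK, hπid, hπlip⟩ :=
    exists_lipschitz_retraction ⟨_, hyK' 0 h0m⟩ hK.isClosed hcv
  have hsub : Icc t P.T ⊆ Icc 0 P.T := Icc_subset_Icc_left ht.1
  set D := H1.gronwallConst (P.T - t) L with hD
  have hD0 : 0 ≤ D := H1.gronwallConst_nonneg (sub_nonneg.mpr htT.le) hL0
  have hπc : Continuous π := by
    refine (LipschitzWith.of_dist_le_mul (K := 1) fun a b => ?_).continuous
    rw [dist_eq_norm, dist_eq_norm, NNReal.coe_one, one_mul]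
    exact hπlip a b
  set C := ((‖P.Q₁‖ ^ 2 + B * L) * P.T + ‖P.Q₂‖ ^ 2) * D ^ 2 with hC
  -- Keep the control `u` and shift the state at time `t` by `v`: the cost of this feasible pair
  -- bounds the value from above, with equality at `v = 0` by the principle of optimality, and
  -- `cost_sub_le` expands it.
  have hmaj : ∀ᶠ v in 𝓝 (0 : Vec n), P.value t (y.rep t + v) - P.value t (y.rep t)
      ≤ innerSL ℝ (p.rep t) v + C * ‖v‖ ^ 2 := by
    have hball : Metric.ball (0 : Vec n) (r / (D + 1)) ∈ 𝓝 (0 : Vec n) :=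
      Metric.ball_mem_nhds _ (by positivity)
    filter_upwards [hball] with v hv
    rw [mem_ball_zero_iff, lt_div_iff₀ (by positivity)] at hv
    -- Composing the field with the nearest point map `π` onto `K` makes it globally Lipschitz. For
    -- small `v` the solution stays in `K`, where `π` is the identity.
    obtain ⟨z, hz0, hz⟩ := H1.exists_solution htT
      (h := fun s q => P.f s (π q) + P.g s (π q) (u s)) hL0
      (fun s hs q q' => by
        refine ((hL s (hsub hs) _ (hπK q) _ (hπK q') (u s) (u s) (hR s (hsub hs))
          (hR s (hsub hs))).2.2.1).trans ?_
        exact mul_le_mul_of_nonneg_left (hπlip q q') hL0)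
      (fun q hq => by
        refine ContinuousOn.memLp_timeMeasure ?_
        have hq' : ContinuousOn (fun s => (s, π (q s))) (Icc t P.T) :=
          continuousOn_id.prodMk (hπc.comp hq).continuousOn
        have h1 := (hP.isC1Field_f univ).cont.comp hq' fun s hs => ⟨hsub hs, mem_univ _⟩
        have h2 := (hP.isC1Field_g univ).cont.comp hq' fun s hs => ⟨hsub hs, mem_univ _⟩
        exact h1.add (h2.clm_apply (hu.mono hsub))) (y.rep t + v)
    obtain ⟨y', hy', hyd'⟩ := H1.exists_restrict ht.1 htT y
    have htm : t ∈ Icc t P.T := left_mem_Icc.mpr htT.le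
    have hstate := ae_mono (Measure.restrict_mono (Ioo_subset_Ioo_left ht.1) le_rfl) hopt.1.2.1
    have hclose : ∀ s ∈ Icc t P.T, ‖z.rep s - y.rep s‖ ≤ D * ‖v‖ := by
      have h1 := (H1.gronwall_left htT (y := z - y') (L := L) (η := ‖v‖) hL0 (by
          rw [H1.rep_sub htT _ _ _ htm, hz0, hy' htm, add_sub_cancel_left]) (by
        filter_upwards [hz, hyd', hstate, H1.der_sub z y', ae_restrict_mem measurableSet_Ioo]
          with s h1 h2 h3 h4 hs
        have hs' := Ioo_subset_Icc_self hs
        rw [h4, h1, h2, h3, H1.rep_sub htT _ _ _ hs', hy' hs']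
        have hys := hyK' s (hsub hs')
        have h5 := (hL s (hsub hs') _ (hπK (z.rep s)) _ hys (u s) (u s) (hR s (hsub hs'))
          (hR s (hsub hs'))).2.2.1
        have h6 := hπlip (z.rep s) (y.rep s)
        rw [hπid _ hys] at h6
        refine (h5.trans (mul_le_mul_of_nonneg_left h6 hL0)).trans ?_
        exact le_add_of_nonneg_right (norm_nonneg _))).1
      intro s hs
      have := h1 s hs
      rwa [H1.rep_sub htT _ _ _ hs, hy' hs] at this
    have hzK : ∀ s ∈ Icc t P.T, z.rep s ∈ K := by
      intro s hs
      refine hyK s (hsub hs) ?_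
      rw [mem_closedBall_iff_norm]
      refine (hclose s hs).trans (le_trans ?_ hv.le)
      nlinarith [norm_nonneg v]
    have hz' : ∀ᵐ s ∂(timeMeasure t P.T), z.der s = P.f s (z.rep s) + P.g s (z.rep s) (u s) := by
      filter_upwards [hz, ae_restrict_mem measurableSet_Ioo] with s h1 hs
      rw [h1, hπid _ (hzK s (Ioo_subset_Icc_self hs))]
    have hval := value_le_cost (P := P) htT (x := y.rep t + v) (y := z) (u := u)
      ⟨hopt.1.1.timeMeasure_mono ht.1, hz', hz0⟩
    have hdiff := hP.cost_sub_le hL0 hB0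
      (fun s hs a ha b hb w hw => (hL s hs a ha b hb w w hw hw).2.2.2) hR hopt.1.1 hyK'
      hopt.1.2.1 hp hB ht hzK hz' hclose
    rw [hopt.value_eq_cost ⟨ht.1, ht.2.le⟩]
    have e1 : z.rep t - y.rep t = v := by rw [hz0, add_sub_cancel_left]
    rw [e1] at hdiff
    have e2 : C * ‖v‖ ^ 2 = ((‖P.Q₁‖ ^ 2 + B * L) * P.T + ‖P.Q₂‖ ^ 2) * (D * ‖v‖) ^ 2 := by
      rw [hC]
      ring
    rw [e2, innerSL_apply_apply]
    linarith
  have heq := hd.hasFDerivAt.eq_of_quadratic_majorant hmaj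
  rw [gradient, heq]
  exact (InnerProductSpace.toDual ℝ (Vec n)).symm_apply_apply (p.rep t)

end ControlProblem

/-- Almost every point of a set is a point of unique differentiability. -/
theorem ae_uniqueDiffWithinAt {E : Type*} [NormedAddCommGroup E] [NormedSpace ℝ E]
    [FiniteDimensional ℝ E] [MeasurableSpace E] [BorelSpace E] (μ : Measure E) [μ.IsAddHaarMeasure]
    (s : Set E) : ∀ᵐ x ∂(μ.restrict s), x ∈ s → UniqueDiffWithinAt ℝ s x := by
  filter_upwards [Besicovitch.ae_tendsto_measure_inter_div μ s] with x hx hxs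
  refine ⟨?_, subset_closure hxs⟩
  -- At a density point every ball around `v`, scaled down towards `x`, meets `s`; hence every
  -- direction `v` is tangent.
  have huniv : tangentConeAt ℝ s x = univ := by
    refine eq_univ_of_forall fun v => ?_
    have h : ∀ k : ℕ, ∃ (r : ℝ) (a : E), 0 < r ∧ r < 1 / ((k : ℝ) + 1) ∧
        ‖a - v‖ ≤ 1 / ((k : ℝ) + 1) ∧ x + r • a ∈ s := by
      intro k
      have hk : (0 : ℝ) < 1 / ((k : ℝ) + 1) := by positivity
      have h1 := Measure.eventually_nonempty_inter_smul_of_density_one μ s x hx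
        (Metric.closedBall v (1 / ((k : ℝ) + 1))) Metric.isClosed_closedBall.measurableSet
        (Metric.measure_closedBall_pos μ v hk).ne'
      obtain ⟨r, ⟨y, ys, hy⟩, hr⟩ := (h1.and (Ioo_mem_nhdsGT hk)).exists
      simp only [mem_smul_set, image_add_left, mem_preimage, singleton_add] at hy
      obtain ⟨a, az, ha⟩ := hy
      refine ⟨r, a, hr.1, hr.2, mem_closedBall_iff_norm.mp az, ?_⟩
      rwa [ha, add_neg_cancel_left]
    choose r a hr0 hr ha has using h
    have hlim := tendsto_one_div_add_atTop_nhds_zero_nat (𝕜 := ℝ)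
    have hr' : Tendsto r atTop (𝓝 0) := squeeze_zero (fun k => (hr0 k).le) (fun k => (hr k).le) hlim
    have ha' : Tendsto a atTop (𝓝 v) := by
      rw [tendsto_iff_norm_sub_tendsto_zero]
      exact squeeze_zero (fun k => norm_nonneg _) ha hlim
    refine mem_tangentConeAt_of_seq atTop (fun k => (r k)⁻¹) (fun k => r k • a k) ?_
      (Eventually.of_forall has) ?_
    · simpa using hr'.smul ha'
    · refine ha'.congr fun k => ?_
      rw [smul_smul, inv_mul_cancel₀ (hr0 k).ne', one_smul]
  rw [huniv]
  simp

theorem embeddingNorm_nonneg (T : ℝ) (n : ℕ) : 0 ≤ embeddingNorm T n :=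
  Real.sInf_nonneg fun _ h => h.1

/-! ### Nearby trajectories and superposition operators -/

section Near

variable {n : ℕ} {T : ℝ} {K : Set (Vec n)} {h h' : ℝ → Vec n → Vec n}

/-- A field that is uniformly close to `h` has trajectories close to those of `h`. -/
theorem exists_trajectory_near (hT : 0 < T) (hK : IsCompact K) (hcv : Convex ℝ K)
    (hh' : IsC1Field T K h') {L κ r : ℝ} (hL0 : 0 ≤ L) (hκ0 : 0 ≤ κ)
    (hL : ∀ t ∈ Icc 0 T, ∀ x ∈ K, ∀ y ∈ K, ‖h t x - h t y‖ ≤ L * ‖x - y‖)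
    (hκ : H1.gronwallConst T L * κ ≤ r) (hclose : ∀ t ∈ Icc 0 T, ∀ x ∈ K, ‖h t x - h' t x‖ ≤ κ)
    {y : H1 0 T n} (hy : IsTrajectory T K h y)
    (hyr : ∀ t ∈ Icc 0 T, Metric.closedBall (y.rep t) r ⊆ K) :
    ∃ y' : H1 0 T n, y'.rep 0 = y.rep 0 ∧ IsTrajectory T K h' y' := by
  have h0m : (0 : ℝ) ∈ Icc 0 T := left_mem_Icc.mpr hT.le
  obtain ⟨L', hL0', -, hL'⟩ := hh'.exists_lipschitz hK hcv
  obtain ⟨π, hπK, hπid, hπlip⟩ :=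
    exists_lipschitz_retraction ⟨_, hy.1 0 h0m⟩ hK.isClosed hcv
  have hπc : Continuous π := by
    refine (LipschitzWith.of_dist_le_mul (K := 1) fun a b => ?_).continuous
    rw [dist_eq_norm, dist_eq_norm, NNReal.coe_one, one_mul]
    exact hπlip a b
  -- Solve with `h'` composed with the retraction onto `K`; the Grönwall estimate then shows that
  -- `z` never leaves the `r`-tube around `y`, hence not `K`.
  obtain ⟨z, hz0, hz⟩ := H1.exists_solution hT (h := fun t q => h' t (π q)) hL0'
    (fun t ht q q' => (hL' t ht _ (hπK q) _ (hπK q')).trans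
      (mul_le_mul_of_nonneg_left (hπlip q q') hL0'))
    (fun q hq => by
      refine ContinuousOn.memLp_timeMeasure ?_
      exact hh'.cont.comp (f := fun s => (s, π (q s)))
        (continuousOn_id.prodMk (hπc.comp hq).continuousOn) fun s hs => ⟨hs, hπK _⟩) (y.rep 0)
  have hzK : ∀ t ∈ Icc 0 T, z.rep t ∈ K := by
    intro t ht
    have key := (H1.gronwall_left hT (y := z - y) (L := L) (η := κ) hL0 (by
        rw [H1.rep_sub hT _ _ _ h0m, hz0, sub_self, norm_zero]
        exact hκ0) (by
      filter_upwards [hz, hy.2, H1.der_sub z y, ae_restrict_mem measurableSet_Ioo]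
        with s h1 h2 h3 hs
      have hs' := Ioo_subset_Icc_self hs
      rw [h3, h1, h2, H1.rep_sub hT _ _ _ hs']
      have e : h' s (π (z.rep s)) - h s (y.rep s)
          = (h s (π (z.rep s)) - h s (y.rep s)) - (h s (π (z.rep s)) - h' s (π (z.rep s))) := by abel
      rw [e]
      refine (norm_sub_le _ _).trans (add_le_add ?_ (hclose s hs' _ (hπK _)))
      refine (hL s hs' _ (hπK _) _ (hy.1 s hs')).trans (mul_le_mul_of_nonneg_left ?_ hL0)
      have := hπlip (z.rep s) (y.rep s)
      rwa [hπid _ (hy.1 s hs')] at this)).1 t ht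
    refine hyr t ht ?_
    rw [mem_closedBall_iff_norm, ← H1.rep_sub hT _ _ _ ht]
    rw [sub_zero] at key
    exact key.trans hκ
  refine ⟨z, hz0, hzK, ?_⟩
  filter_upwards [hz, ae_restrict_mem measurableSet_Ioo] with t h1 ht
  rw [h1, hπid _ (hzK t (Ioo_subset_Icc_self ht))]

theorem exists_uniform_close {F : Type*} [NormedAddCommGroup F] (hT : 0 < T) {Φ : ℝ → Vec n → F}
    (hΦ : ContinuousOn (fun z : ℝ × Vec n => Φ z.1 z.2) (Icc 0 T ×ˢ univ)) (y₀ : H1 0 T n) {η : ℝ}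
    (hη : 0 < η) :
    ∀ᶠ y in 𝓝 y₀, ∀ t ∈ Icc 0 T, ‖Φ t (y.rep t) - Φ t (y₀.rep t)‖ ≤ η := by
  obtain ⟨C, hC0, hC⟩ := H1.exists_norm_rep_le hT n
  set K := Metric.closedBall (0 : Vec n) (C * (‖y₀‖ + 1)) with hK
  have huc := (isCompact_Icc.prod (isCompact_closedBall (0 : Vec n) (C * (‖y₀‖ + 1)))).uniformContinuousOn_of_continuous
    (hΦ.mono (prod_mono_right (subset_univ K)))
  obtain ⟨δ, hδ, hδ'⟩ := Metric.uniformContinuousOn_iff.mp huc η hη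
  have hball : Metric.ball y₀ (min 1 (δ / (C + 1))) ∈ 𝓝 y₀ :=
    Metric.ball_mem_nhds _ (by positivity)
  filter_upwards [hball] with y hy t ht
  rw [Metric.mem_ball, dist_eq_norm, lt_min_iff, lt_div_iff₀ (by positivity)] at hy
  have hyn : ‖y‖ ≤ ‖y₀‖ + 1 := by
    have := norm_sub_norm_le y y₀
    linarith [hy.1]
  have hmem : ∀ z : H1 0 T n, ‖z‖ ≤ ‖y₀‖ + 1 → z.rep t ∈ K := fun z hz => by
    rw [hK, mem_closedBall_zero_iff]
    exact (hC z t ht).trans (mul_le_mul_of_nonneg_left hz hC0)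
  rw [← dist_eq_norm]
  refine (hδ' (t, y.rep t) ⟨ht, hmem y hyn⟩ (t, y₀.rep t) ⟨ht, hmem y₀ (by linarith)⟩ ?_).le
  rw [Prod.dist_eq, dist_self, dist_eq_norm]
  refine max_lt hδ ?_
  change ‖y.rep t - y₀.rep t‖ < δ
  rw [← H1.rep_sub hT _ _ _ ht]
  refine (hC _ t ht).trans_lt (lt_of_le_of_lt ?_ hy.2)
  nlinarith [norm_nonneg (y - y₀)]

theorem continuousOn_comp_rep {F : Type*} [NormedAddCommGroup F] (hT : 0 < T) {Φ : ℝ → Vec n → F}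
    (hΦ : ContinuousOn (fun z : ℝ × Vec n => Φ z.1 z.2) (Icc 0 T ×ˢ univ)) (y : H1 0 T n) :
    ContinuousOn (fun t => Φ t (y.rep t)) (Icc 0 T) :=
  hΦ.comp (f := fun t => (t, y.rep t)) (continuousOn_id.prodMk (y.continuousOn_rep hT))
    fun _ ht => ⟨ht, mem_univ _⟩

/-- By the embedding of H¹ into the continuous functions, convergence in H¹ is uniform, and `Φ` is
uniformly continuous on the compact set containing all nearby trajectories. -/
theorem continuous_toL2_comp {F : Type*} [NormedAddCommGroup F] (hT : 0 < T) {Φ : ℝ → Vec n → F}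
    (hΦ : ContinuousOn (fun z : ℝ × Vec n => Φ z.1 z.2) (Icc 0 T ×ˢ univ)) :
    Continuous fun y : H1 0 T n => toL2 0 T (fun t => Φ t (y.rep t)) := by
  refine continuous_iff_continuousAt.mpr fun y₀ => Metric.tendsto_nhds.mpr fun η hη => ?_
  have hs : 0 ≤ √(T - 0) := Real.sqrt_nonneg _
  filter_upwards [exists_uniform_close hT hΦ y₀ (η := η / (√(T - 0) + 1)) (by positivity)]
    with y hy
  rw [dist_eq_norm, ← toL2_sub (continuousOn_comp_rep hT hΦ y).memLp_timeMeasure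
    (continuousOn_comp_rep hT hΦ y₀).memLp_timeMeasure]
  refine (norm_toL2_le (C := η / (√(T - 0) + 1)) hT.le (by positivity) ?_).trans_lt ?_
  · filter_upwards [ae_restrict_mem measurableSet_Ioo] with t ht
    exact hy t (Ioo_subset_Icc_self ht)
  · rw [mul_div_assoc', div_lt_iff₀ (by positivity)]
    nlinarith

end Near

/-! ### The ensemble of initial values -/

namespace ControlProblem

variable {n m : ℕ} (P : ControlProblem n m)

/-- A radius `r` by which the ball `B̄_{M̂}(0)` may be enlarged inside the interior of
`B̄_{2M̂}(0)`. -/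
theorem exists_margin {M : ℝ} (hM : 0 < M) :
    ∃ r : ℝ, 0 < r ∧
      Metric.closedBall (0 : Vec n) (M * embeddingNorm P.T n + r) ⊆ interior (P.stateBall M) := by
  rcases (embeddingNorm_nonneg P.T n).eq_or_lt with h0 | h0
  -- The embedding constant can vanish only if the state space is trivial, since constants are
  -- trajectories. Then the ball of radius zero is the whole space and has full interior.
  · have hsub : ∀ c : Vec n, c = 0 := by
      intro c
      obtain ⟨y, hy, -⟩ := H1.exists_of_memLp P.T_pos c (v := 0) MemLp.zero
      have := H1.norm_rep_le_embeddingNorm P.T_pos y (left_mem_Icc.mpr P.T_pos.le)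
      rwa [← h0, zero_mul, hy, norm_le_zero_iff] at this
    refine ⟨1, one_pos, fun x _ => ?_⟩
    have : P.stateBall M = univ := by
      refine eq_univ_of_forall fun z => ?_
      rw [hsub z, stateBall, ← h0]
      simp
    rw [this, interior_univ]
    exact mem_univ x
  · refine ⟨M * embeddingNorm P.T n / 2, by positivity, ?_⟩
    refine Subset.trans ?_ Metric.ball_subset_interior_closedBall
    refine Metric.closedBall_subset_ball ?_
    have : 0 < M * embeddingNorm P.T n := by positivity
    linarith

instance : IsProbabilityMeasure P.ensemble :=
  ProbabilityTheory.cond_isProbabilityMeasure_of_finite P.Y₀_pos.ne' P.Y₀_compact.measure_lt_top.ne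

variable {P}

theorem measurableSet_Y₀ : MeasurableSet P.Y₀ := P.Y₀_compact.isClosed.measurableSet

theorem ae_ensemble_of_forall {q : Vec n → Prop} (h : ∀ x ∈ P.Y₀, q x) : ∀ᵐ x ∂P.ensemble, q x := by
  filter_upwards [ProbabilityTheory.ae_cond_mem (measurableSet_Y₀ (P := P))] with x hx
  exact h x hx

theorem ae_ensemble_of_ae_restrict {q : Vec n → Prop} (h : ∀ᵐ x ∂(volume.restrict P.Y₀), q x) :
    ∀ᵐ x ∂P.ensemble, q x :=
  (Measure.absolutelyContinuous_of_le_smul le_rfl :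
    P.ensemble ≪ volume.restrict P.Y₀).ae_le h

theorem aestronglyMeasurable_of_continuousOn {F : Type*} [TopologicalSpace F]
    [TopologicalSpace.PseudoMetrizableSpace F] {φ : Vec n → F} (hφ : ContinuousOn φ P.Y₀) :
    AEStronglyMeasurable φ P.ensemble := by
  have h1 : AEStronglyMeasurable φ (volume.restrict P.Y₀) :=
    hφ.aestronglyMeasurable_of_isCompact P.Y₀_compact measurableSet_Y₀
  exact h1.smul_measure _

theorem memLp_of_continuousOn {F : Type*} [NormedAddCommGroup F] {φ : Vec n → F}
    (hφ : ContinuousOn φ P.Y₀) {q : ℝ≥0∞} : MemLp φ q P.ensemble := by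
  obtain ⟨C, hC⟩ := P.Y₀_compact.exists_bound_of_continuousOn hφ
  exact MemLp.of_bound (aestronglyMeasurable_of_continuousOn hφ) C (ae_ensemble_of_forall hC)

/-- `Y₀` is merely compact with positive measure, so `fderivWithin` might be an arbitrary choice at
some points. At almost every point it is determined, which suffices for the `W^{1,2}` norm. -/
theorem ae_ensemble_uniqueDiffWithinAt : ∀ᵐ x ∂P.ensemble, UniqueDiffWithinAt ℝ P.Y₀ x := by
  filter_upwards [ae_ensemble_of_ae_restrict (ae_uniqueDiffWithinAt volume P.Y₀),
    ae_ensemble_of_forall (P := P) (fun x hx => hx)] with x h1 h2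
  exact h1 h2

end ControlProblem

/-! ### The competitor: closed loop for the approximate value function -/

namespace ControlProblem

variable {n m : ℕ} {P : ControlProblem n m} {M r : ℝ} {ystar : Vec n → P.W}

/-- The closed ball of radius `M̂ + r`. -/
def innerBall (P : ControlProblem n m) (M r : ℝ) : Set (Vec n) :=
  Metric.closedBall 0 (M * embeddingNorm P.T n + r)

theorem isCompact_innerBall : IsCompact (P.innerBall M r) := isCompact_closedBall _ _

theorem convex_innerBall : Convex ℝ (P.innerBall M r) := convex_closedBall _ _

theorem closedBall_subset_innerBall {y : P.W} (hM : ‖y‖ ≤ M) {t : ℝ} (ht : t ∈ Icc 0 P.T) :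
    Metric.closedBall (y.rep t) r ⊆ P.innerBall M r := by
  refine Metric.closedBall_subset_closedBall' ?_
  rw [dist_zero_right, add_comm]
  have h1 := H1.norm_rep_le_embeddingNorm P.T_pos y ht
  have h2 := mul_le_mul_of_nonneg_left hM (embeddingNorm_nonneg P.T n)
  linarith

theorem OptimalFeedback.isTrajectory (hopt : P.OptimalFeedback M ystar) (hr : 0 ≤ r) {x : Vec n}
    (hx : x ∈ P.Y₀) :
    IsTrajectory P.T (P.innerBall M r) (P.closedLoop (P.valueGrad M)) (ystar x) :=
  ⟨fun _ ht => closedBall_subset_innerBall (hopt x hx).1.2 ht (Metric.mem_closedBall_self hr),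
    (hopt x hx).1.1.1⟩

theorem continuousOn_control {K : Set (Vec n)} {G : ℝ → Vec n → Vec n}
    (hG : ContinuousOn (fun z : ℝ × Vec n => P.feedback G z.1 z.2) (Icc 0 P.T ×ˢ K)) {y : P.W}
    (hy : ∀ t ∈ Icc 0 P.T, y.rep t ∈ K) : ContinuousOn (P.control G y) (Icc 0 P.T) :=
  hG.comp (f := fun t => (t, y.rep t)) (continuousOn_id.prodMk (y.continuousOn_rep P.T_pos))
    fun t ht => ⟨ht, hy t ht⟩

/-- The identity `∂_y V* = p` along the optimal ensemble. It is why the gradient penalty of the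
competitor is small. -/
theorem OptimalFeedback.exists_adjoint (hdyn : P.SmoothDynamics) (hval : P.SmoothValue M)
    (hopt : P.OptimalFeedback M ystar) (hr : 0 < r)
    (hint : P.innerBall M r ⊆ interior (P.stateBall M)) {x : Vec n} (hx : x ∈ P.Y₀) :
    ∃ p : P.W, P.IsAdjoint (ystar x) (P.control (P.valueGrad M) (ystar x)) p ∧
      ∀ t ∈ Ioo 0 P.T, p.rep t = P.valueGrad M t ((ystar x).rep t) := by
  have htr := hopt.isTrajectory hr.le hx
  have hu : ContinuousOn (P.control (P.valueGrad M) (ystar x)) (Icc 0 P.T) :=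
    continuousOn_control (hdyn.contDiffOn_feedback (by norm_num)
      hval.contDiffOn_valueGrad).continuousOn fun t ht => hint (htr.1 t ht)
  obtain ⟨p, hp⟩ := hdyn.exists_isAdjoint (ystar x) hu
  refine ⟨p, hp, fun t ht => ?_⟩
  have ht' := Ioo_subset_Icc_self ht
  have hmem := hint (htr.1 t ht')
  rw [valueGrad_of_mem_interior hmem]
  exact (hdyn.gradient_value_eq isCompact_innerBall convex_innerBall (hopt x hx).2.2 hu hp hr
    (fun s hs => closedBall_subset_innerBall (hopt x hx).1.2 hs) ⟨ht.1.le, ht.2⟩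
    (hval.hasFDerivAt_value ht' hmem).differentiableAt).symm

/-- The ensemble `(y, p)` follows the closed loop system for the feedback built from `v`, and is
`η`-close to the optimal ensemble. -/
structure IsNearOptimal (P : ControlProblem n m) (M r η : ℝ) (ystar : Vec n → P.W)
    (v : ℝ → Vec n → ℝ) (y p : Vec n → P.W) : Prop where
  initial : ∀ x ∈ P.Y₀, (y x).rep 0 = x
  trajectory : ∀ x ∈ P.Y₀,
    IsTrajectory P.T (P.innerBall M r) (P.closedLoop fun t => gradient (v t)) (y x)
  adjoint : ∀ x ∈ P.Y₀, P.IsAdjoint (y x) (P.control (fun t => gradient (v t)) (y x)) (p x)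
  norm_sub : ∀ x ∈ P.Y₀, ‖ystar x - y x‖ ≤ η
  control_sub : ∀ x ∈ P.Y₀, ∀ t ∈ Icc 0 P.T,
    ‖P.control (P.valueGrad M) (ystar x) t - P.control (fun t => gradient (v t)) (y x) t‖ ≤ η
  value_sub : ∀ x ∈ P.Y₀, ∀ t ∈ Icc 0 P.T,
    |v t ((y x).rep t) - P.value t ((ystar x).rep t)| ≤ η
  gradient_sub : ∀ x ∈ P.Y₀, ∀ t ∈ Ioo 0 P.T,
    ‖gradient (v t) ((y x).rep t) - (p x).rep t‖ ≤ η
  variation_sub : ∀ x ∈ P.Y₀, ∀ Z Z',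
    IsVariation P.T (fun t => fderiv ℝ (P.closedLoop (P.valueGrad M) t) ((ystar x).rep t)) Z →
    IsVariation P.T
      (fun t => fderiv ℝ (P.closedLoop (fun t => gradient (v t)) t) ((y x).rep t)) Z' →
    ‖Z - Z'‖ ≤ η

/-- The solutions exist because the perturbed field is uniformly close to the optimal one and
`innerBall` leaves a margin `r` around every optimal trajectory. Closeness of the rest follows from
`flow_stability` and `adjoint_stability`; `ε₁` does not depend on `x`. -/
theorem exists_isNearOptimal (hdyn : P.SmoothDynamics) (hval : P.SmoothValue M)
    (hopt : P.OptimalFeedback M ystar) (hr : 0 < r)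
    (hint : P.innerBall M r ⊆ interior (P.stateBall M))
    {R : ℝ → Type*} [∀ ε, NormedAddCommGroup (R ε)] [∀ ε, NormedSpace ℝ (R ε)]
    {V : ∀ ε, R ε → ℝ → Vec n → ℝ} {ε₀ : ℝ} {θ₀ : ∀ ε, R ε} (happ : P.ValueApproximation M ε₀ V θ₀)
    {η : ℝ} (hη : 0 < η) :
    ∃ ε₁ : ℝ, 0 < ε₁ ∧ ∀ ε ∈ Ioc 0 ε₀, ε ≤ ε₁ →
      ∃ y p : Vec n → P.W, P.IsNearOptimal M r η ystar (V ε (θ₀ ε)) y p := by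
  have hT := P.T_pos
  set K := P.innerBall M r with hKdef
  have hK : IsCompact K := isCompact_innerBall
  have hcv : Convex ℝ K := convex_innerBall
  have hU : IsOpen (interior (P.stateBall M)) := isOpen_interior
  set G₀ := P.valueGrad M with hG₀
  have cG : ContDiffOn ℝ 1 (fun z : ℝ × Vec n => G₀ z.1 z.2) (Icc 0 P.T ×ˢ interior (P.stateBall M)) :=
    hval.contDiffOn_valueGrad
  have fh : IsC1Field P.T K (P.closedLoop G₀) :=
    (hdyn.contDiffOn_closedLoop (by norm_num) cG).isC1Field hT hU hint
  have fF : IsC1Field P.T K (P.feedback G₀) :=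
    (hdyn.contDiffOn_feedback (by norm_num) cG).isC1Field hT hU hint
  have fG : IsC1Field P.T K G₀ := cG.isC1Field hT hU hint
  have fV : IsC1Field P.T K P.value :=
    ((hval.smooth.mono (prod_mono_right interior_subset)).of_le (by norm_num)).isC1Field hT hU hint
  obtain ⟨L, hL0, -, hL⟩ := fh.exists_lipschitz hK hcv
  obtain ⟨Lu, hLu0, -, hLu⟩ := fF.exists_lipschitz hK hcv
  obtain ⟨Lg, hLg0, -, hLg⟩ := fG.exists_lipschitz hK hcv
  obtain ⟨Lv, hLv0, -, hLv⟩ := fV.exists_lipschitz hK hcv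
  obtain ⟨Bu, hBu⟩ := (isCompact_Icc.prod hK).exists_bound_of_continuousOn fF.cont
  obtain ⟨Bg, hBg⟩ := (isCompact_Icc.prod hK).exists_bound_of_continuousOn fG.cont
  obtain ⟨Cc, hCc0, hCc⟩ := hdyn.closedLoop_close hK hU hint
  obtain ⟨c, hc0, hc⟩ := happ.bounds hval
  obtain ⟨Ca, hCa0, hCa⟩ := hdyn.adjoint_stability hK hcv (R := max Bu 0 + 1) (R' := max Bg 0)
    (by positivity) (by positivity)
  -- The constants of the final estimates: control, value, gradient, adjoint state. With `S μ = min
  -- 1 η`, all errors are at most `η`, and the perturbed controls exceed the optimal bound by at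
  -- most 1, as used for `Ca`.
  set S : ℝ := (1 + Lu) + (1 + Lv) + (1 + Lg) + Ca * (1 + Lu) with hS
  have hS0 : 0 < S := by positivity
  set μ : ℝ := min 1 η / S with hμ
  have hμ0 : 0 < μ := by positivity
  have hSμ : S * μ = min 1 η := by
    rw [hμ]
    field_simp
  have hCaμ : 0 ≤ Ca * (1 + Lu) * μ := by positivity
  have hLuμ : 0 ≤ Lu * μ := by positivity
  have hLvμ : 0 ≤ Lv * μ := by positivity
  have hLgμ : 0 ≤ Lg * μ := by positivity
  have hSη : S * μ ≤ η := hSμ.trans_le (min_le_right _ _)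
  have hS1 : S * μ ≤ 1 := hSμ.trans_le (min_le_left _ _)
  have hSexp : S * μ = (μ + Lu * μ) + (μ + Lv * μ) + (μ + Lg * μ) + Ca * (1 + Lu) * μ := by
    rw [hS]
    ring
  obtain ⟨δ, hδ0, hδ⟩ := flow_stability hT hK hcv fh hμ0
  set g := H1.gronwallConst P.T L with hg
  have hg0 : 0 ≤ g := H1.gronwallConst_nonneg hT.le hL0
  -- `δ` is for the stability of the flow, `μ` for the direct errors at a fixed state, and `r / (g +
  -- 1)` keeps the perturbed trajectory within the margin.
  set κ : ℝ := min (min δ μ) (r / (g + 1)) with hκ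
  have hκ0 : 0 < κ := by positivity
  have hκr : g * κ ≤ r := by
    have h1 : κ ≤ r / (g + 1) := min_le_right _ _
    rw [le_div_iff₀ (by positivity)] at h1
    nlinarith
  refine ⟨κ / ((Cc + 1) * c), by positivity, fun ε hε hε1 => ?_⟩
  set v := V ε (θ₀ ε) with hv
  set G : ℝ → Vec n → Vec n := fun t => gradient (v t) with hG
  have hεκ : (Cc + 1) * (c * ε) ≤ κ := by
    rw [le_div_iff₀ (by positivity)] at hε1
    linarith
  have hcε0 : 0 ≤ c * ε := mul_nonneg hc0.le hε.1.le
  have hcεκ : c * ε ≤ κ := by nlinarith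
  have hcεμ : c * ε ≤ μ := hcεκ.trans ((min_le_left _ _).trans (min_le_right _ _))
  have hCcκ : Cc * (c * ε) ≤ κ := by linarith
  have hCcδ : Cc * (c * ε) ≤ δ := hCcκ.trans ((min_le_left _ _).trans (min_le_left _ _))
  have hCcμ : Cc * (c * ε) ≤ μ := hCcκ.trans ((min_le_left _ _).trans (min_le_right _ _))
  have cG2 : ∀ {U : Set (Vec n)}, IsOpen U →
      ContDiffOn ℝ 2 (fun z : ℝ × Vec n => G z.1 z.2) (Icc 0 P.T ×ˢ U) := fun hU =>
    contDiffOn_gradient (happ.smooth ε hε) (θ₀ ε) hU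
  have hcl := hCc G₀ G cG ((cG2 hU).of_le (by norm_num)) (c * ε) hcε0
    (fun t ht x hx => by
      rw [norm_sub_rev]
      exact (hc ε hε t ht x (hint hx)).2.1)
    (fun t ht x hx => by
      rw [norm_sub_rev]
      exact (hc ε hε t ht x (hint hx)).2.2)
  have fh' : IsC1Field P.T K (P.closedLoop G) :=
    ((hdyn.contDiffOn_closedLoop le_rfl (cG2 hU)).of_le (by norm_num)).isC1Field hT hU hint
  have hFc : ContinuousOn (fun z : ℝ × Vec n => P.feedback G z.1 z.2) (Icc 0 P.T ×ˢ K) :=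
    (hdyn.contDiffOn_feedback le_rfl (cG2 hU)).continuousOn.mono (prod_mono_right hint)
  have hex : ∀ x, ∃ yp : P.W × P.W, x ∈ P.Y₀ → yp.1.rep 0 = x ∧
      IsTrajectory P.T K (P.closedLoop G) yp.1 ∧ P.IsAdjoint yp.1 (P.control G yp.1) yp.2 := by
    intro x
    by_cases hx : x ∈ P.Y₀
    · obtain ⟨y, hy0, hy⟩ := exists_trajectory_near hT hK hcv fh' hL0 hκ0.le hL hκr
        (fun t ht z hz => (hcl t ht z hz).1.trans hCcκ) (hopt.isTrajectory hr.le hx)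
        (fun t ht => closedBall_subset_innerBall (hopt x hx).1.2 ht)
      obtain ⟨p, hp⟩ := hdyn.exists_isAdjoint y (continuousOn_control hFc hy.1)
      exact ⟨(y, p), fun _ => ⟨by rw [hy0, (hopt x hx).1.1.2], hy, hp⟩⟩
    · exact ⟨(0, 0), fun h => absurd h hx⟩
  choose yp hyp using hex
  have hst : ∀ x (hx : x ∈ P.Y₀), _ := fun x hx => hδ (P.closedLoop G)
    (fun t ht z hz => (hcl t ht z hz).1.trans hCcδ) (fun t ht z hz => (hcl t ht z hz).2.1.trans hCcδ)
    (ystar x) (yp x).1 (hopt.isTrajectory hr.le hx) (hyp x hx).2.1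
    (by rw [(hopt x hx).1.1.2, (hyp x hx).1])
  have hμη : μ ≤ η := by linarith
  have hctl : ∀ x ∈ P.Y₀, ∀ t ∈ Icc 0 P.T,
      ‖P.control G₀ (ystar x) t - P.control G (yp x).1 t‖ ≤ (1 + Lu) * μ := by
    intro x hx t ht
    have m1 := (hopt.isTrajectory hr.le hx).1 t ht
    have m2 := (hyp x hx).2.1.1 t ht
    have e : P.control G₀ (ystar x) t - P.control G (yp x).1 t
        = (P.feedback G₀ t ((ystar x).rep t) - P.feedback G₀ t ((yp x).1.rep t))
          + (P.feedback G₀ t ((yp x).1.rep t) - P.feedback G t ((yp x).1.rep t)) := by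
      simp only [control]
      abel
    rw [e]
    refine (norm_add_le _ _).trans ?_
    have h1 := (hLu t ht _ m1 _ m2).trans (mul_le_mul_of_nonneg_left ((hst x hx).1 t ht) hLu0)
    have h2 := (hcl t ht _ m2).2.2.trans hCcμ
    linarith
  refine ⟨fun x => (yp x).1, fun x => (yp x).2, ?_⟩
  refine ⟨fun x hx => (hyp x hx).1, fun x hx => (hyp x hx).2.1, fun x hx => (hyp x hx).2.2,
    fun x hx => (hst x hx).2.1.trans hμη, fun x hx t ht => (hctl x hx t ht).trans (by linarith),
    fun x hx t ht => ?_, fun x hx t ht => ?_,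
    fun x hx Z Z' hZ hZ' => ((hst x hx).2.2 Z Z' hZ hZ').trans hμη⟩
  · have m1 := (hopt.isTrajectory hr.le hx).1 t ht
    have m2 := (hyp x hx).2.1.1 t ht
    have h1 := (hLv t ht _ m1 _ m2).trans (mul_le_mul_of_nonneg_left ((hst x hx).1 t ht) hLv0)
    have h2 := (hc ε hε t ht _ (hint m2)).1.trans hcεμ
    have e : v t ((yp x).1.rep t) - P.value t ((ystar x).rep t)
        = (v t ((yp x).1.rep t) - P.value t ((yp x).1.rep t))
          - (P.value t ((ystar x).rep t) - P.value t ((yp x).1.rep t)) := by ring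
    rw [e]
    refine (abs_sub _ _).trans ?_
    rw [Real.norm_eq_abs] at h1
    linarith
  · have ht' := Ioo_subset_Icc_self ht
    obtain ⟨p₀, hp₀, hp₀'⟩ := hopt.exists_adjoint hdyn hval hr hint hx
    have m1 := (hopt.isTrajectory hr.le hx).1 t ht'
    have m2 := (hyp x hx).2.1.1 t ht'
    have h1 := (hLg t ht' _ m1 _ m2).trans (mul_le_mul_of_nonneg_left ((hst x hx).1 t ht') hLg0)
    have h2 := (hc ε hε t ht' _ (hint m2)).2.1.trans hcεμ
    have h3 := (hCa (yp x).1 (ystar x) (yp x).2 p₀ (P.control G (yp x).1)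
      (P.control G₀ (ystar x)) ((1 + Lu) * μ) (by positivity) (fun s hs => by
        have k1 := (hopt.isTrajectory hr.le hx).1 s hs
        have k2 := (hyp x hx).2.1.1 s hs
        have k3 : ‖P.control G₀ (ystar x) s‖ ≤ max Bu 0 :=
          (hBu (s, (ystar x).rep s) ⟨hs, k1⟩).trans (le_max_left _ _)
        have k4 := hctl x hx s hs
        rw [norm_sub_rev] at k4
        have k5 := norm_sub_norm_le (P.control G (yp x).1 s) (P.control G₀ (ystar x) s)
        have k6 := (hst x hx).1 s hs
        rw [norm_sub_rev] at k6
        exact ⟨k2, k1, by linarith, by linarith, by linarith, k4⟩)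
      (fun s hs => by
        rw [hp₀' s hs]
        exact (hBg (s, (ystar x).rep s) ⟨Ioo_subset_Icc_self hs,
          (hopt.isTrajectory hr.le hx).1 s (Ioo_subset_Icc_self hs)⟩).trans (le_max_left _ _))
      (hyp x hx).2.2 hp₀).1 t ht'
    rw [hp₀' t ht] at h3
    -- Three errors: approximate against exact gradient at the perturbed state, exact gradient at
    -- the two states, and perturbed adjoint against `p₀ = ∂_y V*`.
    have e : gradient (v t) ((yp x).1.rep t) - (yp x).2.rep t
        = (G t ((yp x).1.rep t) - G₀ t ((yp x).1.rep t))
          - (G₀ t ((ystar x).rep t) - G₀ t ((yp x).1.rep t))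
          - ((yp x).2.rep t - G₀ t ((ystar x).rep t)) := by
      simp only [hG]
      abel
    rw [e]
    refine (norm_sub_le _ _).trans ?_
    have h4 := norm_sub_le (G t ((yp x).1.rep t) - G₀ t ((yp x).1.rep t))
      (G₀ t ((ystar x).rep t) - G₀ t ((yp x).1.rep t))
    have h2' : ‖G t ((yp x).1.rep t) - G₀ t ((yp x).1.rep t)‖ ≤ μ := h2
    linarith

end ControlProblem

/-! ### Continuity of the cost to go and of the augmented cost -/

namespace ControlProblem

variable {n m : ℕ} {P : ControlProblem n m}

theorem continuousOn_cost {y : ℝ → Vec n} {u : ℝ → Vec m} (hy : MemLp y 2 (timeMeasure 0 P.T))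
    (hu : MemLp u 2 (timeMeasure 0 P.T)) : ContinuousOn (fun t => P.cost t y u) (Icc 0 P.T) := by
  have hT := P.T_pos.le
  have hi : IntervalIntegrable (fun s => ‖P.Q₁ (y s - P.yd s)‖ ^ 2 + P.β * ‖u s‖ ^ 2) volume 0 P.T :=
    (intervalIntegrable_iff_timeMeasure hT _).mpr (integrable_runningCost le_rfl hy hu)
  have h1 := intervalIntegral.continuousOn_primitive_interval' hi left_mem_uIcc
  rw [uIcc_of_le hT] at h1
  refine (continuousOn_const (c := P.cost 0 y u)).sub
    ((continuousOn_const (c := (1 / 2 : ℝ))).mul h1) |>.congr fun t ht => ?_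
  change P.cost t y u = P.cost 0 y u - 1 / 2 * _
  rw [cost_eq_add ht hy hu]
  ring

theorem memLp_cost (y : P.W) {u : ℝ → Vec m} (hu : MemLp u 2 (timeMeasure 0 P.T)) :
    MemLp (fun t => P.cost t y.rep u) 2 (timeMeasure 0 P.T) :=
  (continuousOn_cost (y.memLp_rep P.T_pos) hu).memLp_timeMeasure

/-- The cost to go along a state and a control, as an element of `L²(0, T)`. -/
def costL2 (P : ControlProblem n m) (z : P.W × L2 0 P.T (Vec m)) : L2 0 P.T ℝ :=
  toL2 0 P.T fun t => P.cost t z.1.rep z.2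

/-- The cost sees the control only through its L² class. This makes the cost to go a continuous
function on `W_T × L²`, and measurability in `x` comes by composition. -/
theorem costL2_toL2 (y : P.W) {u : ℝ → Vec m} (hu : MemLp u 2 (timeMeasure 0 P.T)) :
    P.costL2 (y, toL2 0 P.T u) = toL2 0 P.T fun t => P.cost t y.rep u := by
  refine toL2_congr ?_
  filter_upwards [ae_restrict_mem measurableSet_Ioo] with t ht
  have h := coeFn_toL2 hu
  exact cost_congr ht.2.le (fun _ _ => rfl)
    (ae_mono (Measure.restrict_mono (Ioo_subset_Ioo_left ht.1.le) le_rfl) h)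

theorem toL2_coe {F : Type*} [NormedAddCommGroup F] {a b : ℝ} (u : L2 a b F) :
    toL2 a b (u : ℝ → F) = u := by
  rw [toL2_of_memLp (Lp.memLp u), Lp.toLp_coeFn]

/-- Local Lipschitz bounds for the cost to go. -/
theorem exists_costL2_lipschitz (P : ControlProblem n m) {R : ℝ} (hR : 0 ≤ R) :
    ∃ C : ℝ, 0 ≤ C ∧ ∀ z z' : P.W × L2 0 P.T (Vec m), ‖z‖ ≤ R → ‖z'‖ ≤ R →
      ‖P.costL2 z - P.costL2 z'‖ ≤ C * (‖z.1 - z'.1‖ + ‖z.2 - z'.2‖) ∧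
      |P.cost 0 z.1.rep z.2 - P.cost 0 z'.1.rep z'.2|
        ≤ C * (‖z.1 - z'.1‖ + ‖z.2 - z'.2‖) := by
  obtain ⟨C, hC0, hC⟩ := P.exists_cost_lipschitz hR
  refine ⟨(√(P.T - 0) + 1) * C, by positivity, fun z z' hz hz' => ?_⟩
  have key : ∀ t ∈ Icc 0 P.T, |P.cost t z.1.rep z.2 - P.cost t z'.1.rep z'.2|
      ≤ C * (‖z.1 - z'.1‖ + ‖z.2 - z'.2‖) := fun t ht => by
    have := hC t ht z.1 z'.1 z.2 z'.2 (Lp.memLp _) (Lp.memLp _) ((norm_fst_le z).trans hz)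
      ((norm_fst_le z').trans hz') (by rw [toL2_coe]; exact (norm_snd_le z).trans hz)
      (by rw [toL2_coe]; exact (norm_snd_le z').trans hz')
    rwa [toL2_coe, toL2_coe] at this
  have hD : 0 ≤ C * (‖z.1 - z'.1‖ + ‖z.2 - z'.2‖) := by positivity
  have hs := Real.sqrt_nonneg (P.T - 0)
  constructor
  · rw [costL2, costL2, ← toL2_sub (memLp_cost _ (Lp.memLp _)) (memLp_cost _ (Lp.memLp _))]
    refine (norm_toL2_le P.T_pos.le hD ?_).trans ?_
    · filter_upwards [ae_restrict_mem measurableSet_Ioo] with t ht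
      exact key t (Ioo_subset_Icc_self ht)
    · nlinarith
  · refine (key 0 (left_mem_Icc.mpr P.T_pos.le)).trans ?_
    nlinarith [mul_nonneg hs hD]

theorem continuous_of_lipschitz_on_balls {E F G : Type*} [NormedAddCommGroup E]
    [NormedAddCommGroup F] [NormedAddCommGroup G] {φ : E × F → G}
    (h : ∀ R : ℝ, 0 ≤ R → ∃ C : ℝ, ∀ z z' : E × F, ‖z‖ ≤ R → ‖z'‖ ≤ R →
      ‖φ z - φ z'‖ ≤ C * (‖z.1 - z'.1‖ + ‖z.2 - z'.2‖)) : Continuous φ := by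
  refine continuous_iff_continuousAt.mpr fun z₀ => ?_
  obtain ⟨C, hC⟩ := h (‖z₀‖ + 1) (by positivity)
  rw [ContinuousAt, tendsto_iff_norm_sub_tendsto_zero]
  have hlim : Tendsto (fun z : E × F => C * (‖z.1 - z₀.1‖ + ‖z.2 - z₀.2‖)) (𝓝 z₀) (𝓝 0) := by
    have : Continuous fun z : E × F => C * (‖z.1 - z₀.1‖ + ‖z.2 - z₀.2‖) := by fun_prop
    simpa using this.tendsto z₀
  refine squeeze_zero' (Eventually.of_forall fun _ => norm_nonneg _) ?_ hlim
  have hev : ∀ᶠ z in 𝓝 z₀, ‖z‖ < ‖z₀‖ + 1 :=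
    continuous_norm.continuousAt.eventually_lt continuousAt_const (lt_add_one _)
  filter_upwards [hev] with z hz
  exact hC z z₀ hz.le (by linarith)

theorem continuous_costL2 : Continuous P.costL2 := by
  refine continuous_of_lipschitz_on_balls fun R hR => ?_
  obtain ⟨C, -, hC⟩ := P.exists_costL2_lipschitz hR
  exact ⟨C, fun z z' hz hz' => (hC z z' hz hz').1⟩

theorem continuous_cost_zero :
    Continuous fun z : P.W × L2 0 P.T (Vec m) => P.cost 0 z.1.rep z.2 := by
  refine continuous_of_lipschitz_on_balls fun R hR => ?_
  obtain ⟨C, -, hC⟩ := P.exists_costL2_lipschitz hR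
  exact ⟨C, fun z z' hz hz' => (hC z z' hz hz').2⟩

/-! ### The augmented cost of a smooth function -/

/-- The defect of `w` as a cost to go along the closed loop. -/
def valueError (P : ControlProblem n m) (w : ℝ → Vec n → ℝ) (y : P.W) (t : ℝ) : ℝ :=
  w t (y.rep t) - P.cost t y.rep (P.control (fun s => gradient (w s)) y)

/-- The defect of the gradient of `w` as an adjoint state. -/
def gradError (P : ControlProblem n m) (w : ℝ → Vec n → ℝ) (y p : P.W) (t : ℝ) : Vec n :=
  gradient (w t) (y.rep t) - p.rep t

section Smooth

variable {w : ℝ → Vec n → ℝ}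

theorem contDiffOn_gradient_of_contDiff (P : ControlProblem n m)
    (hw : ContDiff ℝ 4 (fun z : ℝ × Vec n => w z.1 z.2)) {U : Set (Vec n)} (hU : IsOpen U) :
    ContDiffOn ℝ 2 (fun z : ℝ × Vec n => gradient (w z.1) z.2) (Icc 0 P.T ×ˢ U) :=
  ContDiffOn.gradient_slice P.T_pos hU (hw.contDiffOn.of_le (by norm_num))

theorem SmoothDynamics.continuousOn_feedback (hdyn : P.SmoothDynamics)
    (hw : ContDiff ℝ 4 (fun z : ℝ × Vec n => w z.1 z.2)) :
    ContinuousOn (fun z : ℝ × Vec n => P.feedback (fun t => gradient (w t)) z.1 z.2)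
      (Icc 0 P.T ×ˢ univ) :=
  (hdyn.contDiffOn_feedback le_rfl
    (contDiffOn_gradient_of_contDiff P hw isOpen_univ)).continuousOn

theorem SmoothDynamics.continuousOn_control (hdyn : P.SmoothDynamics)
    (hw : ContDiff ℝ 4 (fun z : ℝ × Vec n => w z.1 z.2)) (y : P.W) :
    ContinuousOn (P.control (fun t => gradient (w t)) y) (Icc 0 P.T) :=
  ControlProblem.continuousOn_control (hdyn.continuousOn_feedback hw) fun _ _ => mem_univ _

theorem SmoothDynamics.memLp_control (hdyn : P.SmoothDynamics)
    (hw : ContDiff ℝ 4 (fun z : ℝ × Vec n => w z.1 z.2)) (y : P.W) {q : ℝ≥0∞} :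
    MemLp (P.control (fun t => gradient (w t)) y) q (timeMeasure 0 P.T) :=
  (hdyn.continuousOn_control hw y).memLp_timeMeasure

theorem SmoothDynamics.continuous_toL2_control (hdyn : P.SmoothDynamics)
    (hw : ContDiff ℝ 4 (fun z : ℝ × Vec n => w z.1 z.2)) :
    Continuous fun y : P.W => toL2 0 P.T (P.control (fun t => gradient (w t)) y) :=
  continuous_toL2_comp P.T_pos (hdyn.continuousOn_feedback hw)

theorem memLp_value_comp (P : ControlProblem n m)
    (hw : ContDiff ℝ 4 (fun z : ℝ × Vec n => w z.1 z.2)) (y : P.W) :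
    MemLp (fun t => w t (y.rep t)) 2 (timeMeasure 0 P.T) :=
  (continuousOn_comp_rep P.T_pos hw.continuous.continuousOn y).memLp_timeMeasure

theorem memLp_gradient_comp (P : ControlProblem n m)
    (hw : ContDiff ℝ 4 (fun z : ℝ × Vec n => w z.1 z.2)) (y : P.W) :
    MemLp (fun t => gradient (w t) (y.rep t)) 2 (timeMeasure 0 P.T) :=
  (continuousOn_comp_rep P.T_pos (Φ := fun t => gradient (w t))
    (contDiffOn_gradient_of_contDiff P hw isOpen_univ).continuousOn y).memLp_timeMeasure

theorem continuous_toL2_value (P : ControlProblem n m)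
    (hw : ContDiff ℝ 4 (fun z : ℝ × Vec n => w z.1 z.2)) :
    Continuous fun y : P.W => toL2 0 P.T fun t => w t (y.rep t) :=
  continuous_toL2_comp P.T_pos hw.continuous.continuousOn

theorem continuous_toL2_gradient (P : ControlProblem n m)
    (hw : ContDiff ℝ 4 (fun z : ℝ × Vec n => w z.1 z.2)) :
    Continuous fun y : P.W => toL2 0 P.T fun t => gradient (w t) (y.rep t) :=
  continuous_toL2_comp P.T_pos (Φ := fun t => gradient (w t))
    (contDiffOn_gradient_of_contDiff P hw isOpen_univ).continuousOn

theorem SmoothDynamics.memLp_valueError (hdyn : P.SmoothDynamics)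
    (hw : ContDiff ℝ 4 (fun z : ℝ × Vec n => w z.1 z.2)) (y : P.W) :
    MemLp (P.valueError w y) 2 (timeMeasure 0 P.T) :=
  (memLp_value_comp P hw y).sub (memLp_cost y (hdyn.memLp_control hw y))

theorem memLp_gradError (hw : ContDiff ℝ 4 (fun z : ℝ × Vec n => w z.1 z.2)) (y p : P.W) :
    MemLp (P.gradError w y p) 2 (timeMeasure 0 P.T) :=
  (memLp_gradient_comp P hw y).sub (p.memLp_rep P.T_pos)

theorem SmoothDynamics.toL2_valueError (hdyn : P.SmoothDynamics)
    (hw : ContDiff ℝ 4 (fun z : ℝ × Vec n => w z.1 z.2)) (y : P.W) :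
    toL2 0 P.T (P.valueError w y) = toL2 0 P.T (fun t => w t (y.rep t))
      - P.costL2 (y, toL2 0 P.T (P.control (fun t => gradient (w t)) y)) := by
  rw [costL2_toL2 y (hdyn.memLp_control hw y), ← toL2_sub (memLp_value_comp P hw y)
    (memLp_cost y (hdyn.memLp_control hw y))]
  rfl

theorem toL2_gradError (hw : ContDiff ℝ 4 (fun z : ℝ × Vec n => w z.1 z.2)) (y p : P.W) :
    toL2 0 P.T (P.gradError w y p)
      = toL2 0 P.T (fun t => gradient (w t) (y.rep t)) - p.1.fst := by
  rw [← p.toL2_rep P.T_pos, ← toL2_sub (memLp_gradient_comp P hw y) (p.memLp_rep P.T_pos)]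
  rfl

theorem SmoothDynamics.continuous_toL2_valueError (hdyn : P.SmoothDynamics)
    (hw : ContDiff ℝ 4 (fun z : ℝ × Vec n => w z.1 z.2)) :
    Continuous fun y : P.W => toL2 0 P.T (P.valueError w y) := by
  simp only [hdyn.toL2_valueError hw]
  exact (continuous_toL2_value P hw).sub
    (continuous_costL2.comp (continuous_id.prodMk (hdyn.continuous_toL2_control hw)))

theorem continuous_fst_H1 {a b : ℝ} : Continuous fun y : H1 a b n => y.1.fst :=
  (LipschitzWith.of_dist_le_mul (K := 1) fun y z => by
    rw [dist_eq_norm, dist_eq_norm, NNReal.coe_one, one_mul]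
    exact (y - z).norm_fst_le).continuous

theorem continuous_toL2_gradError (hw : ContDiff ℝ 4 (fun z : ℝ × Vec n => w z.1 z.2)) :
    Continuous fun z : P.W × P.W => toL2 0 P.T (P.gradError w z.1 z.2) := by
  simp only [toL2_gradError hw]
  exact ((continuous_toL2_gradient P hw).comp continuous_fst).sub
    (continuous_fst_H1.comp continuous_snd)

theorem SmoothDynamics.cost_control (hdyn : P.SmoothDynamics)
    (hw : ContDiff ℝ 4 (fun z : ℝ × Vec n => w z.1 z.2)) (y : P.W) :
    P.cost 0 y.rep (P.control (fun t => gradient (w t)) y)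
      = P.cost 0 y.rep (toL2 0 P.T (P.control (fun t => gradient (w t)) y)) :=
  cost_congr P.T_pos.le (fun _ _ => rfl) (coeFn_toL2 (hdyn.memLp_control hw y)).symm

theorem SmoothDynamics.continuous_cost_control (hdyn : P.SmoothDynamics)
    (hw : ContDiff ℝ 4 (fun z : ℝ × Vec n => w z.1 z.2)) :
    Continuous fun y : P.W => P.cost 0 y.rep (P.control (fun t => gradient (w t)) y) := by
  have h1 : Continuous fun y : P.W =>
      (y, toL2 0 P.T (P.control (fun t => gradient (w t)) y)) :=
    continuous_id.prodMk (hdyn.continuous_toL2_control hw)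
  exact (continuous_cost_zero.comp h1).congr fun y => (hdyn.cost_control hw y).symm

/-- With the penalties written as squared L² norms, continuity in `(y, p)` and domination by the
excess can be read off. -/
theorem SmoothDynamics.augmentedCost_eq (hdyn : P.SmoothDynamics)
    (hw : ContDiff ℝ 4 (fun z : ℝ × Vec n => w z.1 z.2)) (y p : P.W) :
    P.augmentedCost w y p = P.cost 0 y.rep (P.control (fun t => gradient (w t)) y)
      + (P.γ₁ / 2 * ‖toL2 0 P.T (P.valueError w y)‖ ^ 2
        + P.γ₂ / 2 * ‖toL2 0 P.T (P.gradError w y p)‖ ^ 2) := by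
  have h1 := hdyn.memLp_valueError hw y
  have h2 := memLp_gradError hw y p
  rw [← integral_norm_sq_eq h1, ← integral_norm_sq_eq h2, ← integral_const_mul,
    ← integral_const_mul, ← integral_add ((integrable_norm_sq h1).const_mul _)
    ((integrable_norm_sq h2).const_mul _), integral_timeMeasure P.T_pos.le]
  rfl

theorem SmoothDynamics.continuous_augmentedCost (hdyn : P.SmoothDynamics)
    (hw : ContDiff ℝ 4 (fun z : ℝ × Vec n => w z.1 z.2)) :
    Continuous fun z : P.W × P.W => P.augmentedCost w z.1 z.2 := by
  simp only [hdyn.augmentedCost_eq hw]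
  have h1 := (hdyn.continuous_cost_control hw).comp (continuous_fst (X := P.W) (Y := P.W))
  have h2 := ((hdyn.continuous_toL2_valueError hw).comp (continuous_fst (X := P.W) (Y := P.W))).norm
  have h3 := (continuous_toL2_gradError (P := P) hw).norm
  exact h1.add (((h2.pow 2).const_mul _).add ((h3.pow 2).const_mul _))

end Smooth

end ControlProblem

theorem enorm_sq_le_of_norm_sub_le {E : Type*} [NormedAddCommGroup E] {a b : E} {η : ℝ}
    (h : ‖a - b‖ ≤ η) : ‖b‖ₑ ^ 2 ≤ 2 * ‖a‖ₑ ^ 2 + ENNReal.ofReal (2 * η ^ 2) := by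
  have hη : 0 ≤ η := (norm_nonneg _).trans h
  have h1 : ‖b‖ ≤ ‖a‖ + η := by
    have := norm_sub_norm_le b a
    rw [norm_sub_rev] at this
    linarith
  have h2 : ‖b‖ ^ 2 ≤ 2 * ‖a‖ ^ 2 + 2 * η ^ 2 := by
    nlinarith [norm_nonneg b, norm_nonneg a, sq_nonneg (‖a‖ - η)]
  have e : ∀ c : E, ‖c‖ₑ ^ 2 = ENNReal.ofReal (‖c‖ ^ 2) := fun c => by
    rw [ENNReal.ofReal_pow (norm_nonneg _), ofReal_norm]
  have e2 : (2 : ℝ≥0∞) = ENNReal.ofReal 2 := by simp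
  rw [e, e, e2, ← ENNReal.ofReal_mul two_pos.le, ← ENNReal.ofReal_add (by positivity) (by positivity)]
  exact ENNReal.ofReal_le_ofReal h2

/-! ### Admissibility and cost of the competitor -/

namespace ControlProblem

variable {n m : ℕ} {P : ControlProblem n m} {M r η : ℝ} {ystar : Vec n → P.W}
  {w : ℝ → Vec n → ℝ} {y p : Vec n → P.W}

theorem isC1Field_closedLoop (hdyn : P.SmoothDynamics)
    (hw : ContDiff ℝ 4 (fun z : ℝ × Vec n => w z.1 z.2)) (K : Set (Vec n)) :
    IsC1Field P.T K (P.closedLoop fun t => gradient (w t)) :=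
  ((hdyn.contDiffOn_closedLoop le_rfl
    (contDiffOn_gradient_of_contDiff P hw isOpen_univ)).of_le (by norm_num)).isC1Field P.T_pos
    isOpen_univ (subset_univ K)

theorem IsNearOptimal.contDiffOn (h : P.IsNearOptimal M r η ystar w y p) (hdyn : P.SmoothDynamics)
    (hw : ContDiff ℝ 4 (fun z : ℝ × Vec n => w z.1 z.2)) : ContDiffOn ℝ 1 y P.Y₀ :=
  contDiffOn_flow P.T_pos isCompact_innerBall convex_innerBall (isC1Field_closedLoop hdyn hw _)
    fun x hx => ⟨h.initial x hx, h.trajectory x hx⟩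

theorem IsNearOptimal.norm_fderivWithin_sub (h : P.IsNearOptimal M r η ystar w y p)
    (hdyn : P.SmoothDynamics) (hw : ContDiff ℝ 4 (fun z : ℝ × Vec n => w z.1 z.2))
    (hval : P.SmoothValue M) (hopt : P.OptimalFeedback M ystar) (hr : 0 ≤ r)
    (hint : P.innerBall M r ⊆ interior (P.stateBall M)) {x : Vec n} (hx : x ∈ P.Y₀)
    (hu : UniqueDiffWithinAt ℝ P.Y₀ x) :
    ‖fderivWithin ℝ ystar P.Y₀ x - fderivWithin ℝ y P.Y₀ x‖ ≤ η := by
  have hT := P.T_pos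
  have fh : IsC1Field P.T (P.innerBall M r) (P.closedLoop (P.valueGrad M)) :=
    (hdyn.contDiffOn_closedLoop (by norm_num) hval.contDiffOn_valueGrad).isC1Field hT
      isOpen_interior hint
  have fh' := isC1Field_closedLoop hdyn hw (P.innerBall M r)
  have hs := hopt.isTrajectory hr hx
  obtain ⟨Z, hZ⟩ := exists_isVariation hT (fh.continuousOn_fderiv_rep hT hs.1)
  obtain ⟨Z', hZ'⟩ := exists_isVariation hT (fh'.continuousOn_fderiv_rep hT (h.trajectory x hx).1)
  rw [(hasFDerivWithinAt_flow hT isCompact_innerBall convex_innerBall fh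
      (fun x hx => ⟨(hopt x hx).1.1.2, hopt.isTrajectory hr hx⟩) hx hZ).fderivWithin hu,
    (hasFDerivWithinAt_flow hT isCompact_innerBall convex_innerBall fh'
      (fun x hx => ⟨h.initial x hx, h.trajectory x hx⟩) hx hZ').fderivWithin hu]
  exact h.variation_sub x hx Z Z' hZ hZ'

/-- Each squared term is at most twice the optimal one plus `2 η²`, and there are `n + 1` terms. The
total `2 MW² + 2 (n + 1) η²` fits under `(2 MW)²`. -/
theorem IsNearOptimal.w12Norm_le (h : P.IsNearOptimal M r η ystar w y p)
    (hdyn : P.SmoothDynamics) (hw : ContDiff ℝ 4 (fun z : ℝ × Vec n => w z.1 z.2))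
    (hval : P.SmoothValue M) (hopt : P.OptimalFeedback M ystar) (hr : 0 ≤ r)
    (hint : P.innerBall M r ⊆ interior (P.stateBall M)) {MW : ℝ} (hMW : 0 < MW)
    (hW : P.w12Norm ystar ≤ ENNReal.ofReal MW) (hη : (n + 1) * η ^ 2 ≤ MW ^ 2) :
    P.w12Norm y ≤ ENNReal.ofReal (2 * MW) := by
  set c := ENNReal.ofReal (2 * η ^ 2) with hc
  set I : Vec n → ℝ≥0∞ := fun x => ‖ystar x‖ₑ ^ 2
    + ∑ i : Fin n, ‖fderivWithin ℝ ystar P.Y₀ x (EuclideanSpace.single i 1)‖ₑ ^ 2 with hI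
  have hle : ∀ᵐ x ∂P.ensemble, (‖y x‖ₑ ^ 2
      + ∑ i : Fin n, ‖fderivWithin ℝ y P.Y₀ x (EuclideanSpace.single i 1)‖ₑ ^ 2)
      ≤ 2 * I x + (n + 1) * c := by
    filter_upwards [ae_ensemble_uniqueDiffWithinAt (P := P),
      ae_ensemble_of_forall (P := P) (fun x hx => hx)] with x hu hx
    have h1 := enorm_sq_le_of_norm_sub_le (h.norm_sub x hx)
    have h2 : ∀ i : Fin n, ‖fderivWithin ℝ y P.Y₀ x (EuclideanSpace.single i 1)‖ₑ ^ 2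
        ≤ 2 * ‖fderivWithin ℝ ystar P.Y₀ x (EuclideanSpace.single i 1)‖ₑ ^ 2 + c := fun i => by
      refine enorm_sq_le_of_norm_sub_le ?_
      rw [← sub_apply]
      refine (ContinuousLinearMap.le_opNorm _ _).trans ?_
      rw [PiLp.norm_single, norm_one, mul_one]
      exact h.norm_fderivWithin_sub hdyn hw hval hopt hr hint hx hu
    refine (add_le_add h1 (Finset.sum_le_sum fun i _ => h2 i)).trans (le_of_eq ?_)
    rw [Finset.sum_add_distrib, ← Finset.mul_sum, Finset.sum_const, Finset.card_univ,
      Fintype.card_fin, nsmul_eq_mul, hI]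
    ring
  have hstar : ∫⁻ x, I x ∂P.ensemble ≤ ENNReal.ofReal (MW ^ 2) := by
    have h1 := ENNReal.rpow_le_rpow hW two_pos.le
    rw [w12Norm, ← ENNReal.rpow_mul, ENNReal.ofReal_rpow_of_pos hMW] at h1
    norm_num at h1
    exact h1
  have htot : ∫⁻ x, (‖y x‖ₑ ^ 2
      + ∑ i : Fin n, ‖fderivWithin ℝ y P.Y₀ x (EuclideanSpace.single i 1)‖ₑ ^ 2) ∂P.ensemble
      ≤ ENNReal.ofReal ((2 * MW) ^ 2) := by
    refine (lintegral_mono_ae hle).trans ?_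
    -- Only the constant summand has to be measurable, and pulling out the finite factor 2 needs no
    -- measurability; none is known here for the derivatives in `x`.
    rw [lintegral_add_right _ measurable_const, lintegral_const_mul' _ _ ENNReal.ofNat_ne_top,
      lintegral_const, measure_univ, mul_one]
    have e2 : (2 : ℝ≥0∞) = ENNReal.ofReal 2 := by simp
    have en : ((n : ℝ≥0∞) + 1) = ENNReal.ofReal (n + 1) := by
      rw [ENNReal.ofReal_add (by positivity) zero_le_one]
      simp
    refine (add_le_add_left (mul_le_mul_right hstar 2) _).trans ?_
    rw [e2, en, hc, ← ENNReal.ofReal_mul (by norm_num), ← ENNReal.ofReal_mul (by positivity),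
      ← ENNReal.ofReal_add (by positivity) (by positivity)]
    refine ENNReal.ofReal_le_ofReal ?_
    nlinarith
  refine (ENNReal.rpow_le_rpow htot (by norm_num)).trans (le_of_eq ?_)
  rw [ENNReal.ofReal_rpow_of_nonneg (by positivity) (by norm_num), ← Real.sqrt_eq_rpow,
    Real.sqrt_sq (by positivity)]

/-- States and feedback controls depend continuously on `x`, uniformly in time; stability of the
adjoint equation around the fixed `p x₀` carries this over to `p`. -/
theorem IsNearOptimal.continuousOn_adjoint (h : P.IsNearOptimal M r η ystar w y p)
    (hdyn : P.SmoothDynamics) (hw : ContDiff ℝ 4 (fun z : ℝ × Vec n => w z.1 z.2)) :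
    ContinuousOn p P.Y₀ := by
  have hT := P.T_pos
  have hyc := (h.contDiffOn hdyn hw).continuousOn
  have hF := hdyn.continuousOn_feedback hw
  obtain ⟨B, hB⟩ := (isCompact_Icc.prod (isCompact_innerBall (P := P) (M := M) (r := r))).exists_bound_of_continuousOn
    (hF.mono (prod_mono_right (subset_univ _)))
  obtain ⟨E, hE0, hE⟩ := H1.exists_norm_rep_le hT n
  intro x₀ hx₀
  obtain ⟨C, hC0, hC⟩ := hdyn.adjoint_stability (isCompact_innerBall (P := P) (M := M) (r := r))
    convex_innerBall (R := max B 0) (R' := E * ‖p x₀‖) (by positivity) (by positivity)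
  refine Metric.tendsto_nhds.mpr fun c hc => ?_
  have hη' : 0 < c / (C + 1) := by positivity
  have hid : ContinuousOn (fun z : ℝ × Vec n => z.2)
      (Icc 0 P.T ×ˢ univ) := continuous_snd.continuousOn
  filter_upwards [hyc x₀ hx₀ (exists_uniform_close hT (Φ := fun _ x => x) hid (y x₀) hη'),
    hyc x₀ hx₀ (exists_uniform_close hT hF (y x₀) hη'), self_mem_nhdsWithin] with x h1 h2 hx
  have hb : ∀ x ∈ P.Y₀, ∀ t ∈ Icc 0 P.T,
      ‖P.control (fun t => gradient (w t)) (y x) t‖ ≤ max B 0 := fun x hx t ht =>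
    (hB (t, (y x).rep t) ⟨ht, (h.trajectory x hx).1 t ht⟩).trans (le_max_left _ _)
  have key := (hC (y x) (y x₀) (p x) (p x₀) _ _ (c / (C + 1)) hη'.le
    (fun t ht => ⟨(h.trajectory x hx).1 t ht, (h.trajectory x₀ hx₀).1 t ht, hb x hx t ht,
      hb x₀ hx₀ t ht, h1 t ht, h2 t ht⟩)
    (fun t ht => hE _ t (Ioo_subset_Icc_self ht)) (h.adjoint x hx) (h.adjoint x₀ hx₀)).2
  rw [dist_eq_norm]
  refine key.trans_lt ?_
  rw [mul_div_assoc', div_lt_iff₀ (by positivity)]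
  nlinarith

theorem memEnsemble_of_continuousOn {F : Type*} [NormedAddCommGroup F] {q : ℝ≥0∞}
    {φ : Vec n → ℝ → F} (h1 : ∀ x ∈ P.Y₀, MemLp (φ x) 2 (timeMeasure 0 P.T))
    (h2 : ContinuousOn (P.ensembleClass φ) P.Y₀) : P.MemEnsemble q φ :=
  ⟨ae_ensemble_of_forall h1, memLp_of_continuousOn h2⟩

theorem IsNearOptimal.norm_toL2_control_sub (h : P.IsNearOptimal M r η ystar w y p)
    (hdyn : P.SmoothDynamics) (hw : ContDiff ℝ 4 (fun z : ℝ × Vec n => w z.1 z.2))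
    (hval : P.SmoothValue M) (hopt : P.OptimalFeedback M ystar) (hr : 0 ≤ r)
    (hint : P.innerBall M r ⊆ interior (P.stateBall M)) (hη : 0 ≤ η) {x : Vec n} (hx : x ∈ P.Y₀) :
    ‖toL2 0 P.T (P.control (fun t => gradient (w t)) (y x))
      - toL2 0 P.T (P.control (P.valueGrad M) (ystar x))‖ ≤ √P.T * η := by
  have hu : ContinuousOn (P.control (P.valueGrad M) (ystar x)) (Icc 0 P.T) :=
    ControlProblem.continuousOn_control (hdyn.contDiffOn_feedback (by norm_num)
      hval.contDiffOn_valueGrad).continuousOn fun t ht => hint ((hopt.isTrajectory hr hx).1 t ht)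
  rw [← toL2_sub (hdyn.memLp_control hw _) hu.memLp_timeMeasure]
  have key := norm_toL2_le (a := 0) (b := P.T)
    (φ := fun t => P.control (fun t => gradient (w t)) (y x) t
      - P.control (P.valueGrad M) (ystar x) t) P.T_pos.le hη (by
    filter_upwards [ae_restrict_mem measurableSet_Ioo] with t ht
    rw [norm_sub_rev]
    exact h.control_sub x hx t (Ioo_subset_Icc_self ht))
  rwa [sub_zero] at key

/-- The optimal ensemble satisfies the constraints with `M`, `MW`, `MU`; the factors 2 absorb the
perturbation. -/
theorem IsNearOptimal.isAdmissible {Θ : Type*}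
    {v : Θ → ℝ → Vec n → ℝ} {θ : Θ} (h : P.IsNearOptimal M r η ystar (v θ) y p)
    (hdyn : P.SmoothDynamics) (hw : ContDiff ℝ 4 (fun z : ℝ × Vec n => v θ z.1 z.2))
    (hval : P.SmoothValue M) (hopt : P.OptimalFeedback M ystar) (hr : 0 ≤ r)
    (hint : P.innerBall M r ⊆ interior (P.stateBall M)) {MW MU : ℝ} (hMW : 0 < MW) (hMU : 0 < MU)
    (hW : P.w12Norm ystar ≤ ENNReal.ofReal MW)
    (hU : eLpNorm (P.ensembleClass fun x => P.control (P.valueGrad M) (ystar x)) ∞ P.ensemble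
      ≤ ENNReal.ofReal MU) (hη : 0 ≤ η)
    (hη1 : η ≤ M) (hη2 : (n + 1) * η ^ 2 ≤ MW ^ 2) (hη3 : √P.T * η ≤ MU) :
    P.IsAdmissible v M MW MU y p θ where
  y_smooth := h.contDiffOn hdyn hw
  y_bound x hx := by
    have h1 := h.norm_sub x hx
    have h2 := (hopt x hx).1.2
    have h3 := norm_sub_norm_le (y x) (ystar x)
    rw [norm_sub_rev] at h3
    linarith
  y_w12 := h.w12Norm_le hdyn hw hval hopt hr hint hMW hW hη2
  u_mem := memEnsemble_of_continuousOn (fun x _ => hdyn.memLp_control hw (y x))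
    ((hdyn.continuous_toL2_control hw).comp_continuousOn (h.contDiffOn hdyn hw).continuousOn)
  u_bound := by
    rw [eLpNorm_exponent_top] at hU ⊢
    refine eLpNormEssSup_le_of_ae_enorm_bound ?_
    filter_upwards [ae_le_eLpNormEssSup (μ := P.ensemble)
      (f := P.ensembleClass fun x => P.control (P.valueGrad M) (ystar x)),
      ae_ensemble_of_forall (P := P) (fun x hx => hx)] with x hx1 hx
    have h1 := hx1.trans hU
    rw [← ofReal_norm, ENNReal.ofReal_le_ofReal_iff hMU.le] at h1
    rw [← ofReal_norm]
    refine ENNReal.ofReal_le_ofReal ?_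
    have h2 := h.norm_toL2_control_sub hdyn hw hval hopt hr hint hη hx
    have h3 := norm_sub_norm_le (toL2 0 P.T (P.control (fun t => gradient (v θ t)) (y x)))
      (toL2 0 P.T (P.control (P.valueGrad M) (ystar x)))
    simp only [ensembleClass] at h1 ⊢
    linarith
  p_cont := h.continuousOn_adjoint hdyn hw
  state := ae_ensemble_of_forall fun x hx => ⟨(h.trajectory x hx).2, h.initial x hx⟩
  adjoint := ae_ensemble_of_forall h.adjoint

/-- With the exact value function both penalties vanish on the optimal ensemble. For a near optimal
one the cost changes by `O(η)` and the two L² errors are `O(η)`, hence their squares too since `η ≤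
1`. -/
theorem exists_augmentedCost_le (hdyn : P.SmoothDynamics) (hval : P.SmoothValue M)
    (hM : 0 ≤ M) (hopt : P.OptimalFeedback M ystar) (hr : 0 ≤ r)
    (hint : P.innerBall M r ⊆ interior (P.stateBall M)) :
    ∃ C : ℝ, 0 ≤ C ∧ ∀ (w : ℝ → Vec n → ℝ) (y p : Vec n → P.W) (η : ℝ),
      ContDiff ℝ 4 (fun z : ℝ × Vec n => w z.1 z.2) → 0 ≤ η → η ≤ 1 →
      P.IsNearOptimal M r η ystar w y p →
      ∀ x ∈ P.Y₀, P.augmentedCost w (y x) (p x) ≤ P.value 0 x + C * η := by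
  have hT := P.T_pos
  have hF : ContinuousOn (fun z : ℝ × Vec n => P.feedback (P.valueGrad M) z.1 z.2)
      (Icc 0 P.T ×ˢ interior (P.stateBall M)) :=
    (hdyn.contDiffOn_feedback (by norm_num) hval.contDiffOn_valueGrad).continuousOn
  obtain ⟨B, hB⟩ := (isCompact_Icc.prod (isCompact_innerBall (P := P) (M := M) (r := r))).exists_bound_of_continuousOn
    (hF.mono (prod_mono_right hint))
  set s := √P.T with hs
  have hs0 : 0 ≤ s := Real.sqrt_nonneg _
  set R := M + 1 + s * (max B 0 + 1) with hR
  have hR0 : 0 ≤ R := by positivity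
  obtain ⟨C₁, hC₁, hcost⟩ := P.exists_cost_lipschitz hR0
  set C₂ := C₁ * (1 + s) with hC₂
  have hC₂0 : 0 ≤ C₂ := by positivity
  have g1 := P.γ₁_nonneg
  have g2 := P.γ₂_nonneg
  refine ⟨C₂ + P.γ₁ / 2 * (s * (1 + C₂)) ^ 2 + P.γ₂ / 2 * s ^ 2, by positivity,
    fun w y p η hw hη0 hη1 h x hx => ?_⟩
  set u := P.control (fun t => gradient (w t)) (y x) with hu
  set u₀ := P.control (P.valueGrad M) (ystar x) with hu₀
  have htr := hopt.isTrajectory hr hx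
  have hu₀c : ContinuousOn u₀ (Icc 0 P.T) :=
    ControlProblem.continuousOn_control hF fun t ht => hint (htr.1 t ht)
  have hum : MemLp u 2 (timeMeasure 0 P.T) := hdyn.memLp_control hw _
  have hsub := h.norm_toL2_control_sub hdyn hw hval hopt hr hint hη0 hx
  have hu₀n : ‖toL2 0 P.T u₀‖ ≤ s * max B 0 := by
    have key := norm_toL2_le (a := 0) (b := P.T) (φ := u₀) (C := max B 0) hT.le (by positivity) (by
      filter_upwards [ae_restrict_mem measurableSet_Ioo] with t ht
      have ht' := Ioo_subset_Icc_self ht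
      exact (hB (t, (ystar x).rep t) ⟨ht', htr.1 t ht'⟩).trans (le_max_left _ _))
    rwa [sub_zero] at key
  have hun : ‖toL2 0 P.T u‖ ≤ s * (max B 0 + 1) := by
    have h3 := norm_sub_norm_le (toL2 0 P.T u) (toL2 0 P.T u₀)
    nlinarith
  have hyn : ‖y x‖ ≤ M + 1 := by
    have h1 := h.norm_sub x hx
    have h2 := (hopt x hx).1.2
    have h3 := norm_sub_norm_le (y x) (ystar x)
    rw [norm_sub_rev] at h3
    linarith
  have hsB : 0 ≤ s * max B 0 := by positivity
  have hsB1 : 0 ≤ s * (max B 0 + 1) := by positivity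
  have hdiff : ∀ t ∈ Icc 0 P.T, |P.cost t (y x).rep u - P.cost t (ystar x).rep u₀| ≤ C₂ * η := by
    intro t ht
    refine (hcost t ht (y x) (ystar x) u u₀ hum hu₀c.memLp_timeMeasure (by linarith)
      (by linarith [(hopt x hx).1.2]) (by linarith) (by nlinarith)).trans ?_
    rw [hC₂, mul_assoc]
    refine mul_le_mul_of_nonneg_left ?_ hC₁
    have h1 := h.norm_sub x hx
    rw [norm_sub_rev] at h1
    linarith
  have hval' : ∀ t ∈ Icc 0 P.T, P.value t ((ystar x).rep t) = P.cost t (ystar x).rep u₀ :=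
    fun t ht => (hopt x hx).2.2.value_eq_cost ht
  have he1 : ‖toL2 0 P.T (P.valueError w (y x))‖ ≤ s * ((1 + C₂) * η) := by
    have key := norm_toL2_le (a := 0) (b := P.T) (φ := P.valueError w (y x))
      (C := (1 + C₂) * η) hT.le (by positivity) (by
      filter_upwards [ae_restrict_mem measurableSet_Ioo] with t ht
      have ht' := Ioo_subset_Icc_self ht
      have k1 := h.value_sub x hx t ht'
      have k2 := hdiff t ht'
      rw [hval' t ht'] at k1
      rw [Real.norm_eq_abs, valueError]
      rw [abs_le] at k1 k2 ⊢
      constructor <;> linarith [k1.1, k1.2, k2.1, k2.2])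
    rwa [sub_zero] at key
  have he2 : ‖toL2 0 P.T (P.gradError w (y x) (p x))‖ ≤ s * η := by
    have key := norm_toL2_le (a := 0) (b := P.T) (φ := P.gradError w (y x) (p x)) (C := η) hT.le
      hη0 (by
      filter_upwards [ae_restrict_mem measurableSet_Ioo] with t ht
      exact h.gradient_sub x hx t ht)
    rwa [sub_zero] at key
  have h0 := left_mem_Icc.mpr hT.le
  have hd0 := hdiff 0 h0
  have hv0 := hval' 0 h0
  rw [(hopt x hx).1.1.2] at hv0
  rw [← hv0] at hd0
  have hd0' := (abs_le.mp hd0).2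
  rw [hdyn.augmentedCost_eq hw]
  have hη2 : η ^ 2 ≤ η := by nlinarith
  have q1 : ‖toL2 0 P.T (P.valueError w (y x))‖ ^ 2 ≤ (s * (1 + C₂)) ^ 2 * η := by
    refine (pow_le_pow_left₀ (norm_nonneg _) he1 2).trans ?_
    rw [← mul_assoc, mul_pow]
    exact mul_le_mul_of_nonneg_left hη2 (by positivity)
  have q2 : ‖toL2 0 P.T (P.gradError w (y x) (p x))‖ ^ 2 ≤ s ^ 2 * η := by
    refine (pow_le_pow_left₀ (norm_nonneg _) he2 2).trans ?_
    rw [mul_pow]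
    exact mul_le_mul_of_nonneg_left hη2 (by positivity)
  have q1' := mul_le_mul_of_nonneg_left q1 (show 0 ≤ P.γ₁ / 2 by positivity)
  have q2' := mul_le_mul_of_nonneg_left q2 (show 0 ≤ P.γ₂ / 2 by positivity)
  linarith

end ControlProblem

/-! ### From convergence of integrals to convergence of norms -/

section Lp

variable {X : Type*} [MeasurableSpace X] {μ : Measure X} {F : Type*} [NormedAddCommGroup F]

theorem tendsto_eLpNorm_one_of_integral {D : ℕ → X → ℝ} (hD : ∀ k, Integrable (D k) μ)
    (h0 : ∀ k, ∀ᵐ x ∂μ, 0 ≤ D k x) (h : Tendsto (fun k => ∫ x, D k x ∂μ) atTop (𝓝 0)) :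
    Tendsto (fun k => eLpNorm (D k) 1 μ) atTop (𝓝 0) := by
  have e : ∀ k, eLpNorm (D k) 1 μ = ENNReal.ofReal (∫ x, D k x ∂μ) := fun k => by
    rw [eLpNorm_one_eq_lintegral_enorm, ← ofReal_integral_norm_eq_lintegral_enorm (hD k)]
    congr 1
    refine integral_congr_ae ?_
    filter_upwards [h0 k] with x hx
    exact Real.norm_of_nonneg hx
  simp only [e]
  simpa using ENNReal.tendsto_ofReal h

theorem tendsto_eLpNorm_two_of_integral {D : ℕ → X → ℝ} {f : ℕ → X → F} {c : ℝ} (hc : 0 < c)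
    (hD : ∀ k, Integrable (D k) μ) (h0 : ∀ k, ∀ᵐ x ∂μ, c * ‖f k x‖ ^ 2 ≤ D k x)
    (h : Tendsto (fun k => ∫ x, D k x ∂μ) atTop (𝓝 0)) :
    Tendsto (fun k => eLpNorm (f k) 2 μ) atTop (𝓝 0) := by
  have hlim : Tendsto (fun k => ENNReal.ofReal (∫ x, c⁻¹ * D k x ∂μ) ^ (1 / (2 : ℝ))) atTop (𝓝 0) := by
    have h1 : Tendsto (fun k => ENNReal.ofReal (∫ x, c⁻¹ * D k x ∂μ)) atTop (𝓝 0) := by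
      simp only [integral_const_mul]
      simpa using ENNReal.tendsto_ofReal (h.const_mul c⁻¹)
    have h2 := (ENNReal.continuous_rpow_const (y := 1 / (2 : ℝ))).tendsto 0
    rw [ENNReal.zero_rpow_of_pos (by norm_num)] at h2
    exact h2.comp h1
  refine tendsto_of_tendsto_of_tendsto_of_le_of_le tendsto_const_nhds hlim (fun _ => zero_le)
    fun k => ?_
  rw [eLpNorm_eq_lintegral_rpow_enorm_toReal two_ne_zero ENNReal.ofNat_ne_top, ENNReal.toReal_ofNat]
  refine ENNReal.rpow_le_rpow ?_ (by norm_num)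
  have hnn : 0 ≤ᵐ[μ] fun x => c⁻¹ * D k x := by
    filter_upwards [h0 k] with x hx
    have : 0 ≤ D k x := le_trans (by positivity) hx
    positivity
  rw [ofReal_integral_eq_lintegral_ofReal ((hD k).const_mul _) hnn]
  refine lintegral_mono_ae ?_
  filter_upwards [h0 k] with x hx
  rw [← ofReal_norm, ENNReal.ofReal_rpow_of_nonneg (norm_nonneg _) two_pos.le, Real.rpow_two]
  refine ENNReal.ofReal_le_ofReal ?_
  rw [inv_mul_eq_div, le_div_iff₀ hc]
  linarith

/-- The index sequence `ns` is part of the data so that subsequences for several convergences can be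
extracted one after another. -/
theorem exists_subseq_tendsto_ae {q : ℝ≥0∞} (hq : q ≠ 0) {f : ℕ → X → F} {g : X → F}
    (hf : ∀ k, AEStronglyMeasurable (f k) μ) (hg : AEStronglyMeasurable g μ)
    (h : Tendsto (fun k => eLpNorm (fun x => f k x - g x) q μ) atTop (𝓝 0)) {ns : ℕ → ℕ}
    (hns : Tendsto ns atTop atTop) :
    ∃ ms : ℕ → ℕ, StrictMono ms ∧
      ∀ᵐ x ∂μ, Tendsto (fun k => f (ns (ms k)) x) atTop (𝓝 (g x)) :=
  ((tendstoInMeasure_of_tendsto_eLpNorm hq hf hg h).comp hns).exists_seq_tendsto_ae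

end Lp

/-! ### Limits of states and vanishing of the excess -/

namespace ControlProblem

variable {n m : ℕ} {P : ControlProblem n m}

theorem tendsto_rep {T : ℝ} (hT : 0 < T) {y : ℕ → H1 0 T n} {y₀ : H1 0 T n}
    (hy : Tendsto y atTop (𝓝 y₀)) {t : ℝ} (ht : t ∈ Icc 0 T) :
    Tendsto (fun k => (y k).rep t) atTop (𝓝 (y₀.rep t)) := by
  obtain ⟨C, hC0, hC⟩ := H1.exists_norm_rep_le hT n
  rw [tendsto_iff_norm_sub_tendsto_zero] at hy ⊢
  refine squeeze_zero (fun _ => norm_nonneg _) (fun k => ?_) (by simpa using hy.const_mul C)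
  rw [← H1.rep_sub hT _ _ _ ht]
  exact hC _ t ht

/-- The state equation is stable under strong convergence of states and controls. -/
theorem SmoothDynamics.isState_of_tendsto (hdyn : P.SmoothDynamics) {x : Vec n} {y : ℕ → P.W}
    {y₀ : P.W} {u : ℕ → ℝ → Vec m} {u₀ : ℝ → Vec m}
    (hu : ∀ k, MemLp (u k) 2 (timeMeasure 0 P.T)) (hu₀ : MemLp u₀ 2 (timeMeasure 0 P.T))
    (hy : Tendsto y atTop (𝓝 y₀))
    (huk : Tendsto (fun k => toL2 0 P.T (u k)) atTop (𝓝 (toL2 0 P.T u₀)))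
    (hs : ∀ k, P.IsState 0 x (y k) (u k)) : P.IsState 0 x y₀ u₀ := by
  have hT := P.T_pos
  refine ⟨?_, ?_⟩
  · have hd : Tendsto (fun k => (y k).1.snd) atTop (𝓝 y₀.1.snd) := by
      rw [tendsto_iff_norm_sub_tendsto_zero] at hy ⊢
      exact squeeze_zero (fun _ => norm_nonneg _) (fun k => (y k - y₀).norm_snd_le) hy
    -- Along a further subsequence derivatives and controls converge for a.e. time, while states
    -- converge at every time; continuity of `f` and `g` then passes the equation to the limit
    -- pointwise.
    obtain ⟨ns, hns, hae1⟩ := (tendstoInMeasure_of_tendsto_Lp hd).exists_seq_tendsto_ae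
    obtain ⟨ms, hms, hae2⟩ := (tendstoInMeasure_of_tendsto_Lp
      (huk.comp hns.tendsto_atTop)).exists_seq_tendsto_ae
    filter_upwards [hae1, hae2, coeFn_toL2 hu₀, ae_all_iff.mpr fun k => coeFn_toL2 (hu k),
      ae_all_iff.mpr fun k => (hs k).1, ae_restrict_mem measurableSet_Ioo] with t h1 h2 h3 h4 h5 ht
    have ht' := Ioo_subset_Icc_self ht
    have hl : Tendsto (fun k => ns (ms k)) atTop atTop :=
      hns.tendsto_atTop.comp hms.tendsto_atTop
    have hyt := (tendsto_rep hT hy ht').comp hl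
    have hut : Tendsto (fun k => u (ns (ms k)) t) atTop (𝓝 (u₀ t)) := by
      rw [← h3]
      exact h2.congr fun k => h4 _
    have hslice : Continuous fun q : Vec n => (t, q) := by fun_prop
    have hf : Continuous (P.f t) :=
      continuousOn_univ.mp (hdyn.f_smooth.continuousOn.comp (f := fun q : Vec n => (t, q))
        hslice.continuousOn fun _ _ => ⟨ht', mem_univ _⟩)
    have hg : Continuous (P.g t) :=
      continuousOn_univ.mp (hdyn.g_smooth.continuousOn.comp (f := fun q : Vec n => (t, q))
        hslice.continuousOn fun _ _ => ⟨ht', mem_univ _⟩)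
    have hr : Tendsto (fun k => P.f t ((y (ns (ms k))).rep t)
        + P.g t ((y (ns (ms k))).rep t) (u (ns (ms k)) t)) atTop
        (𝓝 (P.f t (y₀.rep t) + P.g t (y₀.rep t) (u₀ t))) :=
      ((hf.tendsto _).comp hyt).add ((continuous_fst.clm_apply continuous_snd).tendsto
        (P.g t (y₀.rep t), u₀ t) |>.comp (((hg.tendsto _).comp hyt).prodMk_nhds hut))
    refine tendsto_nhds_unique ?_ hr
    exact (h1.comp hms.tendsto_atTop).congr fun k => h5 _
  · have h0 : (0 : ℝ) ∈ Icc 0 P.T := left_mem_Icc.mpr hT.le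
    refine tendsto_nhds_unique (tendsto_rep hT hy h0) ?_
    simp only [(hs _).2]
    exact tendsto_const_nhds

theorem OptimalFeedback.norm_le {M : ℝ} {ystar : Vec n → P.W} (hopt : P.OptimalFeedback M ystar)
    {x : Vec n} (hx : x ∈ P.Y₀) : ‖x‖ ≤ M * embeddingNorm P.T n := by
  have h0 : (0 : ℝ) ∈ Icc 0 P.T := left_mem_Icc.mpr P.T_pos.le
  have h1 := H1.norm_rep_le_embeddingNorm P.T_pos (ystar x) h0
  rw [(hopt x hx).1.1.2] at h1
  have h2 := mul_le_mul_of_nonneg_left (hopt x hx).1.2 (embeddingNorm_nonneg P.T n)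
  linarith

theorem OptimalFeedback.continuousOn_value {M : ℝ} {ystar : Vec n → P.W}
    (hopt : P.OptimalFeedback M ystar) (hM : 0 ≤ M) (hval : P.SmoothValue M) :
    ContinuousOn (P.value 0) P.Y₀ := by
  have h0 : (0 : ℝ) ∈ Icc 0 P.T := left_mem_Icc.mpr P.T_pos.le
  have hslice : Continuous fun q : Vec n => ((0 : ℝ), q) := by fun_prop
  refine hval.smooth.continuousOn.comp (f := fun q : Vec n => ((0 : ℝ), q))
    hslice.continuousOn fun x hx => ⟨h0, ?_⟩
  have h1 := hopt.norm_le hx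
  have h2 := mul_nonneg hM (embeddingNorm_nonneg P.T n)
  refine mem_closedBall_zero_iff.mpr ?_
  change ‖x‖ ≤ _
  linarith

/-! ### The excess of the augmented cost over the optimal cost -/

/-- The excess of the augmented cost over the optimal cost. -/
def excess (P : ControlProblem n m) (w : ℝ → Vec n → ℝ) (y p : Vec n → P.W) (x : Vec n) : ℝ :=
  P.augmentedCost w (y x) (p x) - P.value 0 x

section Excess

variable {M MW MU : ℝ} {ystar : Vec n → P.W} {w : ℝ → Vec n → ℝ}

theorem continuousOn_excess (hdyn : P.SmoothDynamics) (hopt : P.OptimalFeedback M ystar)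
    (hM : 0 ≤ M) (hval : P.SmoothValue M) (hw : ContDiff ℝ 4 (fun z : ℝ × Vec n => w z.1 z.2))
    {y p : Vec n → P.W} (hy : ContinuousOn y P.Y₀) (hp : ContinuousOn p P.Y₀) :
    ContinuousOn (P.excess w y p) P.Y₀ :=
  ((hdyn.continuous_augmentedCost hw).comp_continuousOn (hy.prodMk hp)).sub
    (hopt.continuousOn_value hM hval)

theorem integrable_of_continuousOn {φ : Vec n → ℝ} (hφ : ContinuousOn φ P.Y₀) :
    Integrable φ P.ensemble :=
  memLp_one_iff_integrable.mp (memLp_of_continuousOn hφ)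

theorem integrable_weight_mul {φ : Vec n → ℝ} (hφ : ContinuousOn φ P.Y₀) :
    Integrable (fun x => P.weight x * φ x) P.ensemble :=
  (integrable_of_continuousOn hφ).mul_of_top_right P.weight_mem

theorem integral_weight_augmentedCost (hdyn : P.SmoothDynamics)
    (hopt : P.OptimalFeedback M ystar)
    (hM : 0 ≤ M) (hval : P.SmoothValue M) (hw : ContDiff ℝ 4 (fun z : ℝ × Vec n => w z.1 z.2))
    {y p : Vec n → P.W} (hy : ContinuousOn y P.Y₀) (hp : ContinuousOn p P.Y₀) :
    ∫ x, P.weight x * P.augmentedCost w (y x) (p x) ∂P.ensemble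
      = (∫ x, P.weight x * P.excess w y p x ∂P.ensemble)
        + ∫ x, P.weight x * P.value 0 x ∂P.ensemble := by
  rw [← integral_add (integrable_weight_mul (continuousOn_excess hdyn hopt hM hval hw hy hp))
    (integrable_weight_mul (hopt.continuousOn_value hM hval))]
  refine integral_congr_ae (Eventually.of_forall fun x => ?_)
  simp only [excess]
  ring

variable {Θ : Type*} {v : Θ → ℝ → Vec n → ℝ} {θ : Θ} {y p : Vec n → P.W}

theorem IsAdmissible.value_le_cost (h : P.IsAdmissible v M MW MU y p θ) :
    ∀ᵐ x ∂P.ensemble,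
      P.value 0 x ≤ P.cost 0 (y x).rep (P.control (fun t => gradient (v θ t)) (y x)) := by
  filter_upwards [h.state, h.u_mem.1] with x hx hu
  exact ControlProblem.value_le_cost P.T_pos ⟨hu, hx⟩

/-- Feasibility makes the cost gap nonnegative, so the excess is a sum of three nonnegative terms. A
vanishing mean excess thus controls the cost and both learning errors simultaneously. -/
theorem IsAdmissible.le_excess (h : P.IsAdmissible v M MW MU y p θ) (hdyn : P.SmoothDynamics)
    (hw : ContDiff ℝ 4 (fun z : ℝ × Vec n => v θ z.1 z.2)) :
    ∀ᵐ x ∂P.ensemble,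
      P.cost 0 (y x).rep (P.control (fun t => gradient (v θ t)) (y x)) - P.value 0 x
        ≤ P.excess (v θ) y p x ∧
      P.γ₁ / 2 * ‖toL2 0 P.T (P.valueError (v θ) (y x))‖ ^ 2 ≤ P.excess (v θ) y p x ∧
      P.γ₂ / 2 * ‖toL2 0 P.T (P.gradError (v θ) (y x) (p x))‖ ^ 2 ≤ P.excess (v θ) y p x ∧
      0 ≤ P.excess (v θ) y p x := by
  filter_upwards [h.value_le_cost] with x hx
  have g1 := P.γ₁_nonneg
  have g2 := P.γ₂_nonneg
  have h1 : 0 ≤ P.γ₁ / 2 * ‖toL2 0 P.T (P.valueError (v θ) (y x))‖ ^ 2 := by positivity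
  have h2 : 0 ≤ P.γ₂ / 2 * ‖toL2 0 P.T (P.gradError (v θ) (y x) (p x))‖ ^ 2 := by positivity
  rw [excess, hdyn.augmentedCost_eq hw]
  exact ⟨by linarith, by linarith, by linarith, by linarith⟩

end Excess

/-- The excess of minimizers of the learning problem tends to zero in mean. -/
theorem tendsto_integral_excess {M MW MU : ℝ} (hM : 0 < M) (hMW : 0 < MW) (hMU : 0 < MU)
    {ystar : Vec n → P.W} (hdyn : P.SmoothDynamics) (hval : P.SmoothValue M)
    (hopt : P.OptimalFeedback M ystar) (hW : P.w12Norm ystar ≤ ENNReal.ofReal MW)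
    (hU : eLpNorm (P.ensembleClass fun x => P.control (P.valueGrad M) (ystar x)) ∞ P.ensemble
      ≤ ENNReal.ofReal MU)
    {R : ℝ → Type*} [∀ ε, NormedAddCommGroup (R ε)] [∀ ε, NormedSpace ℝ (R ε)]
    {V : ∀ ε, R ε → ℝ → Vec n → ℝ} {ε₀ : ℝ} {θ₀ : ∀ ε, R ε}
    (happ : P.ValueApproximation M ε₀ V θ₀) {γ : ℝ → ℝ} (hγ : ∀ ε ∈ Ioc 0 ε₀, 0 < γ ε)
    (hγθ : (fun ε => γ ε * ‖θ₀ ε‖ ^ 2) =O[𝓝[>] (0 : ℝ)] fun ε => ε)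
    {ε : ℕ → ℝ} (hε_mem : ∀ k, ε k ∈ Ioc 0 ε₀) (hε_lim : Tendsto ε atTop (𝓝 0))
    {y p : ℕ → Vec n → P.W} {θ : ∀ k, R (ε k)}
    (hmin : ∀ k, P.IsMinimizer (V (ε k)) M MW MU (γ (ε k)) (y k) (p k) (θ k)) :
    Tendsto (fun k => ∫ x, P.excess (V (ε k) (θ k)) (y k) (p k) x ∂P.ensemble) atTop (𝓝 0) := by
  obtain ⟨r, hr, hint⟩ := P.exists_margin hM
  obtain ⟨C, hC0, hC⟩ := exists_augmentedCost_le hdyn hval hM.le hopt hr.le hint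
  obtain ⟨c, hc, hcw⟩ := P.weight_pos
  set Wt := ∫ x, P.weight x ∂P.ensemble with hWt
  have hw := fun k => contDiff_slice (happ.smooth (ε k) (hε_mem k)) (θ k)
  have hexc := fun k => continuousOn_excess hdyn hopt hM.le hval (hw k)
    (hmin k).1.y_smooth.continuousOn (hmin k).1.p_cont
  have hnn := fun k => (hmin k).1.le_excess hdyn (hw k)
  have hpen : Tendsto (fun k => γ (ε k) / 2 * ‖θ₀ (ε k)‖ ^ 2) atTop (𝓝 0) := by
    have h1 : Tendsto (fun ε => γ ε * ‖θ₀ ε‖ ^ 2) (𝓝[>] (0 : ℝ)) (𝓝 0) :=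
      hγθ.trans_tendsto (tendsto_id.mono_left nhdsWithin_le_nhds)
    have h2 : Tendsto ε atTop (𝓝[>] 0) :=
      tendsto_nhdsWithin_iff.mpr ⟨hε_lim, Eventually.of_forall fun k => (hε_mem k).1⟩
    have h3 := (h1.comp h2).const_mul (1 / 2 : ℝ)
    rw [mul_zero] at h3
    refine h3.congr fun k => ?_
    simp only [Function.comp_apply]
    ring
  rw [Metric.tendsto_nhds]
  intro δ hδ
  have hsmall : ∀ (φ : ℝ → ℝ) (b : ℝ), Continuous φ → φ 0 = 0 → 0 < b →
      ∀ᶠ η in 𝓝[>] (0 : ℝ), φ η ≤ b := by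
    intro φ b hφ h0 hb
    have := (hφ.tendsto 0).mono_left (nhdsWithin_le_nhds (s := Ioi (0 : ℝ)))
    rw [h0] at this
    exact (this.eventually (gt_mem_nhds hb)).mono fun _ h => le_of_lt h
  -- The first bound serves `exists_augmentedCost_le`, the next three make the competitor
  -- admissible, and the last makes its weighted excess at most `c δ / 4`. The penalty on `θ₀` gets
  -- another `c δ / 4`.
  obtain ⟨η, ⟨h1, h2, h3, h4, h5⟩, hη⟩ := ((hsmall (fun η => η) 1 (by fun_prop) rfl one_pos).and
    ((hsmall (fun η => η) M (by fun_prop) rfl hM).and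
    ((hsmall (fun η => (n + 1) * η ^ 2) (MW ^ 2) (by fun_prop) (by simp) (by positivity)).and
    ((hsmall (fun η => √P.T * η) MU (by fun_prop) (by simp) hMU).and
    (hsmall (fun η => C * η * Wt) (c * δ / 4) (by fun_prop) (by simp) (by positivity)))))).and
    self_mem_nhdsWithin |>.exists
  have hη0 : 0 < η := hη
  obtain ⟨ε₁, hε₁, hnear⟩ := exists_isNearOptimal hdyn hval hopt hr hint happ hη0
  filter_upwards [hpen.eventually (gt_mem_nhds (show (0 : ℝ) < c * δ / 4 by positivity)),
    hε_lim.eventually (gt_mem_nhds hε₁)] with k hk1 hk2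
  obtain ⟨y', p', hnr⟩ := hnear (ε k) (hε_mem k) hk2.le
  have hw' := contDiff_slice (happ.smooth (ε k) (hε_mem k)) (θ₀ (ε k))
  have hadm := hnr.isAdmissible hdyn hw' hval hopt hr.le hint hMW hMU hW hU hη0.le h2 h3 h4
  -- In this comparison the weighted integral of `V*(0, ·)` appears on both sides and cancels, so it
  -- becomes one between excesses.
  have hobj := (hmin k).2 y' p' (θ₀ (ε k)) hadm
  have hexc' := continuousOn_excess hdyn hopt hM.le hval hw' hadm.y_smooth.continuousOn hadm.p_cont
  rw [objective, objective, integral_weight_augmentedCost hdyn hopt hM.le hval (hw k)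
    (hmin k).1.y_smooth.continuousOn (hmin k).1.p_cont,
    integral_weight_augmentedCost hdyn hopt hM.le hval hw' hadm.y_smooth.continuousOn
      hadm.p_cont] at hobj
  have hγk : 0 ≤ γ (ε k) / 2 * ‖θ k‖ ^ 2 := by
    have := hγ _ (hε_mem k)
    positivity
  have hup : ∫ x, P.weight x * P.excess (V (ε k) (θ₀ (ε k))) y' p' x ∂P.ensemble ≤ C * η * Wt := by
    rw [hWt, ← integral_const_mul]
    refine integral_mono_ae (integrable_weight_mul hexc')
      ((P.weight_mem.integrable (by simp)).const_mul _) ?_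
    filter_upwards [hcw, ae_ensemble_of_forall (P := P) (fun x hx => hx)] with x hx hxY
    have k1 := hC _ y' p' η hw' hη0.le h1 hnr x hxY
    have k2 : P.excess (V (ε k) (θ₀ (ε k))) y' p' x ≤ C * η := by
      rw [excess]
      linarith
    change P.weight x * _ ≤ C * η * P.weight x
    rw [mul_comm (C * η)]
    exact mul_le_mul_of_nonneg_left k2 (hc.le.trans hx)
  -- The excess is nonnegative a.e., so the lower bound `c` on the weight removes the weight.
  have hlow : c * ∫ x, P.excess (V (ε k) (θ k)) (y k) (p k) x ∂P.ensemble
      ≤ ∫ x, P.weight x * P.excess (V (ε k) (θ k)) (y k) (p k) x ∂P.ensemble := by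
    rw [← integral_const_mul]
    refine integral_mono_ae ((integrable_of_continuousOn (hexc k)).const_mul _)
      (integrable_weight_mul (hexc k)) ?_
    filter_upwards [hcw, hnn k] with x hx hxn
    exact mul_le_mul_of_nonneg_right hx hxn.2.2.2
  have hpos : 0 ≤ ∫ x, P.excess (V (ε k) (θ k)) (y k) (p k) x ∂P.ensemble :=
    integral_nonneg_of_ae ((hnn k).mono fun x hx => hx.2.2.2)
  rw [Real.dist_eq, sub_zero, abs_of_nonneg hpos]
  have : c * ∫ x, P.excess (V (ε k) (θ k)) (y k) (p k) x ∂P.ensemble < c * δ := by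
    have : 0 < c * δ := by positivity
    linarith
  exact lt_of_mul_lt_mul_left this hc.le

end ControlProblem

/-! ### Optimality of the limit and the two convergences -/

namespace ControlProblem

variable {n m : ℕ} {P : ControlProblem n m} {M MW MU : ℝ} {Θ : ℕ → Type*}
  {v : ∀ k, Θ k → ℝ → Vec n → ℝ} {θ : ∀ k, Θ k} {y p : ℕ → Vec n → P.W} {ybar pbar : Vec n → P.W}
  {ubar : Vec n → ℝ → Vec m}

theorem IsAdmissible.norm_toL2_control_le {Θ : Type*} {v : Θ → ℝ → Vec n → ℝ} {θ : Θ}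
    {y p : Vec n → P.W} (h : P.IsAdmissible v M MW MU y p θ) (hMU : 0 ≤ MU) :
    ∀ᵐ x ∂P.ensemble, ‖toL2 0 P.T (P.control (fun t => gradient (v θ t)) (y x))‖ ≤ 2 * MU := by
  have hU := h.u_bound
  rw [eLpNorm_exponent_top] at hU
  filter_upwards [ae_le_eLpNormEssSup (μ := P.ensemble)
    (f := P.ensembleClass fun x => P.control (fun t => gradient (v θ t)) (y x))] with x hx
  have h1 := hx.trans hU
  rwa [← ofReal_norm, ENNReal.ofReal_le_ofReal_iff (by positivity)] at h1

/-- Along a sequence of admissible triples with vanishing excess, the limits are optimal pairs. -/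
theorem ae_isOptimal_of_tendsto (hdyn : P.SmoothDynamics) (hMU : 0 ≤ MU)
    (hv : ∀ k, ContDiff ℝ 4 (fun z : ℝ × Vec n => v k (θ k) z.1 z.2))
    (hadm : ∀ k, P.IsAdmissible (v k) M MW MU (y k) (p k) (θ k))
    (hint : ∀ k, Integrable (P.excess (v k (θ k)) (y k) (p k)) P.ensemble)
    (hexc : Tendsto (fun k => ∫ x, P.excess (v k (θ k)) (y k) (p k) x ∂P.ensemble) atTop (𝓝 0))
    (hy : P.TendstoTraj y ybar)
    (hu : P.TendstoEnsemble (fun k x => P.control (fun t => gradient (v k (θ k) t)) (y k x)) ubar) :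
    ∀ᵐ x ∂P.ensemble, P.IsOptimal x (ybar x) (ubar x) ∧ ‖ybar x‖ ≤ 2 * M ∧
      ‖toL2 0 P.T (ubar x)‖ ≤ 2 * MU := by
  have hE := tendsto_eLpNorm_one_of_integral hint
    (fun k => ((hadm k).le_excess hdyn (hv k)).mono fun x hx => hx.2.2.2) hexc
  -- Successive extraction of one subsequence along which states, controls and excess converge for
  -- a.e. `x`. The conclusion concerns only the limits, so a subsequence suffices.
  obtain ⟨n₁, hn₁, h1⟩ := exists_subseq_tendsto_ae two_ne_zero (fun k => (hy.1 k).1) hy.2.1.1 hy.2.2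
    tendsto_id
  obtain ⟨n₂, hn₂, h2⟩ := exists_subseq_tendsto_ae two_ne_zero (fun k => (hu.1 k).2.1) hu.2.1.2.1
    hu.2.2 hn₁.tendsto_atTop
  have hn₁₂ : Tendsto (fun k => n₁ (n₂ k)) atTop atTop :=
    hn₁.tendsto_atTop.comp hn₂.tendsto_atTop
  obtain ⟨n₃, hn₃, h3⟩ := exists_subseq_tendsto_ae (g := fun _ => (0 : ℝ)) one_ne_zero
    (fun k => (hint k).1) aestronglyMeasurable_const (by simpa using hE) hn₁₂
  set ns : ℕ → ℕ := fun k => n₁ (n₂ (n₃ k)) with hns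
  filter_upwards [h1, h2, h3, ae_all_iff.mpr fun k => (hadm k).state,
    ae_all_iff.mpr fun k => (hadm k).norm_toL2_control_le hMU,
    ae_all_iff.mpr fun k => (hadm k).value_le_cost,
    ae_all_iff.mpr fun k => (hadm k).le_excess hdyn (hv k), hu.2.1.1,
    ae_ensemble_of_forall (P := P) (fun x hx => hx)]
    with x hx1 hx2 hx3 hst hub hvc hle hum hxY
  have ty : Tendsto (fun k => y (ns k) x) atTop (𝓝 (ybar x)) :=
    hx1.comp (hn₂.tendsto_atTop.comp hn₃.tendsto_atTop)
  have tu : Tendsto (fun k => toL2 0 P.T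
      (P.control (fun t => gradient (v (ns k) (θ (ns k)) t)) (y (ns k) x))) atTop
      (𝓝 (toL2 0 P.T (ubar x))) := hx2.comp hn₃.tendsto_atTop
  have hstate : P.IsState 0 x (ybar x) (ubar x) :=
    hdyn.isState_of_tendsto (fun k => hdyn.memLp_control (hv (ns k)) _) hum ty tu fun k => hst (ns k)
  have tc : Tendsto (fun k => P.cost 0 (y (ns k) x).rep
      (P.control (fun t => gradient (v (ns k) (θ (ns k)) t)) (y (ns k) x))) atTop
      (𝓝 (P.cost 0 (ybar x).rep (ubar x))) := by
    have e : P.cost 0 (ybar x).rep (ubar x) = P.cost 0 (ybar x).rep (toL2 0 P.T (ubar x)) :=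
      cost_congr P.T_pos.le (fun _ _ => rfl) (coeFn_toL2 hum).symm
    rw [e]
    exact ((continuous_cost_zero.tendsto (ybar x, toL2 0 P.T (ubar x))).comp
      (ty.prodMk_nhds tu)).congr fun k => (hdyn.cost_control (hv (ns k)) _).symm
  have tv : Tendsto (fun k => P.cost 0 (y (ns k) x).rep
      (P.control (fun t => gradient (v (ns k) (θ (ns k)) t)) (y (ns k) x)) - P.value 0 x) atTop
      (𝓝 0) :=
    squeeze_zero (fun k => sub_nonneg.mpr (hvc (ns k))) (fun k => (hle (ns k)).1) hx3
  -- The costs converge to that of the limit pair, and the cost gap, squeezed between 0 and the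
  -- excess, tends to 0; so the limit pair attains the infimum.
  have hcost : P.cost 0 (ybar x).rep (ubar x) = P.value 0 x :=
    sub_eq_zero.mp (tendsto_nhds_unique (tc.sub_const _) tv)
  refine ⟨⟨⟨hum, hstate⟩, fun z u hz => hcost.trans_le (ControlProblem.value_le_cost P.T_pos hz)⟩,
    le_of_tendsto ty.norm (Eventually.of_forall fun k => (hadm (ns k)).y_bound x hxY),
    le_of_tendsto tu.norm (Eventually.of_forall fun k => hub (ns k))⟩

/-- `V` along `y_k` equals the value error, which vanishes because the excess does, plus the cost to
go of `(y_k, u_k)`, which follows the strong convergence. Optimality of the limit identifies the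
limiting cost to go with `V*(·, ȳ)`. -/
theorem tendstoEnsemble_value (hdyn : P.SmoothDynamics) (hM : 0 ≤ M) (hMU : 0 ≤ MU)
    (hv : ∀ k, ContDiff ℝ 4 (fun z : ℝ × Vec n => v k (θ k) z.1 z.2))
    (hadm : ∀ k, P.IsAdmissible (v k) M MW MU (y k) (p k) (θ k))
    (hint : ∀ k, Integrable (P.excess (v k (θ k)) (y k) (p k)) P.ensemble)
    (hexc : Tendsto (fun k => ∫ x, P.excess (v k (θ k)) (y k) (p k) x ∂P.ensemble) atTop (𝓝 0))
    (hy : P.TendstoTraj y ybar)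
    (hu : P.TendstoEnsemble (fun k x => P.control (fun t => gradient (v k (θ k) t)) (y k x)) ubar)
    (hγ₁ : 0 < P.γ₁) :
    P.TendstoEnsemble (fun k x t => v k (θ k) t ((y k x).rep t))
      (fun x t => P.value t ((ybar x).rep t)) := by
  have hopt := ae_isOptimal_of_tendsto hdyn hMU hv hadm hint hexc hy hu
  -- The cost is Lipschitz only on bounded sets; the constraints, which pass to the limit, keep all
  -- states and controls in a ball of this radius.
  set R := 2 * M + 2 * MU with hR
  have hR0 : 0 ≤ R := by positivity
  obtain ⟨C, hC0, hC⟩ := P.exists_costL2_lipschitz hR0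
  have hmem : ∀ x, P.IsOptimal x (ybar x) (ubar x) →
      (fun t => P.value t ((ybar x).rep t)) =ᵐ[timeMeasure 0 P.T]
        fun t => P.cost t (ybar x).rep (ubar x) := fun x hx => by
    filter_upwards [ae_restrict_mem measurableSet_Ioo] with t ht
    exact hx.value_eq_cost (Ioo_subset_Icc_self ht)
  -- Rewriting the class as `costL2` of the limit pair gives its measurability in `x`, as a
  -- continuous function of measurable maps.
  have hcls : ∀ᵐ x ∂P.ensemble, P.ensembleClass (fun x t => P.value t ((ybar x).rep t)) x
      = P.costL2 (ybar x, P.ensembleClass ubar x) := by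
    filter_upwards [hopt] with x hx
    rw [ensembleClass, ensembleClass, costL2_toL2 _ hx.1.1.1]
    exact toL2_congr (hmem x hx.1)
  have hnorm : ∀ z : P.W × L2 0 P.T (Vec m), ‖z.1‖ ≤ 2 * M → ‖z.2‖ ≤ 2 * MU → ‖z‖ ≤ R :=
    fun z h1 h2 => norm_prod_le_iff.mpr ⟨by linarith, by linarith⟩
  have hEk : Tendsto (fun k => eLpNorm (fun x => toL2 0 P.T (P.valueError (v k (θ k)) (y k x))) 2
      P.ensemble) atTop (𝓝 0) :=
    tendsto_eLpNorm_two_of_integral (c := P.γ₁ / 2) (by positivity) hint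
      (fun k => ((hadm k).le_excess hdyn (hv k)).mono fun x hx => hx.2.1) hexc
  refine ⟨fun k => memEnsemble_of_continuousOn (fun x _ => memLp_value_comp P (hv k) _)
    ((continuous_toL2_value P (hv k)).comp_continuousOn (hadm k).y_smooth.continuousOn),
    ⟨?_, ?_⟩, ?_⟩
  · filter_upwards [hopt] with x hx
    exact (memLp_congr_ae (hmem x hx.1)).mpr (memLp_cost _ hx.1.1.1)
  · refine (memLp_congr_ae hcls).mpr (MemLp.of_bound
      (continuous_costL2.comp_aestronglyMeasurable (hy.2.1.1.prodMk hu.2.1.2.1))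
      (‖P.costL2 0‖ + C * (2 * M + 2 * MU)) ?_)
    filter_upwards [hopt] with x hx
    have h1 := (hC (ybar x, P.ensembleClass ubar x) 0 (hnorm _ hx.2.1 hx.2.2)
      (by rw [norm_zero]; exact hR0)).1
    have h2 := norm_sub_norm_le (P.costL2 (ybar x, P.ensembleClass ubar x)) (P.costL2 0)
    have h3 : C * (‖ybar x - 0‖ + ‖P.ensembleClass ubar x - 0‖) ≤ C * (2 * M + 2 * MU) := by
      rw [sub_zero, sub_zero]
      exact mul_le_mul_of_nonneg_left (add_le_add hx.2.1 hx.2.2) hC0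
    have h4 : ‖P.costL2 (ybar x, P.ensembleClass ubar x) - P.costL2 0‖
      ≤ C * (‖ybar x - 0‖ + ‖P.ensembleClass ubar x - 0‖) := h1
    linarith
  · set U : ℕ → Vec n → L2 0 P.T (Vec m) := fun k =>
      P.ensembleClass fun x => P.control (fun t => gradient (v k (θ k) t)) (y k x) with hUdef
    set E : ℕ → Vec n → L2 0 P.T ℝ := fun k x => toL2 0 P.T (P.valueError (v k (θ k)) (y k x))
      with hE
    have hEm : ∀ k, AEStronglyMeasurable (E k) P.ensemble := fun k =>
      aestronglyMeasurable_of_continuousOn ((hdyn.continuous_toL2_valueError (hv k)).comp_continuousOn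
        (hadm k).y_smooth.continuousOn)
    have hlim : Tendsto (fun k => eLpNorm (E k) 2 P.ensemble
        + ‖C‖ₑ * (eLpNorm (fun x => y k x - ybar x) 2 P.ensemble
          + eLpNorm (fun x => U k x - P.ensembleClass ubar x) 2 P.ensemble)) atTop (𝓝 0) := by
      have := hEk.add (ENNReal.Tendsto.const_mul (hy.2.2.add hu.2.2)
        (Or.inr (enorm_ne_top (x := C))))
      simpa using this
    refine tendsto_of_tendsto_of_tendsto_of_le_of_le tendsto_const_nhds hlim (fun _ => zero_le)
      fun k => ?_
    have m1 := hEm k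
    have m2 : AEStronglyMeasurable (fun x => y k x - ybar x) P.ensemble :=
      (hy.1 k).1.sub hy.2.1.1
    have m3 : AEStronglyMeasurable (fun x => U k x - P.ensembleClass ubar x) P.ensemble :=
      (hu.1 k).2.1.sub hu.2.1.2.1
    have hb : ∀ᵐ x ∂P.ensemble,
        ‖P.ensembleClass (fun x t => v k (θ k) t ((y k x).rep t)) x
          - P.ensembleClass (fun x t => P.value t ((ybar x).rep t)) x‖
        ≤ ‖‖E k x‖ + (C • fun x => ‖y k x - ybar x‖ + ‖U k x - P.ensembleClass ubar x‖) x‖ := by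
      filter_upwards [hopt, hcls, (hadm k).norm_toL2_control_le hMU,
        ae_ensemble_of_forall (P := P) (fun x hx => hx)] with x hx hc hub hxY
      have e : P.ensembleClass (fun x t => v k (θ k) t ((y k x).rep t)) x
          - P.ensembleClass (fun x t => P.value t ((ybar x).rep t)) x
          = E k x + (P.costL2 (y k x, U k x) - P.costL2 (ybar x, P.ensembleClass ubar x)) := by
        rw [hc, hE]
        simp only [hdyn.toL2_valueError (hv k)]
        simp only [ensembleClass, hUdef]
        abel
      rw [e, Pi.smul_apply, smul_eq_mul]
      refine (norm_add_le _ _).trans (le_trans ?_ (le_abs_self _))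
      exact add_le_add le_rfl (hC (y k x, U k x) (ybar x, P.ensembleClass ubar x)
        (hnorm _ ((hadm k).y_bound x hxY) hub) (hnorm _ hx.2.1 hx.2.2)).1
    refine (eLpNorm_mono_ae (g := (fun x => ‖E k x‖) + C • ((fun x => ‖y k x - ybar x‖)
      + fun x => ‖U k x - P.ensembleClass ubar x‖)) hb).trans ?_
    refine (eLpNorm_add_le m1.norm ((m2.norm.add m3.norm).const_smul C) one_le_two).trans ?_
    rw [eLpNorm_const_smul, eLpNorm_norm]
    gcongr
    refine (eLpNorm_add_le m2.norm m3.norm one_le_two).trans ?_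
    rw [eLpNorm_norm, eLpNorm_norm]

/-- `∂_y V` along `y_k` is the gradient error plus `p_k`; the first vanishes with the excess, the
second converges by hypothesis. Optimality of the limit plays no role. -/
theorem tendstoEnsemble_gradient (hdyn : P.SmoothDynamics)
    (hv : ∀ k, ContDiff ℝ 4 (fun z : ℝ × Vec n => v k (θ k) z.1 z.2))
    (hadm : ∀ k, P.IsAdmissible (v k) M MW MU (y k) (p k) (θ k))
    (hint : ∀ k, Integrable (P.excess (v k (θ k)) (y k) (p k)) P.ensemble)
    (hexc : Tendsto (fun k => ∫ x, P.excess (v k (θ k)) (y k) (p k) x ∂P.ensemble) atTop (𝓝 0))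
    (hp : P.TendstoTraj p pbar) (hγ₂ : 0 < P.γ₂) :
    P.TendstoEnsemble (fun k x t => gradient (v k (θ k) t) ((y k x).rep t))
      (fun x => (pbar x).rep) := by
  have hfst : ∀ q : Vec n → P.W, P.ensembleClass (fun x => (q x).rep) = fun x => (q x).1.fst :=
    fun q => funext fun x => (q x).toL2_rep P.T_pos
  have hEk : Tendsto (fun k => eLpNorm (fun x => toL2 0 P.T
      (P.gradError (v k (θ k)) (y k x) (p k x))) 2 P.ensemble) atTop (𝓝 0) :=
    tendsto_eLpNorm_two_of_integral (c := P.γ₂ / 2) (by positivity) hint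
      (fun k => ((hadm k).le_excess hdyn (hv k)).mono fun x hx => hx.2.2.1) hexc
  refine ⟨fun k => memEnsemble_of_continuousOn (fun x _ => memLp_gradient_comp P (hv k) _)
    ((continuous_toL2_gradient P (hv k)).comp_continuousOn (hadm k).y_smooth.continuousOn),
    ⟨Eventually.of_forall fun x => (pbar x).memLp_rep P.T_pos, ?_⟩, ?_⟩
  · rw [hfst]
    exact hp.2.1.of_le (continuous_fst_H1.comp_aestronglyMeasurable hp.2.1.1)
      (Eventually.of_forall fun x => (pbar x).norm_fst_le)
  · have hlim := hEk.add hp.2.2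
    rw [add_zero] at hlim
    refine tendsto_of_tendsto_of_tendsto_of_le_of_le tendsto_const_nhds hlim (fun _ => zero_le)
      fun k => ?_
    have hpair : ContinuousOn (fun x => (y k x, p k x)) P.Y₀ :=
      (hadm k).y_smooth.continuousOn.prodMk (hadm k).p_cont
    have hcont := (continuous_toL2_gradError (P := P) (hv k)).comp_continuousOn hpair
    have m1 : AEStronglyMeasurable (fun x => toL2 0 P.T
        (P.gradError (v k (θ k)) (y k x) (p k x))) P.ensemble :=
      aestronglyMeasurable_of_continuousOn hcont
    have m2 : AEStronglyMeasurable (fun x => (p k x - pbar x).1.fst) P.ensemble :=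
      continuous_fst_H1.comp_aestronglyMeasurable ((hp.1 k).1.sub hp.2.1.1)
    have e : (fun x => P.ensembleClass (fun x t => gradient (v k (θ k) t) ((y k x).rep t)) x
        - P.ensembleClass (fun x => (pbar x).rep) x)
        = (fun x => toL2 0 P.T (P.gradError (v k (θ k)) (y k x) (p k x)))
          + fun x => (p k x - pbar x).1.fst := by
      funext x
      rw [Pi.add_apply, hfst, toL2_gradError (hv k)]
      change _ = _ - (p k x).1.fst + ((p k x).1.fst - (pbar x).1.fst)
      rw [sub_add_sub_cancel]
      rfl
    rw [e]
    refine (eLpNorm_add_le m1 m2 one_le_two).trans ?_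
    gcongr
    exact eLpNorm_mono fun x => (p k x - pbar x).norm_fst_le

end ControlProblem

end

theorem mainTheorem5 {n m : ℕ} (P : ControlProblem n m)
    (M MW MU : ℝ) (hM : 0 < M) (hMW : 0 < MW) (hMU : 0 < MU)
    (ystar : Vec n → P.W)
    (hdyn : P.SmoothDynamics)
    (hval : P.SmoothValue M)
    (hopt : P.OptimalFeedback M ystar)
    (hW : P.w12Norm ystar ≤ ENNReal.ofReal MW)
    (hU : eLpNorm (P.ensembleClass fun x => P.control (P.valueGrad M) (ystar x)) ∞ P.ensemble
      ≤ ENNReal.ofReal MU)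
    {R : ℝ → Type*} [∀ ε, NormedAddCommGroup (R ε)] [∀ ε, InnerProductSpace ℝ (R ε)]
    [∀ ε, FiniteDimensional ℝ (R ε)]
    (V : ∀ ε, R ε → ℝ → Vec n → ℝ)
    (ε₀ : ℝ) (hε₀ : 0 < ε₀) (θ₀ : ∀ ε, R ε)
    (happ : P.ValueApproximation M ε₀ V θ₀)
    (γ : ℝ → ℝ) (hγ : ∀ ε ∈ Set.Ioc 0 ε₀, 0 < γ ε)
    (hγθ : (fun ε => γ ε * ‖θ₀ ε‖ ^ 2) =O[𝓝[>] (0 : ℝ)] fun ε => ε)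
    (ε : ℕ → ℝ) (hε_mem : ∀ k, ε k ∈ Set.Ioc 0 ε₀) (hε_anti : StrictAnti ε)
    (hε_lim : Tendsto ε atTop (𝓝 0))
    (y p : ℕ → Vec n → P.W) (θ : ∀ k, R (ε k))
    (hmin : ∀ k, P.IsMinimizer (V (ε k)) M MW MU (γ (ε k)) (y k) (p k) (θ k))
    (ybar pbar : Vec n → P.W) (ubar : Vec n → ℝ → Vec m)
    (hy : P.TendstoTraj y ybar) (hp : P.TendstoTraj p pbar)
    (hu : P.TendstoEnsemble
      (fun k x => P.control (fun t => gradient (V (ε k) (θ k) t)) (y k x)) ubar)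
    (hγ₁ : 0 < P.γ₁) (hγ₂ : 0 < P.γ₂) :
    P.TendstoEnsemble (fun k x t => V (ε k) (θ k) t ((y k x).rep t))
        (fun x t => P.value t ((ybar x).rep t)) ∧
      P.TendstoEnsemble (fun k x t => gradient (V (ε k) (θ k) t) ((y k x).rep t))
        (fun x => (pbar x).rep) := by
  have hw := fun k => ControlProblem.contDiff_slice (happ.smooth (ε k) (hε_mem k)) (θ k)
  have hadm := fun k => (hmin k).1
  have hint := fun k => ControlProblem.integrable_of_continuousOn
    (ControlProblem.continuousOn_excess hdyn hopt hM.le hval (hw k) (hadm k).y_smooth.continuousOn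
      (hadm k).p_cont)
  have hexc := ControlProblem.tendsto_integral_excess hM hMW hMU hdyn hval hopt hW hU happ hγ hγθ
    hε_mem hε_lim hmin
  exact ⟨ControlProblem.tendstoEnsemble_value hdyn hM.le hMU.le hw hadm hint hexc hy hu hγ₁,
    ControlProblem.tendstoEnsemble_gradient hdyn hw hadm hint hexc hp hγ₂⟩
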